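/- Let $(M,h)$ be a Riemannian manifold of dimension $n\ge 3$ that is Einstein with the normalization $\mathrm{Ric}(h)=\tfrac{2J}{n}(n-1)h$ for a constant $J\in\mathbb R$. Let $g_+=r^{-2}\big(dr^2+(1-\tfrac{J}{2n}r^2)^2h\big)$ on $M\times(0,\varepsilon)$, let $p\ge 0$ be an integer, $\lambda\in\mathbb C$, $\beta:=n-2p$. For a metric $g$ write $\Delta^g=d\delta^g+\delta^g d$ for the form Laplacian, $\delta^g$ being the codifferential (the formal adjoint of $d$). Let $\omega_j^{(+)}\in\Omega^p(M)$ and $\omega_j^{(-)}\in\Omega^{p-1}(M)$, $j\ge 0$, be smooth complex-valued forms ($\Omega^{-1}(M)=0$), put $\omega_j^{(\pm)}=0$ for $j<0$, and consider the formal series $$\omega=\sum_{j\ge 0} r^{\lambda+j}\omega_j^{(+)}+\tfrac{dr}{r}\wedge\sum_{j\ge 0}r^{\lambda+j}\omega_j^{(-)} .$$ One says that $\omega$ solves the eigenequation $\Delta^{g_+}\omega=\lambda(n-2p-\lambda)\,\omega$ if it does so as a formal series, i.e. if for every $N$ the partial sum over $j\le N$ solves it up to an error both of whose components in the splitting $\rho=\rho^{(+)}+\tfrac{dr}{r}\wedge\rho^{(-)}$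 are $O(r^{\lambda+N+1})$ as $r\to 0^+$, pointwise on $M$. (1) If $\omega_0^{(-)}=0$, then $\omega$ solves the eigenequation if and only if for all $j\ge 1$ $$A_j\omega^{(-)}_j=B_j\tfrac{J}{2n}\omega^{(-)}_{j-2}+C_j(\tfrac{J}{2n})^2\omega^{(-)}_{j-4}+D_j(\tfrac{J}{2n})^3\omega^{(-)}_{j-6}+\Delta^h\omega^{(-)}_{j-2}-\tfrac{J}{2n}\Delta^h\omega^{(-)}_{j-4}+2\delta^h\omega^{(+)}_{j-2}+2\tfrac{J}{2n}\delta^h\omega^{(+)}_{j-4},$$ $$a_j\omega^{(+)}_j=b_j\tfrac{J}{2n}\omega^{(+)}_{j-2}+c_j(\tfrac{J}{2n})^2\omega^{(+)}_{j-4}+\Delta^h\omega^{(+)}_{j-2}+2d\omega^{(-)}_j-2(\tfrac{J}{2n})^2d\omega^{(-)}_{j-4},$$ where $$\begin{aligned} A_j&=-[(j-2)(\beta-2\lambda-j+2)+2(\beta-\lambda-j+2)],\\ B_j&=-3[(j-4)(\beta-2\lambda-j+4)+2(\beta-\lambda-j+4)]+2(\beta+2)(\lambda+j),\\ C_j&=3[(j-6)(\beta-2\lambda-j+6)+2(\beta-\lambda-j+6)]-4(\beta+2)(\lambda+j-3),\\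 D_j&=-[(j-8)(\beta-2\lambda-j+8)+2(\beta-\lambda-j+8)]+2(\beta+2)(\lambda+j-6),\\ a_j&=-j(\beta-2\lambda-j),\\ b_j&=2[(j-2)(\lambda+j-2)+\lambda(\beta+j-2)],\\ c_j&=-(2\lambda+j-4)(\beta+j-4). \end{aligned}$$ (2) If $\lambda\ne 0$, every solution $\omega$ of the eigenequation has $\omega_0^{(-)}=0$. (3) Let $\omega$ be a solution of the eigenequation with $\omega_0^{(-)}=0$. If $m\ge 0$ is such that $a_i\ne 0$ and (in case $p\ge 1$) $A_i\neq 0$ for all odd $i\le m$, then $\omega_i^{(\pm)}=0$ for all odd $i\le m$; in particular all odd coefficients vanish if $a_i\ne0$ and (in case $p\ge 1$) $A_i\ne 0$ for all odd $i\ge 1$. For arbitrary $\lambda$, replacing all $\omega^{(\pm)}_i$ with $i$ odd by $0$ again gives a solution of the eigenequation. -/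

import Mathlib

open scoped Manifold ContDiff Topology

noncomputable section

namespace FormLaplace

/-! ### Local coordinate expressions on a finite-dimensional vector space

`E` is the target of a coordinate chart, `b` the basis of coordinate vectors `∂_i`, `G y` the matrix
`(g_ij)` of a metric at `y`. Forms are complex valued. -/

section Local

variable {E : Type*} [NormedAddCommGroup E] [NormedSpace ℝ E] [FiniteDimensional ℝ E]
  {ι : Type*} [Fintype ι] [DecidableEq ι]

/-- The endomorphism of `E` with matrix `A` in the basis `b`. -/
def matEnd (b : Module.Basis ι ℝ E) (A : Matrix ι ι ℝ) : E →L[ℝ] E :=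
  LinearMap.toContinuousLinearMap (Matrix.toLin b b A)

/-- The codifferential of a `(k+1)`-form in local coordinates:
`(δω)_{i₁…i_k} = - |g|^{-1/2} g_{i₁j₁} ⋯ g_{i_kj_k} ∂_a (|g|^{1/2} ω^{a j₁…j_k})`,
the formal adjoint of `d`, that is `(-1)^{k+1} ⋆⁻¹ d ⋆` on `(k+1)`-forms.
Composition with `matEnd b (G z)⁻¹` raises all indices and composition with `matEnd b (G y)`
lowers them. -/
def codiffLocal (b : Module.Basis ι ℝ E) (G : E → Matrix ι ι ℝ) {k : ℕ}
    (w : E → E [⋀^Fin (k + 1)]→L[ℝ] ℂ) (y : E) : E [⋀^Fin k]→L[ℝ] ℂ :=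
  -((√(G y).det)⁻¹ • ∑ a : ι,
    ((fderiv ℝ (fun z => √(G z).det • (w z).compContinuousLinearMap (matEnd b (G z)⁻¹)) y
      (b a)).curryLeft (b a)).compContinuousLinearMap (matEnd b (G y)))

/-- The form Laplacian `dδ + δd` in local coordinates (with `δ = 0` on functions). -/
def laplacianLocal (b : Module.Basis ι ℝ E) (G : E → Matrix ι ι ℝ) :
    {k : ℕ} → (E → E [⋀^Fin k]→L[ℝ] ℂ) → E → E [⋀^Fin k]→L[ℝ] ℂ
  | 0, w => codiffLocal b G (extDeriv w)
  | _ + 1, w => extDeriv (codiffLocal b G w) + codiffLocal b G (extDeriv w)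

/-- The coordinate derivative `∂_i f` at `y`. -/
def partialDeriv (b : Module.Basis ι ℝ E) (i : ι) (f : E → ℝ) (y : E) : ℝ :=
  fderiv ℝ f y (b i)

/-- The Christoffel symbol `Γ^k_{ij}` of the Levi-Civita connection of `G`. -/
def christoffel (b : Module.Basis ι ℝ E) (G : E → Matrix ι ι ℝ) (k i j : ι) (y : E) : ℝ :=
  (1 / 2) * ∑ l, (G y)⁻¹ k l *
    (partialDeriv b i (fun z => G z j l) y + partialDeriv b j (fun z => G z i l) y
      - partialDeriv b l (fun z => G z i j) y)

/-- The component `R_{ij}` of the Ricci tensor of `G` (positive on round spheres). -/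
def ricciLocal (b : Module.Basis ι ℝ E) (G : E → Matrix ι ι ℝ) (i j : ι) (y : E) : ℝ :=
  ∑ k, (partialDeriv b k (christoffel b G k i j) y - partialDeriv b i (christoffel b G k k j) y
    + ∑ l, (christoffel b G k k l y * christoffel b G l i j y
      - christoffel b G k i l y * christoffel b G l k j y))

end Local

/-! ### Forms and metrics on manifolds without boundary

All operators are local and invariant under coordinate changes; their value at a point `x` is given
by their expression in the chart around `x`. -/

section Manifold

variable {E : Type*} [NormedAddCommGroup E] [NormedSpace ℝ E] [FiniteDimensional ℝ E]
  {ι : Type*} [Fintype ι] [DecidableEq ι]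
  {H : Type*} [TopologicalSpace H] (I : ModelWithCorners ℝ E H)
  (M : Type*) [TopologicalSpace M] [ChartedSpace H M]

/-- Complex valued differential `k`-forms on `M`, not necessarily smooth. -/
abbrev Form (k : ℕ) : Type _ := (x : M) → TangentSpace I x [⋀^Fin k]→L[ℝ] ℂ

/-- Differential `(p-1)`-forms on `M`: for `p = q + 1` such an object is a `q`-form, while
for `p = 0` there is only the object `0`. -/
abbrev PredForm (p : ℕ) : Type _ := (q : {q : ℕ // q + 1 = p}) → Form I M q

/-- Fields of bilinear forms on the tangent spaces of `M`. -/
abbrev MetricField : Type _ := (x : M) → TangentSpace I x → TangentSpace I x → ℝ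

variable {I M}

/-- The expression of `ω` in the chart around `x₀`: its pullback by the inverse chart. -/
def Form.inChart {k : ℕ} (w : Form I M k) (x₀ : M) (y : E) : E [⋀^Fin k]→L[ℝ] ℂ :=
  (w ((extChartAt I x₀).symm y)).compContinuousLinearMap
    (mfderiv 𝓘(ℝ, E) I (extChartAt I x₀).symm y)

/-- The matrix `(g_ij)` of `g` in the chart around `x₀`. -/
def MetricField.inChart (b : Module.Basis ι ℝ E) (g : MetricField I M) (x₀ : M) (y : E) :
    Matrix ι ι ℝ :=
  Matrix.of fun i j => g ((extChartAt I x₀).symm y)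
    (mfderiv 𝓘(ℝ, E) I (extChartAt I x₀).symm y (b i))
    (mfderiv 𝓘(ℝ, E) I (extChartAt I x₀).symm y (b j))

/-- The alternating form on `T_x M` that corresponds to `η` in the chart around `x`. -/
def fromChart {k : ℕ} (x : M) (η : E [⋀^Fin k]→L[ℝ] ℂ) : TangentSpace I x [⋀^Fin k]→L[ℝ] ℂ :=
  η.compContinuousLinearMap (mfderiv I 𝓘(ℝ, E) (extChartAt I x) x)

/-- Smoothness of a form. -/
def Form.IsSmooth {k : ℕ} (w : Form I M k) : Prop :=
  ∀ x₀ : M, ContDiffOn ℝ ∞ (w.inChart x₀) (extChartAt I x₀).target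

/-- Smoothness of a `(p-1)`-form. -/
def PredForm.IsSmooth {p : ℕ} (η : PredForm I M p) : Prop :=
  ∀ q : {q : ℕ // q + 1 = p}, Form.IsSmooth (η q)

/-- The exterior derivative. -/
def Form.d {k : ℕ} (w : Form I M k) : Form I M (k + 1) :=
  fun x => fromChart x (extDeriv (w.inChart x) (extChartAt I x x))

/-- The codifferential with respect to `g`. -/
def Form.codiff (b : Module.Basis ι ℝ E) (g : MetricField I M) {k : ℕ}
    (w : Form I M (k + 1)) : Form I M k :=
  fun x => fromChart x (codiffLocal b (g.inChart b x) (w.inChart x) (extChartAt I x x))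

/-- The form Laplacian `dδ + δd` with respect to `g`. -/
def Form.laplacian (b : Module.Basis ι ℝ E) (g : MetricField I M) {k : ℕ}
    (w : Form I M k) : Form I M k :=
  fun x => fromChart x (laplacianLocal b (g.inChart b x) (w.inChart x) (extChartAt I x x))

/-- The exterior derivative of a `(p-1)`-form. -/
def PredForm.d : {p : ℕ} → PredForm I M p → Form I M p
  | 0, _ => 0
  | q + 1, η => Form.d (η ⟨q, rfl⟩)

/-- The codifferential of a `p`-form as a `(p-1)`-form. -/
def Form.codiffPred (b : Module.Basis ι ℝ E) (g : MetricField I M) {p : ℕ}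
    (w : Form I M p) : PredForm I M p :=
  fun q => match p, q, w with
    | _, ⟨_, rfl⟩, w => Form.codiff b g w

/-- The form Laplacian of a `(p-1)`-form. -/
def PredForm.laplacian (b : Module.Basis ι ℝ E) (g : MetricField I M) {p : ℕ}
    (η : PredForm I M p) : PredForm I M p :=
  fun q => Form.laplacian b g (η q)

/-- `Ric(g) = c g`. -/
def IsEinstein (b : Module.Basis ι ℝ E) (g : MetricField I M) (c : ℝ) : Prop :=
  ∀ (x : M) (i j : ι), ricciLocal b (g.inChart b x) i j (extChartAt I x x)
    = c * g.inChart b x (extChartAt I x x) i j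

end Manifold

/-! ### The Poincaré–Einstein space

`X = M × (0, ε)` is regarded as an open subset of the manifold `M × ℝ`, with points `(x, r)` and
tangent spaces `T_x M × ℝ`. Only germs at `r = 0+` matter below, so `ε` does not appear. -/

section Poincare

variable {n : ℕ} {M : Type*} [TopologicalSpace M] [ChartedSpace (EuclideanSpace ℝ (Fin n)) M]

/-- The coordinate basis for charts of `M`. -/
abbrev coordM (n : ℕ) : Module.Basis (Fin n) ℝ (EuclideanSpace ℝ (Fin n)) :=
  (EuclideanSpace.basisFun (Fin n) ℝ).toBasis

/-- The coordinate basis for charts of `M × ℝ`. -/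
abbrev coordX (n : ℕ) : Module.Basis (Fin n ⊕ Unit) ℝ (EuclideanSpace ℝ (Fin n) × ℝ) :=
  (coordM n).prod (Module.Basis.singleton Unit ℝ)

/-- The metric `r⁻² (dr² + (1 - κ r²)² h)`. -/
def poincareMetric (h : MetricField (𝓡 n) M) (κ : ℝ) :
    MetricField ((𝓡 n).prod 𝓘(ℝ, ℝ)) (M × ℝ) :=
  fun z (u v : EuclideanSpace ℝ (Fin n) × ℝ) =>
    (z.2 ^ 2)⁻¹ * (u.2 * v.2 + (1 - κ * z.2 ^ 2) ^ 2 * h z.1 u.1 v.1)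

/-- The pullback of a form on `M` to `M × ℝ` by the projection. -/
def pullM {k : ℕ} (w : Form (𝓡 n) M k) : Form ((𝓡 n).prod 𝓘(ℝ, ℝ)) (M × ℝ) k :=
  fun z => (w z.1).compContinuousLinearMap
    (ContinuousLinearMap.fst ℝ (EuclideanSpace ℝ (Fin n)) ℝ)

/-- The wedge product `dr ∧ η` of forms on `M × ℝ`:
`(dr ∧ η)(v₀, …, v_q) = ∑ (-1)^i dr(v_i) η(v₀, …, v̂_i, …, v_q)`. -/
def drWedge {q : ℕ} (η : Form ((𝓡 n).prod 𝓘(ℝ, ℝ)) (M × ℝ) q) :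
    Form ((𝓡 n).prod 𝓘(ℝ, ℝ)) (M × ℝ) (q + 1) :=
  fun z => ContinuousAlternatingMap.alternatizeUncurryFin (E := EuclideanSpace ℝ (Fin n) × ℝ)
    ((ContinuousLinearMap.snd ℝ (EuclideanSpace ℝ (Fin n)) ℝ).smulRight
      (show (EuclideanSpace ℝ (Fin n) × ℝ) [⋀^Fin q]→L[ℝ] ℂ from η z))

/-- The `p`-form `dr ∧ η` on `M × ℝ` for a `(p-1)`-form `η` on `M`. -/
def drWedgePull : {p : ℕ} → PredForm (𝓡 n) M p → Form ((𝓡 n).prod 𝓘(ℝ, ℝ)) (M × ℝ) p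
  | 0, _ => 0
  | q + 1, η => drWedge (pullM (η ⟨q, rfl⟩))

/-- The partial sum
`∑_{j ≤ N} r^{λ+j} ω⁺_j + (dr / r) ∧ ∑_{j ≤ N} r^{λ+j} ω⁻_j` (relevant for `r > 0`). -/
def ansatz {p : ℕ} (lam : ℂ) (wp : ℕ → Form (𝓡 n) M p) (wm : ℕ → PredForm (𝓡 n) M p) (N : ℕ) :
    Form ((𝓡 n).prod 𝓘(ℝ, ℝ)) (M × ℝ) p :=
  fun z => ∑ j ∈ Finset.range (N + 1),
    ((z.2 : ℂ) ^ (lam + j)) • (pullM (wp j) z + ((z.2 : ℂ)⁻¹) • drWedgePull (wm j) z)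

/-- The tuple `(v_i + s_i r∂_r)_i` of tangent vectors at `(x, r)`, for `v_i ∈ T_x M`, `s_i ∈ ℝ`. -/
def frame {p : ℕ} {x : M} (v : Fin p → TangentSpace (𝓡 n) x) (s : Fin p → ℝ) (r : ℝ) :
    Fin p → TangentSpace ((𝓡 n).prod 𝓘(ℝ, ℝ)) ((x, r) : M × ℝ) :=
  fun i => ((v i, s i * r) : EuclideanSpace ℝ (Fin n) × ℝ)

/-- The formal series `ω = ∑ r^{λ+j} ω⁺_j + (dr / r) ∧ ∑ r^{λ+j} ω⁻_j` solves
`Δ ω = λ (n - 2p - λ) ω` for the metric `r⁻² (dr² + (1 - κ r²)² h)`: for every `N` the partial sum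
up to `r^{λ+N}` solves the equation up to `O(r^{λ+N+1})` as `r → 0+`, where both components in the
splitting `ρ = ρ⁺ + (dr / r) ∧ ρ⁻` of the error are measured, by inserting vectors
`v_i + s_i r∂_r`. Since the operator has a power series expansion in `r` in this splitting, this says
that all the coefficients of `r^{λ+j}` in the formal series `Δ ω - λ (n - 2p - λ) ω` vanish. -/
def IsFormalEigenform {p : ℕ} (h : MetricField (𝓡 n) M) (κ : ℝ) (lam : ℂ)
    (wp : ℕ → Form (𝓡 n) M p) (wm : ℕ → PredForm (𝓡 n) M p) : Prop :=
  ∀ (N : ℕ) (x : M) (v : Fin p → TangentSpace (𝓡 n) x) (s : Fin p → ℝ),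
    (fun r : ℝ =>
      Form.laplacian (coordX n) (poincareMetric h κ) (ansatz lam wp wm N) (x, r) (frame v s r)
        - lam * ((n : ℂ) - 2 * p - lam) * ansatz lam wp wm N (x, r) (frame v s r))
      =O[𝓝[>] 0] (fun r : ℝ => (r : ℂ) ^ (lam + (N + 1)))

end Poincare

/-! ### The recurrence relations -/

section Recurrence

def coeffA (β lam : ℂ) (j : ℕ) : ℂ :=
  -((j - 2) * (β - 2 * lam - j + 2) + 2 * (β - lam - j + 2))

def coeffB (β lam : ℂ) (j : ℕ) : ℂ :=
  -3 * ((j - 4) * (β - 2 * lam - j + 4) + 2 * (β - lam - j + 4)) + 2 * (β + 2) * (lam + j)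

def coeffC (β lam : ℂ) (j : ℕ) : ℂ :=
  3 * ((j - 6) * (β - 2 * lam - j + 6) + 2 * (β - lam - j + 6)) - 4 * (β + 2) * (lam + j - 3)

def coeffD (β lam : ℂ) (j : ℕ) : ℂ :=
  -((j - 8) * (β - 2 * lam - j + 8) + 2 * (β - lam - j + 8)) + 2 * (β + 2) * (lam + j - 6)

def coeffa (β lam : ℂ) (j : ℕ) : ℂ :=
  -(j * (β - 2 * lam - j))

def coeffb (β lam : ℂ) (j : ℕ) : ℂ :=
  2 * ((j - 2) * (lam + j - 2) + lam * (β + j - 2))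

def coeffc (β lam : ℂ) (j : ℕ) : ℂ :=
  -((2 * lam + j - 4) * (β + j - 4))

/-- The term `w_{j-k}` of a sequence, which is `0` if `j < k`. -/
def back {V : Type*} [Zero V] (w : ℕ → V) (k j : ℕ) : V :=
  if k ≤ j then w (j - k) else 0

variable {n : ℕ} {M : Type*} [TopologicalSpace M] [ChartedSpace (EuclideanSpace ℝ (Fin n)) M]

/-- The recurrence relation for `ω⁻_j`. -/
def MinusRecurrence {p : ℕ} (h : MetricField (𝓡 n) M) (κ : ℝ) (lam : ℂ)
    (wp : ℕ → Form (𝓡 n) M p) (wm : ℕ → PredForm (𝓡 n) M p) (j : ℕ) : Prop :=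
  let β : ℂ := (n : ℂ) - 2 * p
  coeffA β lam j • wm j =
    (coeffB β lam j * κ) • back wm 2 j + (coeffC β lam j * κ ^ 2) • back wm 4 j
      + (coeffD β lam j * κ ^ 3) • back wm 6 j
      + PredForm.laplacian (coordM n) h (back wm 2 j)
      - (κ : ℂ) • PredForm.laplacian (coordM n) h (back wm 4 j)
      + (2 : ℂ) • Form.codiffPred (coordM n) h (back wp 2 j)
      + (2 * κ : ℂ) • Form.codiffPred (coordM n) h (back wp 4 j)

/-- The recurrence relation for `ω⁺_j`. -/
def PlusRecurrence {p : ℕ} (h : MetricField (𝓡 n) M) (κ : ℝ) (lam : ℂ)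
    (wp : ℕ → Form (𝓡 n) M p) (wm : ℕ → PredForm (𝓡 n) M p) (j : ℕ) : Prop :=
  let β : ℂ := (n : ℂ) - 2 * p
  coeffa β lam j • wp j =
    (coeffb β lam j * κ) • back wp 2 j + (coeffc β lam j * κ ^ 2) • back wp 4 j
      + Form.laplacian (coordM n) h (back wp 2 j)
      + (2 : ℂ) • PredForm.d (wm j)
      - (2 * κ ^ 2 : ℂ) • PredForm.d (back wm 4 j)

end Recurrence

end FormLaplace

end

open FormLaplace

set_option linter.unusedSectionVars false

/-! ### Exterior algebra with a covector -/

noncomputable section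

namespace FormLaplace

open ContinuousAlternatingMap

section Wedge

variable {V V' : Type*} [NormedAddCommGroup V] [NormedSpace ℝ V]
  [NormedAddCommGroup V'] [NormedSpace ℝ V'] {k : ℕ}

/-! The metric is a warped product `r⁻² dr² + f(r)² h` with `f = (1 - κ r²) / r` and `κ = J / (2n)`,
so its form Laplacian can be computed exactly on separated forms. Put `u = -r f' / f = (1 + κ r²) /
(1 - κ r²)`. Then `Δ(c α) = f⁻² c Δα - T α + (2u / r) f⁻² c dr ∧ δα` and `Δ(c dr ∧ η) = f⁻² c dr ∧
Δη - t dr ∧ η + 2 r u c dη`, where `T` and `t` are second-order differential expressions in `c(r)`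
(`laplacianLocal_prodPull_succ`, `laplacianLocal_prodWedge`). For a power `c = r^L` each coefficient
in the `dr / r` splitting is `r^L` times a rational function of `r²` whose denominator is a power of
`1 - κ r²`. Charts of `M × ℝ` are charts of `M` times the identity, so these local formulas give the
Laplacian of the partial sums (`laplacian_ansatz_frame`).

Multiply the tangential error by `(1 - κ r²)²`, the normal error by `(1 - κ r²)³`, and divide by
`r^λ`: both become polynomials in `r`. The factors tend to `1`, so the error estimate is unaffected,
and a polynomial is `O(r^(N+1))` exactly when its coefficients up to index `N` vanish
(`isBigO_term_iff`). Coefficient `m` involves only `ω_j` with `j ≤ m`, so truncation at `N ≥ m` is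
harmless; its vanishing is the recurrence at index `m` (`sum_back_plusPoly`, `sum_back_minusPoly`).
Hence the eigenequation is equivalent to all recurrences, index `0` included
(`isFormalEigenform_iff`).

At index `0` the normal recurrence reads `-2λ ω⁻_0 = 0` and the tangential one `0 = 2 dω⁻_0`. So
index `0` imposes nothing if `ω⁻_0 = 0`, and it forces `ω⁻_0 = 0` if `λ ≠ 0`. All index shifts in
the recurrences are even, so even and odd coefficients decouple: the odd ones vanish inductively
while `A_i` and `a_i` are invertible (`odd_eq_zero`), and they can always be replaced by zero
(`recurrence_even_part`). -/

theorem alt_zero_smul_real (μ : V [⋀^Fin k]→L[ℝ] ℂ) : (0 : ℝ) • μ = 0 := zero_smul ℝ μ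

theorem alt_smul_zero (c : ℂ) : c • (0 : V [⋀^Fin k]→L[ℝ] ℂ) = 0 :=
  ContinuousAlternatingMap.ext fun _ => mul_zero c

theorem alt_smul_zero_real (c : ℝ) : c • (0 : V [⋀^Fin k]→L[ℝ] ℂ) = 0 :=
  ContinuousAlternatingMap.ext fun _ => smul_zero c

theorem alt_smul_add_real (c : ℝ) (μ ν : V [⋀^Fin k]→L[ℝ] ℂ) : c • (μ + ν) = c • μ + c • ν :=
  ContinuousAlternatingMap.ext fun _ => smul_add c _ _

theorem alt_add_smul (c d : ℂ) (μ : V [⋀^Fin k]→L[ℝ] ℂ) : (c + d) • μ = c • μ + d • μ :=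
  add_smul c d μ

theorem alt_neg_smul (c : ℂ) (μ : V [⋀^Fin k]→L[ℝ] ℂ) : (-c) • μ = -(c • μ) := neg_smul c μ

theorem alt_real_smul (c : ℝ) (μ : V [⋀^Fin k]→L[ℝ] ℂ) : c • μ = (c : ℂ) • μ := by
  ext v
  simp

/-- The wedge product `ℓ ∧ μ` of a covector with an alternating form. -/
def covWedge (ℓ : V →L[ℝ] ℝ) (μ : V [⋀^Fin k]→L[ℝ] ℂ) : V [⋀^Fin (k + 1)]→L[ℝ] ℂ :=
  alternatizeUncurryFin (ℓ.smulRight μ)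

/-- `covWedge ℓ` as a continuous linear map. -/
def covWedgeL (k : ℕ) (ℓ : V →L[ℝ] ℝ) :
    (V [⋀^Fin k]→L[ℝ] ℂ) →L[ℝ] (V [⋀^Fin (k + 1)]→L[ℝ] ℂ) :=
  (alternatizeUncurryFinCLM ℝ V ℂ) ∘L
    (ContinuousLinearMap.smulRightL ℝ V (V [⋀^Fin k]→L[ℝ] ℂ) ℓ)

theorem covWedgeL_apply (ℓ : V →L[ℝ] ℝ) (μ : V [⋀^Fin k]→L[ℝ] ℂ) :
    covWedgeL k ℓ μ = covWedge ℓ μ := rfl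

theorem covWedge_apply (ℓ : V →L[ℝ] ℝ) (μ : V [⋀^Fin k]→L[ℝ] ℂ) (v : Fin (k + 1) → V) :
    covWedge ℓ μ v = ∑ i : Fin (k + 1), (-1 : ℤ) ^ (i : ℕ) • (ℓ (v i) • μ (i.removeNth v)) := by
  simp [covWedge, alternatizeUncurryFin_apply]

theorem covWedge_smul (ℓ : V →L[ℝ] ℝ) (c : ℂ) (μ : V [⋀^Fin k]→L[ℝ] ℂ) :
    covWedge ℓ (c • μ) = c • covWedge ℓ μ := by
  ext v
  simp only [covWedge_apply, ContinuousAlternatingMap.smul_apply, Finset.smul_sum]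
  refine Finset.sum_congr rfl fun i _ => ?_
  rw [smul_comm (ℓ (v i)) c, smul_comm _ c]

theorem covWedge_zero (ℓ : V →L[ℝ] ℝ) : covWedge ℓ (0 : V [⋀^Fin k]→L[ℝ] ℂ) = 0 :=
  (covWedgeL k ℓ).map_zero

theorem covWedge_neg (ℓ : V →L[ℝ] ℝ) (μ : V [⋀^Fin k]→L[ℝ] ℂ) :
    covWedge ℓ (-μ) = -covWedge ℓ μ :=
  (covWedgeL k ℓ).map_neg μ

theorem covWedge_comp (ℓ : V →L[ℝ] ℝ) (μ : V [⋀^Fin k]→L[ℝ] ℂ) (A : V' →L[ℝ] V) :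
    (covWedge ℓ μ).compContinuousLinearMap A
      = covWedge (ℓ ∘L A) (μ.compContinuousLinearMap A) := by
  ext v
  simp only [covWedge_apply, compContinuousLinearMap_apply]
  rfl

theorem covWedge_smul_left (c : ℝ) (ℓ : V →L[ℝ] ℝ) (μ : V [⋀^Fin k]→L[ℝ] ℂ) :
    covWedge (c • ℓ) μ = c • covWedge ℓ μ := by
  ext v
  simp only [covWedge_apply, ContinuousAlternatingMap.smul_apply, Finset.smul_sum, _root_.smul_apply]
  refine Finset.sum_congr rfl fun i _ => ?_
  rw [smul_assoc, smul_comm _ c]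

/-- Interior product of `ℓ ∧ μ` for a form `μ` of positive degree. -/
theorem curryLeft_covWedge (ℓ : V →L[ℝ] ℝ) (μ : V [⋀^Fin (k + 1)]→L[ℝ] ℂ) (e : V) :
    (covWedge ℓ μ).curryLeft e = ℓ e • μ - covWedge ℓ (μ.curryLeft e) := by
  ext v
  simp only [curryLeft_apply_apply, ContinuousAlternatingMap.sub_apply, ContinuousAlternatingMap.smul_apply, covWedge_apply]
  rw [Fin.sum_univ_succ]
  simp only [Matrix.cons_val_zero, Matrix.cons_val_succ, Fin.val_zero, pow_zero, one_smul,
    Fin.val_succ, pow_succ, mul_neg_one, neg_smul, Finset.sum_neg_distrib, sub_eq_add_neg]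
  congr 2
  refine Finset.sum_congr rfl fun i _ => ?_
  congr 3
  ext j
  refine Fin.cases ?_ (fun j => ?_) j <;> simp [Fin.removeNth, Matrix.vecCons]

theorem curryLeft_covWedge_zero (ℓ : V →L[ℝ] ℝ) (μ : V [⋀^Fin 0]→L[ℝ] ℂ) (e : V) :
    (covWedge ℓ μ).curryLeft e = ℓ e • μ := by
  ext v
  simp only [curryLeft_apply_apply, ContinuousAlternatingMap.smul_apply, covWedge_apply, Fin.sum_univ_succ]
  simp

theorem alternatizeUncurryFin_comp (f : V →L[ℝ] V [⋀^Fin k]→L[ℝ] ℂ) (A : V' →L[ℝ] V) :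
    alternatizeUncurryFin ((compContinuousLinearMapCLM A) ∘L f ∘L A)
      = (alternatizeUncurryFin f).compContinuousLinearMap A := by
  ext v
  simp only [alternatizeUncurryFin_apply, compContinuousLinearMap_apply]
  rfl

/-- Covectors anticommute: `∑ e^i ∧ ℓ ∧ f(e_i) = - ℓ ∧ ∑ e^i ∧ f(e_i)`. -/
theorem alternatizeUncurryFin_covWedgeL_comp (ℓ : V →L[ℝ] ℝ)
    (f : V →L[ℝ] V [⋀^Fin k]→L[ℝ] ℂ) :
    alternatizeUncurryFin ((covWedgeL k ℓ) ∘L f) = -covWedge ℓ (alternatizeUncurryFin f) := by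
  -- `S x y = ℓ(y) f(x) + ℓ(x) f(y)` is symmetric in `x` and `y`, so its double alternation
  -- vanishes. The two summands alternate to the two sides of the claim.
  set S : V →L[ℝ] V →L[ℝ] V [⋀^Fin k]→L[ℝ] ℂ :=
    (ContinuousLinearMap.smulRightL ℝ V (V [⋀^Fin k]→L[ℝ] ℂ) ℓ) ∘L f + ℓ.smulRight f with hS
  have h0 : alternatizeUncurryFin ((alternatizeUncurryFinCLM ℝ V ℂ) ∘L S) = 0 := by
    apply alternatizeUncurryFin_alternatizeUncurryFinCLM_comp_of_symmetric
    intro x y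
    simp [hS, add_comm]
  have h1 : (alternatizeUncurryFinCLM ℝ V ℂ) ∘L S
      = (covWedgeL k ℓ) ∘L f + ℓ.smulRight (alternatizeUncurryFin f) := by
    ext1 x
    simp only [hS, ContinuousLinearMap.comp_add, _root_.add_apply]
    congr 1
    simp [ContinuousLinearMap.comp_apply]
  rw [h1, alternatizeUncurryFin_add] at h0
  exact eq_neg_of_add_eq_zero_left h0

end Wedge

end FormLaplace

end

/-! ### Smoothness of the local operators -/

noncomputable section

namespace FormLaplace

section Smooth

variable {E : Type*} [NormedAddCommGroup E] [NormedSpace ℝ E] [FiniteDimensional ℝ E]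
  {ι : Type*} [Fintype ι] [DecidableEq ι] {k : ℕ}
  {F : Type*} [NormedAddCommGroup F] [NormedSpace ℝ F]

theorem alternating_eq_of_basis (b : Module.Basis ι ℝ E) {f g : E [⋀^Fin k]→L[ℝ] ℂ}
    (h : ∀ s : Fin k → ι, f (fun i => b (s i)) = g (fun i => b (s i))) : f = g := by
  apply ContinuousAlternatingMap.toAlternatingMap_injective
  apply AlternatingMap.coe_multilinearMap_injective
  exact Module.Basis.ext_multilinear (fun _ => b) h

/-- Smoothness of a form follows from smoothness of its components. -/
theorem contDiffOn_of_components (b : Module.Basis ι ℝ E) {w : F → E [⋀^Fin k]→L[ℝ] ℂ} {S : Set F}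
    (h : ∀ s : Fin k → ι, ContDiffOn ℝ ∞ (fun y => w y (fun i => b (s i))) S) :
    ContDiffOn ℝ ∞ w S := by
  let ev : (E [⋀^Fin k]→L[ℝ] ℂ) →ₗ[ℝ] ((Fin k → ι) → ℂ) :=
    { toFun := fun f s => f (fun i => b (s i))
      map_add' := fun f g => rfl
      map_smul' := fun c f => rfl }
  have hinj : LinearMap.ker ev = ⊥ := by
    rw [LinearMap.ker_eq_bot]
    intro f g hfg
    exact alternating_eq_of_basis b fun s => congrFun hfg s
  -- A linear left inverse of the component map is continuous, by finite dimension, and recovers the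
  -- form smoothly from its components.
  obtain ⟨L, hL⟩ := ev.exists_leftInverse_of_injective hinj
  have h1 : ContDiffOn ℝ ∞ (fun y => ev (w y)) S := contDiffOn_pi.2 h
  have h2 := (LinearMap.toContinuousLinearMap L).contDiff.comp_contDiffOn h1
  refine h2.congr fun y _ => ?_
  exact (LinearMap.congr_fun hL (w y)).symm

theorem contDiffOn_component {w : F → E [⋀^Fin k]→L[ℝ] ℂ} {S : Set F} (hw : ContDiffOn ℝ ∞ w S)
    (v : Fin k → E) : ContDiffOn ℝ ∞ (fun y => w y v) S :=
  (ContinuousAlternatingMap.apply ℝ E ℂ v).contDiff.comp_contDiffOn hw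

theorem matEnd_basis (b : Module.Basis ι ℝ E) (A : Matrix ι ι ℝ) (i : ι) :
    matEnd b A (b i) = ∑ j, A j i • b j := by
  simp [matEnd, Matrix.toLin_self]

/-- By multilinearity, the components of the pulled-back form are polynomials in the matrix entries
with the components of `w` as coefficients. -/
theorem contDiffOn_comp_matEnd (b : Module.Basis ι ℝ E) {w : F → E [⋀^Fin k]→L[ℝ] ℂ}
    {A : F → Matrix ι ι ℝ} {S : Set F} (hw : ContDiffOn ℝ ∞ w S)
    (hA : ∀ i j, ContDiffOn ℝ ∞ (fun y => A y i j) S) :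
    ContDiffOn ℝ ∞ (fun y => (w y).compContinuousLinearMap (matEnd b (A y))) S := by
  refine contDiffOn_of_components b fun s => ?_
  have h : ∀ y, (w y).compContinuousLinearMap (matEnd b (A y)) (fun i => b (s i))
      = ∑ t : Fin k → ι, (∏ i, A y (t i) (s i)) • w y (fun i => b (t i)) := by
    intro y
    rw [ContinuousAlternatingMap.compContinuousLinearMap_apply]
    have : (⇑(matEnd b (A y)) ∘ fun i => b (s i)) = fun i => ∑ j, A y j (s i) • b j := by
      funext i
      exact matEnd_basis b (A y) (s i)
    rw [this, ContinuousAlternatingMap.map_sum]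
    exact Finset.sum_congr rfl fun t _ => (w y).map_smul_univ _ _
  simp only [h]
  refine ContDiffOn.sum fun t _ => ?_
  have h1 : ContDiffOn ℝ ∞ (fun y => ∏ i, A y (t i) (s i)) S := contDiffOn_prod fun i _ => hA _ _
  exact h1.smul (contDiffOn_component hw fun i => b (t i))

theorem contDiffOn_det {A : F → Matrix ι ι ℝ} {S : Set F}
    (hA : ∀ i j, ContDiffOn ℝ ∞ (fun y => A y i j) S) :
    ContDiffOn ℝ ∞ (fun y => (A y).det) S := by
  simp only [Matrix.det_apply]
  refine ContDiffOn.sum fun σ _ => ?_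
  exact (contDiffOn_prod fun i _ => hA _ _).const_smul _

/-- Cramer's rule: the entries of the inverse are determinants of smooth matrices divided by the
nonvanishing determinant. -/
theorem contDiffOn_inv {A : F → Matrix ι ι ℝ} {S : Set F}
    (hA : ∀ i j, ContDiffOn ℝ ∞ (fun y => A y i j) S) (hdet : ∀ y ∈ S, 0 < (A y).det) (i j : ι) :
    ContDiffOn ℝ ∞ (fun y => (A y)⁻¹ i j) S := by
  simp only [Matrix.inv_def, Ring.inverse_eq_inv', Matrix.smul_apply, Matrix.adjugate_apply]
  refine ContDiffOn.smul ((contDiffOn_det hA).inv fun y hy => (hdet y hy).ne') ?_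
  refine contDiffOn_det fun i' j' => ?_
  by_cases h : i' = j
  · subst h
    simp only [Matrix.updateRow_self]
    exact contDiffOn_const
  · simp only [Matrix.updateRow_ne h]
    exact hA i' j'

/-- Smooth matrix fields on an open set with positive determinant. -/
structure IsMetricOn (G : E → Matrix ι ι ℝ) (S : Set E) : Prop where
  isOpen : IsOpen S
  smooth : ∀ i j, ContDiffOn ℝ ∞ (fun y => G y i j) S
  det_pos : ∀ y ∈ S, 0 < (G y).det

/-- The form `w` with all indices raised, multiplied by the volume density. -/
def raised (b : Module.Basis ι ℝ E) (G : E → Matrix ι ι ℝ) (w : E → E [⋀^Fin k]→L[ℝ] ℂ) (z : E) :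
    E [⋀^Fin k]→L[ℝ] ℂ :=
  √(G z).det • (w z).compContinuousLinearMap (matEnd b (G z)⁻¹)

/-- The divergence `∂_a u^a`. -/
def diverg (b : Module.Basis ι ℝ E) (u : E → E [⋀^Fin (k + 1)]→L[ℝ] ℂ) (y : E) :
    E [⋀^Fin k]→L[ℝ] ℂ :=
  ∑ a : ι, (fderiv ℝ u y (b a)).curryLeft (b a)

/-- The lowering matrix is evaluated at the fixed point `y`, so lowering commutes with the sum over
`a`. This exhibits `δ` as raising, flat divergence and lowering, three operations that can be
computed separately on a product. -/
theorem codiffLocal_eq (b : Module.Basis ι ℝ E) (G : E → Matrix ι ι ℝ)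
    (w : E → E [⋀^Fin (k + 1)]→L[ℝ] ℂ) (y : E) :
    codiffLocal b G w y = -((√(G y).det)⁻¹ •
      (diverg b (raised b G w) y).compContinuousLinearMap (matEnd b (G y))) := by
  rw [codiffLocal, diverg]
  congr 2
  exact (map_sum (ContinuousAlternatingMap.compContinuousLinearMapCLM (matEnd b (G y))) _ _).symm

variable {b : Module.Basis ι ℝ E} {G : E → Matrix ι ι ℝ} {S : Set E}

theorem contDiffOn_sqrt_det (hG : IsMetricOn G S) :
    ContDiffOn ℝ ∞ (fun y => √(G y).det) S :=
  (contDiffOn_det hG.smooth).sqrt fun y hy => (hG.det_pos y hy).ne'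

theorem contDiffOn_raised (hG : IsMetricOn G S) {w : E → E [⋀^Fin k]→L[ℝ] ℂ}
    (hw : ContDiffOn ℝ ∞ w S) : ContDiffOn ℝ ∞ (raised b G w) S :=
  (contDiffOn_sqrt_det hG).smul
    (contDiffOn_comp_matEnd b hw (contDiffOn_inv hG.smooth hG.det_pos))

theorem contDiffOn_fderiv (hS : IsOpen S) {w : E → F} (hw : ContDiffOn ℝ ∞ w S) :
    ContDiffOn ℝ ∞ (fderiv ℝ w) S :=
  hw.fderiv_of_isOpen hS (by simp)

theorem contDiffOn_diverg (hS : IsOpen S) {u : E → E [⋀^Fin (k + 1)]→L[ℝ] ℂ}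
    (hu : ContDiffOn ℝ ∞ u S) : ContDiffOn ℝ ∞ (diverg b u) S := by
  refine ContDiffOn.sum fun a _ => ?_
  have h1 := (contDiffOn_fderiv hS hu).clm_apply (contDiffOn_const (c := b a))
  let L : (E [⋀^Fin (k + 1)]→L[ℝ] ℂ) →L[ℝ] (E →L[ℝ] E [⋀^Fin k]→L[ℝ] ℂ) :=
    ContinuousAlternatingMap.curryLeftLI.toContinuousLinearMap
  exact (L.contDiff.comp_contDiffOn h1).clm_apply (contDiffOn_const (c := b a))

theorem contDiffOn_codiffLocal (hG : IsMetricOn G S) {w : E → E [⋀^Fin (k + 1)]→L[ℝ] ℂ}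
    (hw : ContDiffOn ℝ ∞ w S) : ContDiffOn ℝ ∞ (codiffLocal b G w) S := by
  have : codiffLocal b G w = fun y => -((√(G y).det)⁻¹ •
      (diverg b (raised b G w) y).compContinuousLinearMap (matEnd b (G y))) :=
    funext fun y => codiffLocal_eq b G w y
  rw [this]
  have h1 := (contDiffOn_sqrt_det hG).inv fun y hy => (Real.sqrt_pos.2 (hG.det_pos y hy)).ne'
  exact (h1.smul (contDiffOn_comp_matEnd b
    (contDiffOn_diverg hG.isOpen (contDiffOn_raised hG hw)) hG.smooth)).neg

theorem contDiffOn_extDeriv (hS : IsOpen S) {w : E → E [⋀^Fin k]→L[ℝ] ℂ}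
    (hw : ContDiffOn ℝ ∞ w S) : ContDiffOn ℝ ∞ (extDeriv w) S := by
  let L : (E →L[ℝ] E [⋀^Fin k]→L[ℝ] ℂ) →L[ℝ] (E [⋀^Fin (k + 1)]→L[ℝ] ℂ) :=
    ContinuousAlternatingMap.alternatizeUncurryFinCLM ℝ E ℂ
  have h := L.contDiff.comp_contDiffOn (contDiffOn_fderiv hS hw)
  exact h

end Smooth

end FormLaplace

end

/-! ### Forms on a product with the real line -/

noncomputable section

namespace FormLaplace

open ContinuousAlternatingMap

section Product

variable {E : Type*} [NormedAddCommGroup E] [NormedSpace ℝ E] [FiniteDimensional ℝ E]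
  {ι : Type*} [Fintype ι] [DecidableEq ι] {k : ℕ}

/-- The pullback of alternating forms from `E` to `E × ℝ`. -/
def pullFst (E : Type*) [NormedAddCommGroup E] [NormedSpace ℝ E] (k : ℕ) :
    (E [⋀^Fin k]→L[ℝ] ℂ) →L[ℝ] ((E × ℝ) [⋀^Fin k]→L[ℝ] ℂ) :=
  compContinuousLinearMapCLM (ContinuousLinearMap.fst ℝ E ℝ)

theorem pullFst_smul (c : ℂ) (μ : E [⋀^Fin k]→L[ℝ] ℂ) :
    pullFst E k (c • μ) = c • pullFst E k μ := rfl

/-- The form `c(r) w` on `E × ℝ`. -/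
def prodPull (c : ℝ → ℂ) (w : E → E [⋀^Fin k]→L[ℝ] ℂ) (z : E × ℝ) : (E × ℝ) [⋀^Fin k]→L[ℝ] ℂ :=
  c z.2 • pullFst E k (w z.1)

/-- The form `c(r) dr ∧ w` on `E × ℝ`. -/
def prodWedge (c : ℝ → ℂ) (w : E → E [⋀^Fin k]→L[ℝ] ℂ) (z : E × ℝ) :
    (E × ℝ) [⋀^Fin (k + 1)]→L[ℝ] ℂ :=
  c z.2 • covWedge (ContinuousLinearMap.snd ℝ E ℝ)
    (pullFst E k (w z.1))

theorem hasFDerivAt_prodPull {c : ℝ → ℂ} {c' : ℂ} {w : E → E [⋀^Fin k]→L[ℝ] ℂ}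
    {w' : E →L[ℝ] E [⋀^Fin k]→L[ℝ] ℂ} {z : E × ℝ} (hc : HasDerivAt c c' z.2)
    (hw : HasFDerivAt w w' z.1) :
    HasFDerivAt (prodPull c w)
      (c z.2 • (pullFst E k ∘L w' ∘L
          ContinuousLinearMap.fst ℝ E ℝ)
        + (ContinuousLinearMap.snd ℝ E ℝ).smulRight
          (c' • pullFst E k (w z.1))) z := by
  have h1 : HasFDerivAt (fun z : E × ℝ => c z.2)
      ((ContinuousLinearMap.snd ℝ E ℝ).smulRight c') z :=
    (hc.hasFDerivAt.comp z hasFDerivAt_snd).congr_fderiv (by ext <;> simp)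
  have h2 : HasFDerivAt
      (fun z : E × ℝ => pullFst E k (w z.1))
      (pullFst E k ∘L w' ∘L
          ContinuousLinearMap.fst ℝ E ℝ) z :=
    (pullFst E k).hasFDerivAt.comp z
      (hw.comp z hasFDerivAt_fst)
  refine (h1.smul h2).congr_fderiv (ContinuousLinearMap.ext fun v => ?_)
  simp only [_root_.add_apply, ContinuousLinearMap.smulRight_apply, smul_assoc]

theorem hasFDerivAt_prodWedge {c : ℝ → ℂ} {c' : ℂ} {w : E → E [⋀^Fin k]→L[ℝ] ℂ}
    {w' : E →L[ℝ] E [⋀^Fin k]→L[ℝ] ℂ} {z : E × ℝ} (hc : HasDerivAt c c' z.2)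
    (hw : HasFDerivAt w w' z.1) :
    HasFDerivAt (prodWedge c w)
      ((covWedgeL k (ContinuousLinearMap.snd ℝ E ℝ)) ∘L
        (c z.2 • (pullFst E k ∘L w' ∘L
          ContinuousLinearMap.fst ℝ E ℝ)
        + (ContinuousLinearMap.snd ℝ E ℝ).smulRight
          (c' • pullFst E k (w z.1)))) z := by
  have h := (covWedgeL k (ContinuousLinearMap.snd ℝ E ℝ)).hasFDerivAt.comp z
    (hasFDerivAt_prodPull hc hw)
  refine h.congr_of_eventuallyEq (Filter.Eventually.of_forall fun z => ?_)
  simp [prodWedge, prodPull, covWedgeL_apply, covWedge_smul]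

/-- Anticommutation of covectors applied to `ℓ ⊗ μ` gives `X = -X` for `X = ℓ ∧ ℓ ∧ μ`. -/
theorem covWedge_covWedge (ℓ : E →L[ℝ] ℝ) (μ : E [⋀^Fin k]→L[ℝ] ℂ) :
    covWedge ℓ (covWedge ℓ μ) = 0 := by
  have h := alternatizeUncurryFin_covWedgeL_comp ℓ (ℓ.smulRight μ)
  have h2 : (covWedgeL k ℓ) ∘L (ℓ.smulRight μ) = ℓ.smulRight (covWedge ℓ μ) := by
    ext1 v
    simp [covWedgeL_apply]
  rw [h2] at h
  have h3 : (2 : ℝ) • covWedge ℓ (covWedge ℓ μ) = 0 :=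
    (two_smul ℝ _).trans (add_eq_zero_iff_eq_neg.2 h)
  exact (smul_eq_zero.1 h3).resolve_left two_ne_zero

theorem alternatizeUncurryFin_pullFst (f : E →L[ℝ] E [⋀^Fin k]→L[ℝ] ℂ) :
    alternatizeUncurryFin (pullFst E k ∘L f ∘L ContinuousLinearMap.fst ℝ E ℝ)
      = pullFst E (k + 1) (alternatizeUncurryFin f) :=
  alternatizeUncurryFin_comp f _

theorem extDeriv_prodPull {c : ℝ → ℂ} {c' : ℂ} {w : E → E [⋀^Fin k]→L[ℝ] ℂ} {z : E × ℝ}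
    (hc : HasDerivAt c c' z.2) (hw : DifferentiableAt ℝ w z.1) :
    extDeriv (prodPull c w) z
      = prodPull c (extDeriv w) z + prodWedge (fun _ => c') w z := by
  rw [extDeriv, (hasFDerivAt_prodPull hc hw.hasFDerivAt).fderiv, alternatizeUncurryFin_add,
    alternatizeUncurryFin_smul, alternatizeUncurryFin_pullFst]
  congr 1
  exact covWedge_smul _ _ _

theorem extDeriv_prodWedge {c : ℝ → ℂ} {w : E → E [⋀^Fin k]→L[ℝ] ℂ} {z : E × ℝ}
    (hc : DifferentiableAt ℝ c z.2) (hw : DifferentiableAt ℝ w z.1) :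
    extDeriv (prodWedge c w) z = -prodWedge c (extDeriv w) z := by
  rw [extDeriv, (hasFDerivAt_prodWedge hc.hasDerivAt hw.hasFDerivAt).fderiv,
    alternatizeUncurryFin_covWedgeL_comp, alternatizeUncurryFin_add,
    alternatizeUncurryFin_smul, alternatizeUncurryFin_pullFst, ← covWedgeL_apply, map_add,
    covWedgeL_apply, covWedgeL_apply, covWedge_smul]
  -- The radial derivative of `c` only contributes a multiple of `dr ∧ dr ∧ w`.
  have : covWedge (ContinuousLinearMap.snd ℝ E ℝ) (alternatizeUncurryFin
      ((ContinuousLinearMap.snd ℝ E ℝ).smulRight (deriv c z.2 • pullFst E k (w z.1)))) = 0 :=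
    covWedge_covWedge _ _
  rw [this, add_zero]
  rfl

/-- The basis of `E × ℝ` made of `b` and the unit vector of `ℝ`. -/
abbrev prodBasis (b : Module.Basis ι ℝ E) : Module.Basis (ι ⊕ Unit) ℝ (E × ℝ) :=
  b.prod (Module.Basis.singleton Unit ℝ)

theorem prodBasis_inl (b : Module.Basis ι ℝ E) (i : ι) : prodBasis b (Sum.inl i) = (b i, 0) := by
  simp [Module.Basis.prod_apply]

theorem prodBasis_inr (b : Module.Basis ι ℝ E) (i : Unit) :
    prodBasis b (Sum.inr i) = (0, 1) := by
  simp [Module.Basis.prod_apply]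

theorem curryLeft_complex_smul (c : ℂ) (μ : E [⋀^Fin (k + 1)]→L[ℝ] ℂ) (e : E) :
    (c • μ).curryLeft e = c • μ.curryLeft e := rfl

theorem curryLeft_pullFst (μ : E [⋀^Fin (k + 1)]→L[ℝ] ℂ) (e : E × ℝ) :
    (pullFst E (k + 1) μ).curryLeft e = pullFst E k (μ.curryLeft e.1) :=
  curryLeft_compContinuousLinearMap _ _ _

/-- Pulled-back forms are annihilated by contraction with `∂_r`, so only the tangential directions
contribute and `c(r)` is never differentiated. -/
theorem diverg_prodPull (b : Module.Basis ι ℝ E) {c : ℝ → ℂ} {u : E → E [⋀^Fin (k + 1)]→L[ℝ] ℂ}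
    {z : E × ℝ} (hc : DifferentiableAt ℝ c z.2) (hu : DifferentiableAt ℝ u z.1) :
    diverg (prodBasis b) (prodPull c u) z = prodPull c (diverg b u) z := by
  rw [diverg, (hasFDerivAt_prodPull hc.hasDerivAt hu.hasFDerivAt).fderiv, Fintype.sum_sum_type]
  simp only [prodBasis_inl, prodBasis_inr, _root_.add_apply, ContinuousLinearMap.smulRight_apply,
    ContinuousLinearMap.coe_snd', zero_smul, add_zero, _root_.smul_apply,
    ContinuousLinearMap.comp_apply, ContinuousLinearMap.coe_fst', _root_.map_zero, alt_smul_zero, zero_add,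
    one_smul, curryLeft_complex_smul, curryLeft_pullFst, Finset.sum_const_zero, prodPull, diverg,
    _root_.map_sum, Finset.smul_sum]

/-- The direction `∂_r` contracts away `dr` and differentiates `c`. The tangential contractions must
pass `dr`, which produces the minus sign. -/
theorem diverg_prodWedge (b : Module.Basis ι ℝ E) {c : ℝ → ℂ} {c' : ℂ}
    {u : E → E [⋀^Fin (k + 1)]→L[ℝ] ℂ}
    {z : E × ℝ} (hc : HasDerivAt c c' z.2) (hu : DifferentiableAt ℝ u z.1) :
    diverg (prodBasis b) (prodWedge c u) z
      = prodPull (fun _ => c') u z - prodWedge c (diverg b u) z := by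
  rw [diverg, (hasFDerivAt_prodWedge hc hu.hasFDerivAt).fderiv, Fintype.sum_sum_type]
  simp only [prodBasis_inl, prodBasis_inr, _root_.add_apply, ContinuousLinearMap.smulRight_apply,
    ContinuousLinearMap.coe_snd', zero_smul, add_zero, _root_.smul_apply, covWedgeL_apply,
    ContinuousLinearMap.comp_apply, ContinuousLinearMap.coe_fst', _root_.map_zero, alt_smul_zero,
    alt_zero_smul_real, zero_add,
    one_smul, curryLeft_complex_smul, curryLeft_pullFst, prodPull, diverg,
    curryLeft_covWedge, zero_sub, covWedge_smul, covWedge_zero, sub_zero, smul_neg,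
    Finset.sum_neg_distrib, Finset.univ_unique, Finset.sum_singleton, prodWedge]
  rw [← covWedgeL_apply, _root_.map_sum, _root_.map_sum, Finset.smul_sum, neg_add_eq_sub]
  rfl

/-- For functions `u` there is nothing left to contract tangentially; only the radial term remains.
-/
theorem diverg_prodWedge_zero (b : Module.Basis ι ℝ E) {c : ℝ → ℂ} {c' : ℂ}
    {u : E → E [⋀^Fin 0]→L[ℝ] ℂ}
    {z : E × ℝ} (hc : HasDerivAt c c' z.2) (hu : DifferentiableAt ℝ u z.1) :
    diverg (prodBasis b) (prodWedge c u) z = prodPull (fun _ => c') u z := by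
  rw [diverg, (hasFDerivAt_prodWedge hc hu.hasFDerivAt).fderiv, Fintype.sum_sum_type]
  simp only [prodBasis_inl, prodBasis_inr, _root_.add_apply, ContinuousLinearMap.smulRight_apply,
    ContinuousLinearMap.coe_snd', zero_smul, add_zero, _root_.smul_apply, covWedgeL_apply,
    ContinuousLinearMap.comp_apply, ContinuousLinearMap.coe_fst', _root_.map_zero, alt_smul_zero,
    alt_zero_smul_real, zero_add,
    one_smul, curryLeft_complex_smul, Finset.sum_const_zero, prodPull,
    curryLeft_covWedge_zero, covWedge_smul,
    Finset.univ_unique, Finset.sum_singleton]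

end Product

end FormLaplace

end

/-! ### Local operators: locality and additivity -/

noncomputable section

namespace FormLaplace

open ContinuousAlternatingMap

section Additivity

variable {E : Type*} [NormedAddCommGroup E] [NormedSpace ℝ E] [FiniteDimensional ℝ E]
  {ι : Type*} [Fintype ι] [DecidableEq ι] {k : ℕ}
  {b : Module.Basis ι ℝ E} {G G' : E → Matrix ι ι ℝ} {S : Set E}

theorem codiffLocal_congr {w w' : E → E [⋀^Fin (k + 1)]→L[ℝ] ℂ} {y : E} (hG : G =ᶠ[𝓝 y] G')
    (hw : w =ᶠ[𝓝 y] w') : codiffLocal b G w y = codiffLocal b G' w' y := by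
  have h : raised b G w =ᶠ[𝓝 y] raised b G' w' := by
    filter_upwards [hG, hw] with z h1 h2
    rw [raised, raised, h1, h2]
  rw [codiffLocal_eq, codiffLocal_eq, diverg, diverg, h.fderiv_eq, hG.eq_of_nhds]

theorem laplacianLocal_congr {w w' : E → E [⋀^Fin k]→L[ℝ] ℂ} {y : E} (hG : G =ᶠ[𝓝 y] G')
    (hw : w =ᶠ[𝓝 y] w') : laplacianLocal b G w y = laplacianLocal b G' w' y := by
  cases k with
  | zero => exact codiffLocal_congr hG hw.extDeriv
  | succ k =>
    have h : codiffLocal b G w =ᶠ[𝓝 y] codiffLocal b G' w' := by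
      filter_upwards [hG.eventuallyEq_nhds, hw.eventuallyEq_nhds] with z h1 h2
      exact codiffLocal_congr h1 h2
    exact congrArg₂ (· + ·) h.extDeriv_eq (codiffLocal_congr hG hw.extDeriv)

theorem diffAt_of_contDiffOn {F : Type*} [NormedAddCommGroup F] [NormedSpace ℝ F] {w : E → F}
    (hS : IsOpen S) (hw : ContDiffOn ℝ ∞ w S) {y : E} (hy : y ∈ S) : DifferentiableAt ℝ w y :=
  (hw.contDiffAt (hS.mem_nhds hy)).differentiableAt (by simp)

/-- Smoothness on an open set is needed because the Fréchet derivative is additive only at points of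
differentiability. -/
theorem codiffLocal_add (hG : IsMetricOn G S) {w w' : E → E [⋀^Fin (k + 1)]→L[ℝ] ℂ}
    (hw : ContDiffOn ℝ ∞ w S) (hw' : ContDiffOn ℝ ∞ w' S) {y : E} (hy : y ∈ S) :
    codiffLocal b G (w + w') y = codiffLocal b G w y + codiffLocal b G w' y := by
  have h : raised b G (w + w') = raised b G w + raised b G w' := by
    funext z
    exact alt_smul_add_real (√(G z).det) ((w z).compContinuousLinearMap (matEnd b (G z)⁻¹))
      ((w' z).compContinuousLinearMap (matEnd b (G z)⁻¹))
  have h2 : diverg b (raised b G (w + w')) y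
      = diverg b (raised b G w) y + diverg b (raised b G w') y := by
    simp only [diverg]
    rw [h, fderiv_add (diffAt_of_contDiffOn hG.isOpen (contDiffOn_raised hG hw) hy)
      (diffAt_of_contDiffOn hG.isOpen (contDiffOn_raised hG hw') hy), ← Finset.sum_add_distrib]
    rfl
  rw [codiffLocal_eq, codiffLocal_eq, codiffLocal_eq, h2, ← neg_add, ← alt_smul_add_real]
  rfl

theorem eventuallyEq_of_eqOn {F : Type*} {w w' : E → F} (hS : IsOpen S) (h : Set.EqOn w w' S)
    {y : E} (hy : y ∈ S) : w =ᶠ[𝓝 y] w' :=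
  h.eventuallyEq_of_mem (hS.mem_nhds hy)

theorem extDeriv_add_on (hS : IsOpen S) {w w' : E → E [⋀^Fin k]→L[ℝ] ℂ}
    (hw : ContDiffOn ℝ ∞ w S) (hw' : ContDiffOn ℝ ∞ w' S) :
    Set.EqOn (extDeriv (w + w')) (extDeriv w + extDeriv w') S := fun _ hy =>
  extDeriv_add (diffAt_of_contDiffOn hS hw hy) (diffAt_of_contDiffOn hS hw' hy)

theorem laplacianLocal_add (hG : IsMetricOn G S) {w w' : E → E [⋀^Fin k]→L[ℝ] ℂ}
    (hw : ContDiffOn ℝ ∞ w S) (hw' : ContDiffOn ℝ ∞ w' S) {y : E} (hy : y ∈ S) :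
    laplacianLocal b G (w + w') y = laplacianLocal b G w y + laplacianLocal b G w' y := by
  have h1 : codiffLocal b G (extDeriv (w + w')) y
      = codiffLocal b G (extDeriv w) y + codiffLocal b G (extDeriv w') y := by
    rw [codiffLocal_congr Filter.EventuallyEq.rfl
      (eventuallyEq_of_eqOn hG.isOpen (extDeriv_add_on hG.isOpen hw hw') hy)]
    exact codiffLocal_add hG (contDiffOn_extDeriv hG.isOpen hw)
      (contDiffOn_extDeriv hG.isOpen hw') hy
  cases k with
  | zero => exact h1
  | succ k =>
    have h2 : extDeriv (codiffLocal b G (w + w')) y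
        = extDeriv (codiffLocal b G w) y + extDeriv (codiffLocal b G w') y := by
      rw [Filter.EventuallyEq.extDeriv_eq (eventuallyEq_of_eqOn hG.isOpen
        (w' := codiffLocal b G w + codiffLocal b G w')
        (fun z hz => codiffLocal_add hG hw hw' hz) hy)]
      exact extDeriv_add_on hG.isOpen (contDiffOn_codiffLocal hG hw)
        (contDiffOn_codiffLocal hG hw') hy
    simp only [laplacianLocal, Pi.add_apply, h1, h2]
    abel

theorem extDeriv_zero_form (y : E) : extDeriv (0 : E → E [⋀^Fin k]→L[ℝ] ℂ) y = 0 := by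
  have h : fderiv ℝ (0 : E → E [⋀^Fin k]→L[ℝ] ℂ) y = 0 := fderiv_const_apply _
  rw [extDeriv, h]
  exact map_zero (alternatizeUncurryFinCLM ℝ E ℂ)

theorem codiffLocal_zero (y : E) :
    codiffLocal b G (0 : E → E [⋀^Fin (k + 1)]→L[ℝ] ℂ) y = 0 := by
  have h : raised b G (0 : E → E [⋀^Fin (k + 1)]→L[ℝ] ℂ) = 0 :=
    funext fun z => alt_smul_zero_real (√(G z).det)
  have h2 : fderiv ℝ (0 : E → E [⋀^Fin (k + 1)]→L[ℝ] ℂ) y = 0 := fderiv_const_apply _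
  have h3 : diverg b (0 : E → E [⋀^Fin (k + 1)]→L[ℝ] ℂ) y = 0 := by
    rw [diverg, h2]
    exact Finset.sum_eq_zero fun _ _ => rfl
  rw [codiffLocal_eq, h, h3, neg_eq_zero]
  exact alt_smul_zero_real (√(G y).det)⁻¹

theorem laplacianLocal_zero (y : E) :
    laplacianLocal b G (0 : E → E [⋀^Fin k]→L[ℝ] ℂ) y = 0 := by
  have h1 : extDeriv (0 : E → E [⋀^Fin k]→L[ℝ] ℂ) = 0 := funext fun y => extDeriv_zero_form y
  cases k with
  | zero => rw [laplacianLocal, h1, codiffLocal_zero]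
  | succ k =>
    have h2 : codiffLocal b G (0 : E → E [⋀^Fin (k + 1)]→L[ℝ] ℂ) = 0 :=
      funext fun y => codiffLocal_zero y
    rw [laplacianLocal, Pi.add_apply, h1, h2, codiffLocal_zero, extDeriv_zero_form, add_zero]

theorem laplacianLocal_sum (hG : IsMetricOn G S) {α : Type*} (s : Finset α)
    {w : α → E → E [⋀^Fin k]→L[ℝ] ℂ} (hw : ∀ j, ContDiffOn ℝ ∞ (w j) S) {y : E} (hy : y ∈ S) :
    laplacianLocal b G (∑ j ∈ s, w j) y = ∑ j ∈ s, laplacianLocal b G (w j) y := by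
  classical
  induction s using Finset.induction_on with
  | empty => simp [laplacianLocal_zero]
  | insert a s ha ih =>
    have hs : ContDiffOn ℝ ∞ (∑ j ∈ s, w j) S := by
      have h := ContDiffOn.sum (s := s) (f := w) fun j _ => hw j
      refine h.congr fun z _ => ?_
      simp
    rw [Finset.sum_insert ha, Finset.sum_insert ha, laplacianLocal_add hG (hw a) hs hy, ih]

end Additivity

end FormLaplace

end

/-! ### Warped products with an interval -/

noncomputable section

namespace FormLaplace

open ContinuousAlternatingMap

/-! ### Calculus of logarithmic derivatives. -/

section LogDeriv

variable {f g : ℝ → ℝ} {a a' r : ℝ}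

/-- Writing a derivative as `a * f r` keeps track of `a = f' / f`, which is multiplied by the
exponent under powers, changes sign under inversion and adds under products. -/
theorem hasDerivAt_pow_of_log (hf : HasDerivAt f (a * f r) r) (n : ℕ) :
    HasDerivAt (fun r => f r ^ n) ((n * a) * f r ^ n) r := by
  refine (hf.pow n).congr_deriv ?_
  cases n with
  | zero => simp
  | succ n => simp [pow_succ]; ring

theorem hasDerivAt_inv_of_log (hf : HasDerivAt f (a * f r) r) (h0 : f r ≠ 0) :
    HasDerivAt (fun r => (f r)⁻¹) ((-a) * (f r)⁻¹) r := by
  refine (hf.inv h0).congr_deriv ?_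
  field_simp

theorem hasDerivAt_mul_of_log (hf : HasDerivAt f (a * f r) r) (hg : HasDerivAt g (a' * g r) r) :
    HasDerivAt (fun r => f r * g r) ((a + a') * (f r * g r)) r :=
  (hf.mul hg).congr_deriv (by ring)

end LogDeriv

/-! ### Density, raising and lowering for a warped product metric. -/

section Warped

variable {E : Type*} [NormedAddCommGroup E] [NormedSpace ℝ E] [FiniteDimensional ℝ E]
  {ι : Type*} [Fintype ι] [DecidableEq ι] {k : ℕ}

/-- The matrix of the metric `r⁻² dr² + f(r)² G`. -/
def warpMetric (f : ℝ → ℝ) (G : E → Matrix ι ι ℝ) (z : E × ℝ) :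
    Matrix (ι ⊕ Unit) (ι ⊕ Unit) ℝ :=
  Matrix.fromBlocks (f z.2 ^ 2 • G z.1) 0 0 (Matrix.diagonal fun _ => (z.2 ^ 2)⁻¹)

theorem matEnd_smul (b : Module.Basis ι ℝ E) (c : ℝ) (A : Matrix ι ι ℝ) :
    matEnd b (c • A) = c • matEnd b A := by
  simp [matEnd]

theorem matEnd_comp_matEnd_inv (b : Module.Basis ι ℝ E) {A : Matrix ι ι ℝ} (hA : A.det ≠ 0) :
    matEnd b A⁻¹ ∘L matEnd b A = ContinuousLinearMap.id ℝ E := by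
  have h : Matrix.toLin b b (A⁻¹ * A) = Matrix.toLin b b A⁻¹ ∘ₗ Matrix.toLin b b A :=
    Matrix.toLin_mul b b b _ _
  rw [Matrix.nonsing_inv_mul _ (isUnit_iff_ne_zero.2 hA), Matrix.toLin_one] at h
  ext v
  exact (LinearMap.congr_fun h v).symm

theorem matEnd_fromBlocks (b : Module.Basis ι ℝ E) (A : Matrix ι ι ℝ) (d : ℝ) :
    matEnd (prodBasis b) (Matrix.fromBlocks A 0 0 (Matrix.diagonal fun _ => d))
      = (matEnd b A).prodMap (d • ContinuousLinearMap.id ℝ ℝ) := by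
  apply ContinuousLinearMap.coe_injective
  refine (prodBasis b).ext fun i => ?_
  rcases i with i | i
  · refine (matEnd_basis _ _ _).trans ?_
    rw [Fintype.sum_sum_type]
    simp only [prodBasis_inl, prodBasis_inr]
    simp [matEnd_basis, Prod.ext_iff, Prod.fst_sum, Prod.snd_sum]
  · refine (matEnd_basis _ _ _).trans ?_
    rw [Fintype.sum_sum_type]
    simp only [prodBasis_inl, prodBasis_inr]
    simp

theorem comp_smul_clm (μ : E [⋀^Fin k]→L[ℝ] ℂ) (c : ℝ) (A : E →L[ℝ] E) :
    μ.compContinuousLinearMap (c • A) = ((c : ℂ) ^ k) • μ.compContinuousLinearMap A := by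
  ext v
  have h := μ.map_smul_univ (fun _ => c) (fun i => A (v i))
  simp only [Finset.prod_const, Finset.card_univ, Fintype.card_fin] at h
  refine h.trans ?_
  simp only [Complex.real_smul, Complex.ofReal_pow]
  rfl

theorem pullFst_comp_prodMap (μ : E [⋀^Fin k]→L[ℝ] ℂ) (A : E →L[ℝ] E) (B : ℝ →L[ℝ] ℝ) :
    (pullFst E k μ).compContinuousLinearMap (A.prodMap B)
      = pullFst E k (μ.compContinuousLinearMap A) := rfl

theorem covWedge_pullFst_comp_prodMap (μ : E [⋀^Fin k]→L[ℝ] ℂ) (A : E →L[ℝ] E) (d : ℝ) :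
    (covWedge (ContinuousLinearMap.snd ℝ E ℝ) (pullFst E k μ)).compContinuousLinearMap
        (A.prodMap (d • ContinuousLinearMap.id ℝ ℝ))
      = (d : ℂ) • covWedge (ContinuousLinearMap.snd ℝ E ℝ)
          (pullFst E k (μ.compContinuousLinearMap A)) := by
  rw [covWedge_comp, pullFst_comp_prodMap, ← alt_real_smul, ← covWedge_smul_left]
  congr 1

variable {b : Module.Basis ι ℝ E} {G : E → Matrix ι ι ℝ} {f : ℝ → ℝ}

theorem det_warpMetric (z : E × ℝ) :
    (warpMetric f G z).det = (f z.2 ^ 2) ^ Fintype.card ι * (G z.1).det * (z.2 ^ 2)⁻¹ := by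
  rw [warpMetric, Matrix.det_fromBlocks_zero₂₁, Matrix.det_smul, Matrix.det_diagonal]
  simp

theorem sqrt_det_warpMetric {z : E × ℝ} (hf : 0 < f z.2) (hr : 0 < z.2) :
    √(warpMetric f G z).det = f z.2 ^ Fintype.card ι * z.2⁻¹ * √(G z.1).det := by
  have h : (warpMetric f G z).det
      = (f z.2 ^ Fintype.card ι * z.2⁻¹) ^ 2 * (G z.1).det := by
    rw [det_warpMetric]
    ring
  rw [h, Real.sqrt_mul (by positivity), Real.sqrt_sq (by positivity)]

theorem inv_warpMetric {z : E × ℝ} (hf : 0 < f z.2) (hr : 0 < z.2) (hG : 0 < (G z.1).det) :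
    (warpMetric f G z)⁻¹ = Matrix.fromBlocks ((f z.2 ^ 2)⁻¹ • (G z.1)⁻¹) 0 0
      (Matrix.diagonal fun _ => z.2 ^ 2) := by
  apply Matrix.inv_eq_right_inv
  have h1 : G z.1 * (G z.1)⁻¹ = 1 := Matrix.mul_nonsing_inv _ (isUnit_iff_ne_zero.2 hG.ne')
  have h2 : f z.2 ^ 2 ≠ 0 := by positivity
  have h3 : z.2 ^ 2 ≠ 0 := by positivity
  rw [warpMetric, Matrix.fromBlocks_multiply]
  simp [h1, h2, h3, smul_smul, Matrix.fromBlocks_one]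

/-- The volume density contributes `f^n r⁻¹`, and each of the `k` tangential indices is raised with
a factor `f⁻²`. -/
theorem raised_prodPull {c : ℝ → ℂ} {w : E → E [⋀^Fin k]→L[ℝ] ℂ} {z : E × ℝ} (hf : 0 < f z.2)
    (hr : 0 < z.2) (hG : 0 < (G z.1).det) :
    raised (prodBasis b) (warpMetric f G) (prodPull c w) z
      = prodPull (fun r => ((f r ^ Fintype.card ι * r⁻¹ * ((f r ^ 2)⁻¹) ^ k : ℝ) : ℂ) * c r)
        (raised b G w) z := by
  have h : (prodPull c w z).compContinuousLinearMap
      (matEnd (prodBasis b) (warpMetric f G z)⁻¹)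
      = c z.2 • (((((f z.2 ^ 2)⁻¹ : ℝ) : ℂ) ^ k) • pullFst E k
        ((w z.1).compContinuousLinearMap (matEnd b (G z.1)⁻¹))) := by
    rw [inv_warpMetric hf hr hG, matEnd_fromBlocks, matEnd_smul, ← pullFst_smul, ← comp_smul_clm]
    rfl
  rw [raised, h, sqrt_det_warpMetric hf hr, prodPull, raised, alt_real_smul, alt_real_smul,
    pullFst_smul, smul_smul, smul_smul, smul_smul]
  congr 1
  push_cast
  ring

/-- Of the `k + 1` indices only `k` are tangential. The `dr` index is raised with `r²`, which turns
the factor `r⁻¹` of the volume density into `r`. -/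
theorem raised_prodWedge {c : ℝ → ℂ} {w : E → E [⋀^Fin k]→L[ℝ] ℂ} {z : E × ℝ} (hf : 0 < f z.2)
    (hr : 0 < z.2) (hG : 0 < (G z.1).det) :
    raised (prodBasis b) (warpMetric f G) (prodWedge c w) z
      = prodWedge (fun r => ((f r ^ Fintype.card ι * r * ((f r ^ 2)⁻¹) ^ k : ℝ) : ℂ) * c r)
        (raised b G w) z := by
  have h : (prodWedge c w z).compContinuousLinearMap
      (matEnd (prodBasis b) (warpMetric f G z)⁻¹)
      = c z.2 • (((z.2 ^ 2 : ℝ) : ℂ) • (((((f z.2 ^ 2)⁻¹ : ℝ) : ℂ) ^ k) •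
        covWedge (ContinuousLinearMap.snd ℝ E ℝ) (pullFst E k
        ((w z.1).compContinuousLinearMap (matEnd b (G z.1)⁻¹))))) := by
    rw [inv_warpMetric hf hr hG, matEnd_fromBlocks, matEnd_smul, ← covWedge_smul, ← pullFst_smul,
      ← comp_smul_clm, ← covWedge_pullFst_comp_prodMap]
    rfl
  rw [raised, h, sqrt_det_warpMetric hf hr, prodWedge, raised, alt_real_smul, alt_real_smul,
    pullFst_smul, covWedge_smul, smul_smul, smul_smul, smul_smul, smul_smul]
  congr 1
  have : (z.2 : ℂ) ≠ 0 := by exact_mod_cast hr.ne'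
  push_cast
  field_simp

theorem prodPull_comp_warp (c : ℝ → ℂ) (w : E → E [⋀^Fin k]→L[ℝ] ℂ) (z : E × ℝ) :
    (prodPull c w z).compContinuousLinearMap (matEnd (prodBasis b) (warpMetric f G z))
      = (c z.2 * ((f z.2 ^ 2 : ℝ) : ℂ) ^ k) • pullFst E k
        ((w z.1).compContinuousLinearMap (matEnd b (G z.1))) := by
  rw [← smul_smul, ← pullFst_smul, ← comp_smul_clm, warpMetric, matEnd_fromBlocks, matEnd_smul]
  rfl

theorem prodWedge_comp_warp (c : ℝ → ℂ) (w : E → E [⋀^Fin k]→L[ℝ] ℂ) (z : E × ℝ) :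
    (prodWedge c w z).compContinuousLinearMap (matEnd (prodBasis b) (warpMetric f G z))
      = (c z.2 * (((z.2 ^ 2)⁻¹ : ℝ) : ℂ) * ((f z.2 ^ 2 : ℝ) : ℂ) ^ k) •
        covWedge (ContinuousLinearMap.snd ℝ E ℝ) (pullFst E k
        ((w z.1).compContinuousLinearMap (matEnd b (G z.1)))) := by
  rw [← smul_smul, ← smul_smul, ← covWedge_smul, ← pullFst_smul, ← comp_smul_clm, warpMetric,
    ← covWedge_pullFst_comp_prodMap, matEnd_fromBlocks, matEnd_smul]
  rfl

theorem raised_comp_matEnd {w : E → E [⋀^Fin k]→L[ℝ] ℂ} {y : E} (hG : 0 < (G y).det) :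
    (raised b G w y).compContinuousLinearMap (matEnd b (G y)) = ((√(G y).det : ℝ) : ℂ) • w y := by
  have h : ((w y).compContinuousLinearMap (matEnd b (G y)⁻¹)).compContinuousLinearMap
      (matEnd b (G y)) = (w y).compContinuousLinearMap (matEnd b (G y)⁻¹ ∘L matEnd b (G y)) := rfl
  rw [matEnd_comp_matEnd_inv b hG.ne'] at h
  rw [← alt_real_smul]
  exact congrArg (fun μ => √(G y).det • μ) h

end Warped

end FormLaplace

end

/-! ### The Laplacian of a warped product -/

noncomputable section

namespace FormLaplace

open ContinuousAlternatingMap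

section WarpedLaplacian

variable {E : Type*} [NormedAddCommGroup E] [NormedSpace ℝ E] [FiniteDimensional ℝ E]
  {ι : Type*} [Fintype ι] [DecidableEq ι] {k : ℕ}
  {b : Module.Basis ι ℝ E} {G : E → Matrix ι ι ℝ} {f u : ℝ → ℝ} {S : Set E} {R : Set ℝ}

/-- Data for a warped product: `f` is a positive smooth function on the open set `R` of positive
numbers, and `r f' = - u f`. -/
structure IsWarping (f u : ℝ → ℝ) (R : Set ℝ) : Prop where
  isOpen : IsOpen R
  pos : ∀ r ∈ R, 0 < r
  f_pos : ∀ r ∈ R, 0 < f r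
  smooth : ContDiffOn ℝ ∞ f R
  deriv : ∀ r ∈ R, HasDerivAt f (-(u r / r) * f r) r

theorem isMetricOn_warpMetric (hG : IsMetricOn G S) (hf : IsWarping f u R) :
    IsMetricOn (warpMetric f G) (S ×ˢ R) where
  isOpen := hG.isOpen.prod hf.isOpen
  smooth := by
    have h1 : ContDiffOn ℝ ∞ (fun z : E × ℝ => f z.2) (S ×ˢ R) :=
      hf.smooth.comp contDiffOn_snd fun z hz => hz.2
    have h2 : ContDiffOn ℝ ∞ (fun z : E × ℝ => (z.2 ^ 2)⁻¹) (S ×ˢ R) :=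
      (contDiffOn_snd.pow 2).inv fun z hz => pow_ne_zero 2 (hf.pos _ hz.2).ne'
    rintro (i | i) (j | j)
    · have h3 : ContDiffOn ℝ ∞ (fun z : E × ℝ => G z.1 i j) (S ×ˢ R) :=
        (hG.smooth i j).comp contDiffOn_fst fun z hz => hz.1
      exact (h1.pow 2).mul h3
    · exact contDiffOn_const
    · exact contDiffOn_const
    · simpa [warpMetric] using h2
  det_pos := by
    intro z hz
    rw [det_warpMetric]
    have h1 := hf.pos _ hz.2
    have h2 := hf.f_pos _ hz.2
    have h3 := hG.det_pos _ hz.1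
    positivity

theorem contDiffOn_prodPull {c : ℝ → ℂ} {w : E → E [⋀^Fin k]→L[ℝ] ℂ} (hc : ContDiffOn ℝ ∞ c R)
    (hw : ContDiffOn ℝ ∞ w S) : ContDiffOn ℝ ∞ (prodPull c w) (S ×ˢ R) := by
  have h1 : ContDiffOn ℝ ∞ (fun z : E × ℝ => c z.2) (S ×ˢ R) :=
    hc.comp contDiffOn_snd fun z hz => hz.2
  have h2 : ContDiffOn ℝ ∞ (fun z : E × ℝ => w z.1) (S ×ˢ R) :=
    hw.comp contDiffOn_fst fun z hz => hz.1
  exact h1.smul ((pullFst E k).contDiff.comp_contDiffOn h2)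

theorem contDiffOn_prodWedge {c : ℝ → ℂ} {w : E → E [⋀^Fin k]→L[ℝ] ℂ} (hc : ContDiffOn ℝ ∞ c R)
    (hw : ContDiffOn ℝ ∞ w S) : ContDiffOn ℝ ∞ (prodWedge c w) (S ×ˢ R) := by
  have h := (covWedgeL k (ContinuousLinearMap.snd ℝ E ℝ)).contDiff.comp_contDiffOn
    (contDiffOn_prodPull hc hw)
  exact h.congr fun z _ => (covWedge_smul _ _ _).symm

theorem diverg_congr {w w' : E → E [⋀^Fin (k + 1)]→L[ℝ] ℂ} {y : E} (h : w =ᶠ[𝓝 y] w') :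
    diverg b w y = diverg b w' y := by
  rw [diverg, diverg, h.fderiv_eq]

theorem differentiableAt_of_isWarping (hf : IsWarping f u R) {r : ℝ} (hr : r ∈ R) :
    DifferentiableAt ℝ f r := (hf.deriv r hr).differentiableAt

/-- The factors from density and raising depend on `r` alone, so they pass through the tangential
divergence. Lowering cancels all of them except one `f⁻²`, since the divergence has used up one of
the `k + 1` raised indices. -/
theorem codiffLocal_prodPull (hG : IsMetricOn G S) (hf : IsWarping f u R) {c : ℝ → ℂ}
    {w : E → E [⋀^Fin (k + 1)]→L[ℝ] ℂ} {z : E × ℝ} (hz : z ∈ S ×ˢ R)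
    (hc : DifferentiableAt ℝ c z.2) (hw : ContDiffOn ℝ ∞ w S) :
    codiffLocal (prodBasis b) (warpMetric f G) (prodPull c w) z
      = prodPull (fun r => (((f r ^ 2)⁻¹ : ℝ) : ℂ) * c r) (codiffLocal b G w) z := by
  have hr := hf.pos _ hz.2
  have hfr := hf.f_pos _ hz.2
  have hd := hG.det_pos _ hz.1
  have h1 := eventuallyEq_of_eqOn (hG.isOpen.prod hf.isOpen)
    (fun z' hz' => raised_prodPull (b := b) (c := c) (w := w) (hf.f_pos _ hz'.2)
      (hf.pos _ hz'.2) (hG.det_pos _ hz'.1)) hz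
  have hM : DifferentiableAt ℝ
      (fun r => f r ^ Fintype.card ι * r⁻¹ * ((f r ^ 2)⁻¹) ^ (k + 1)) z.2 := by
    have h0 := differentiableAt_of_isWarping hf hz.2
    exact ((h0.pow _).mul (differentiableAt_inv hr.ne')).mul
      (((h0.pow 2).inv (pow_ne_zero 2 hfr.ne')).pow _)
  have hC : DifferentiableAt ℝ (fun r =>
      ((f r ^ Fintype.card ι * r⁻¹ * ((f r ^ 2)⁻¹) ^ (k + 1) : ℝ) : ℂ) * c r) z.2 :=
    (hM.hasDerivAt.ofReal_comp.differentiableAt).mul hc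
  rw [codiffLocal_eq, diverg_congr h1, diverg_prodPull b hC
    (diffAt_of_contDiffOn hG.isOpen (contDiffOn_raised hG hw) hz.1), prodPull_comp_warp,
    sqrt_det_warpMetric hfr hr, prodPull, codiffLocal_eq, map_neg, alt_real_smul, alt_real_smul,
    pullFst_smul, smul_neg, smul_smul, smul_smul]
  congr 2
  have h2 : (z.2 : ℂ) ≠ 0 := by exact_mod_cast hr.ne'
  have h3 : (f z.2 : ℂ) ≠ 0 := by exact_mod_cast hfr.ne'
  have h4 : ((√(G z.1).det : ℝ) : ℂ) ≠ 0 := by exact_mod_cast (Real.sqrt_pos.2 hd).ne'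
  push_cast
  simp only [inv_pow]
  field_simp
  ring

/-- The density is `f^(n - 2k) r`, and the logarithmic derivatives of `f` and `r` are `-u / r` and
`1 / r`. -/
theorem hasDerivAt_density (hf : IsWarping f u R) {r : ℝ} (hr : r ∈ R) (n k : ℕ) :
    HasDerivAt (fun r => f r ^ n * r * ((f r ^ 2)⁻¹) ^ k)
      ((1 - (n - 2 * k) * u r) / r * (f r ^ n * r * ((f r ^ 2)⁻¹) ^ k)) r := by
  have h0 := hf.pos r hr
  have h1 := hf.deriv r hr
  have h2 : HasDerivAt (fun r : ℝ => r) (1 / r * r) r :=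
    (hasDerivAt_id r).congr_deriv (by field_simp)
  have h3 := hasDerivAt_pow_of_log (hasDerivAt_inv_of_log (hasDerivAt_pow_of_log h1 2)
    (pow_ne_zero 2 (hf.f_pos r hr).ne')) k
  refine (hasDerivAt_mul_of_log (hasDerivAt_mul_of_log (hasDerivAt_pow_of_log h1 n) h2)
    h3).congr_deriv ?_
  congr 1
  push_cast
  field_simp
  ring

/-- The radial part of the codifferential of `c(r) dr ∧ w` for a `k`-form `w`, where `c₁ = c'`. -/
def radialCoeff (n k : ℕ) (u : ℝ → ℝ) (c c₁ : ℝ → ℂ) (r : ℝ) : ℂ :=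
  r ^ 2 * c₁ r + r * (1 - (n - 2 * k) * u r) * c r

/-- The `∂_r` part of the divergence, common to the cases of degree zero and positive degree. With
the density `D = f^(n - 2k) r`, normalising and lowering turn `(D c)'` into `r² D⁻¹ (D c)'`, which
is `radialCoeff`; the value `C'` itself drops out. -/
theorem codiff_wedge_aux (hG : IsMetricOn G S) (hf : IsWarping f u R) {c : ℝ → ℂ} {c' : ℂ}
    {w : E → E [⋀^Fin k]→L[ℝ] ℂ} {z : E × ℝ} (hz : z ∈ S ×ˢ R) (hc : HasDerivAt c c' z.2) :
    ∃ C' : ℂ, HasDerivAt (fun r =>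
        ((f r ^ Fintype.card ι * r * ((f r ^ 2)⁻¹) ^ k : ℝ) : ℂ) * c r) C' z.2 ∧
      (((√(warpMetric f G z).det)⁻¹ : ℝ) : ℂ) •
        (prodPull (fun _ => C') (raised b G w) z).compContinuousLinearMap
          (matEnd (prodBasis b) (warpMetric f G z))
      = prodPull (radialCoeff (Fintype.card ι) k u c fun _ => c') w z := by
  have hr := hf.pos _ hz.2
  have hfr := hf.f_pos _ hz.2
  have hd := hG.det_pos _ hz.1
  refine ⟨_, ((hasDerivAt_density hf hz.2 (Fintype.card ι) k).ofReal_comp).mul hc, ?_⟩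
  rw [prodPull_comp_warp, sqrt_det_warpMetric hfr hr, raised_comp_matEnd hd, pullFst_smul,
    prodPull, smul_smul, smul_smul]
  congr 1
  have h2 : (z.2 : ℂ) ≠ 0 := by exact_mod_cast hr.ne'
  have h3 : (f z.2 : ℂ) ≠ 0 := by exact_mod_cast hfr.ne'
  have h4 : ((√(G z.1).det : ℝ) : ℂ) ≠ 0 := by exact_mod_cast (Real.sqrt_pos.2 hd).ne'
  simp only [radialCoeff]
  push_cast
  simp only [inv_pow]
  field_simp
  ring

theorem codiffLocal_prodWedge_zero (hG : IsMetricOn G S) (hf : IsWarping f u R) {c : ℝ → ℂ}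
    {c' : ℂ} {w : E → E [⋀^Fin 0]→L[ℝ] ℂ} {z : E × ℝ} (hz : z ∈ S ×ˢ R)
    (hc : HasDerivAt c c' z.2) (hw : ContDiffOn ℝ ∞ w S) :
    codiffLocal (prodBasis b) (warpMetric f G) (prodWedge c w) z
      = -prodPull (radialCoeff (Fintype.card ι) 0 u c fun _ => c') w z := by
  have h1 := eventuallyEq_of_eqOn (hG.isOpen.prod hf.isOpen)
    (fun z' hz' => raised_prodWedge (b := b) (c := c) (w := w) (hf.f_pos _ hz'.2)
      (hf.pos _ hz'.2) (hG.det_pos _ hz'.1)) hz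
  obtain ⟨C', hC, hC2⟩ := codiff_wedge_aux (b := b) (w := w) hG hf hz hc
  rw [codiffLocal_eq, diverg_congr h1, diverg_prodWedge_zero b hC
    (diffAt_of_contDiffOn hG.isOpen (contDiffOn_raised hG hw) hz.1), alt_real_smul, hC2]

theorem codiffLocal_prodWedge (hG : IsMetricOn G S) (hf : IsWarping f u R) {c : ℝ → ℂ}
    {c' : ℂ} {w : E → E [⋀^Fin (k + 1)]→L[ℝ] ℂ} {z : E × ℝ} (hz : z ∈ S ×ˢ R)
    (hc : HasDerivAt c c' z.2) (hw : ContDiffOn ℝ ∞ w S) :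
    codiffLocal (prodBasis b) (warpMetric f G) (prodWedge c w) z
      = -prodPull (radialCoeff (Fintype.card ι) (k + 1) u c fun _ => c') w z
        - prodWedge (fun r => (((f r ^ 2)⁻¹ : ℝ) : ℂ) * c r) (codiffLocal b G w) z := by
  have hr := hf.pos _ hz.2
  have hfr := hf.f_pos _ hz.2
  have hd := hG.det_pos _ hz.1
  have h1 := eventuallyEq_of_eqOn (hG.isOpen.prod hf.isOpen)
    (fun z' hz' => raised_prodWedge (b := b) (c := c) (w := w) (hf.f_pos _ hz'.2)
      (hf.pos _ hz'.2) (hG.det_pos _ hz'.1)) hz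
  obtain ⟨C', hC, hC2⟩ := codiff_wedge_aux (b := b) (w := w) hG hf hz hc
  have h5 : ∀ (μ ν : (E × ℝ) [⋀^Fin (k + 1)]→L[ℝ] ℂ) (A : (E × ℝ) →L[ℝ] (E × ℝ)),
    (μ - ν).compContinuousLinearMap A = μ.compContinuousLinearMap A - ν.compContinuousLinearMap A :=
    fun _ _ _ => rfl
  rw [codiffLocal_eq, diverg_congr h1, diverg_prodWedge b hC
    (diffAt_of_contDiffOn hG.isOpen (contDiffOn_raised hG hw) hz.1), alt_real_smul, h5, smul_sub,
    hC2, neg_sub', sub_neg_eq_add, sub_eq_add_neg]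
  congr 1
  rw [prodWedge_comp_warp,
    sqrt_det_warpMetric hfr hr, prodWedge, codiffLocal_eq, map_neg, alt_real_smul,
    pullFst_smul, covWedge_neg, covWedge_smul, smul_neg, neg_neg]
  simp only [smul_smul]
  congr 1
  have h2 : (z.2 : ℂ) ≠ 0 := by exact_mod_cast hr.ne'
  have h3 : (f z.2 : ℂ) ≠ 0 := by exact_mod_cast hfr.ne'
  have h4 : ((√(G z.1).det : ℝ) : ℂ) ≠ 0 := by exact_mod_cast (Real.sqrt_pos.2 hd).ne'
  push_cast
  simp only [inv_pow]
  field_simp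
  ring

end WarpedLaplacian

end FormLaplace

end

/-! ### The Laplacian of `c(r) w` and of `c(r) dr ∧ w`. -/

noncomputable section

namespace FormLaplace

open ContinuousAlternatingMap

section WarpedLaplacianFormula

variable {E : Type*} [NormedAddCommGroup E] [NormedSpace ℝ E] [FiniteDimensional ℝ E]
  {ι : Type*} [Fintype ι] [DecidableEq ι] {k : ℕ}
  {b : Module.Basis ι ℝ E} {G : E → Matrix ι ι ℝ} {f u : ℝ → ℝ} {S : Set E} {R : Set ℝ}

theorem differentiableAt_prodPull {c : ℝ → ℂ} {w : E → E [⋀^Fin k]→L[ℝ] ℂ} {z : E × ℝ}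
    (hc : DifferentiableAt ℝ c z.2) (hw : DifferentiableAt ℝ w z.1) :
    DifferentiableAt ℝ (prodPull c w) z :=
  (hasFDerivAt_prodPull hc.hasDerivAt hw.hasFDerivAt).differentiableAt

theorem differentiableAt_prodWedge {c : ℝ → ℂ} {w : E → E [⋀^Fin k]→L[ℝ] ℂ} {z : E × ℝ}
    (hc : DifferentiableAt ℝ c z.2) (hw : DifferentiableAt ℝ w z.1) :
    DifferentiableAt ℝ (prodWedge c w) z :=
  (hasFDerivAt_prodWedge hc.hasDerivAt hw.hasFDerivAt).differentiableAt

theorem hasDerivAt_inv_sq (hf : IsWarping f u R) {r : ℝ} (hr : r ∈ R) :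
    HasDerivAt (fun r => (((f r ^ 2)⁻¹ : ℝ) : ℂ))
      (2 * u r / r * (((f r ^ 2)⁻¹ : ℝ) : ℂ)) r := by
  refine ((hasDerivAt_inv_of_log (hasDerivAt_pow_of_log (hf.deriv r hr) 2)
    (pow_ne_zero 2 (hf.f_pos r hr).ne')).ofReal_comp).congr_deriv ?_
  push_cast
  ring

theorem extDeriv_prodPull_eqOn (hS : IsOpen S) {c c₁ : ℝ → ℂ} {w : E → E [⋀^Fin k]→L[ℝ] ℂ}
    (hc : ∀ r ∈ R, HasDerivAt c (c₁ r) r) (hw : ContDiffOn ℝ ∞ w S) :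
    Set.EqOn (extDeriv (prodPull c w)) (prodPull c (extDeriv w) + prodWedge c₁ w) (S ×ˢ R) :=
  fun _ hz => extDeriv_prodPull (hc _ hz.2) (diffAt_of_contDiffOn hS hw hz.1)

theorem extDeriv_prodWedge_eqOn (hS : IsOpen S) {c c₁ : ℝ → ℂ} {w : E → E [⋀^Fin k]→L[ℝ] ℂ}
    (hc : ∀ r ∈ R, HasDerivAt c (c₁ r) r) (hw : ContDiffOn ℝ ∞ w S) :
    Set.EqOn (extDeriv (prodWedge c w)) (prodWedge (fun r => -c r) (extDeriv w)) (S ×ˢ R) :=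
  fun _ hz => (extDeriv_prodWedge (hc _ hz.2).differentiableAt
    (diffAt_of_contDiffOn hS hw hz.1)).trans (alt_neg_smul _ _).symm

theorem laplacianLocal_prodPull_zero (hG : IsMetricOn G S) (hf : IsWarping f u R)
    {c c₁ c₂ : ℝ → ℂ} (hcs : ContDiffOn ℝ ∞ c R) (hc₁s : ContDiffOn ℝ ∞ c₁ R)
    (hc : ∀ r ∈ R, HasDerivAt c (c₁ r) r) (hc₁ : ∀ r ∈ R, HasDerivAt c₁ (c₂ r) r)
    {w : E → E [⋀^Fin 0]→L[ℝ] ℂ} (hw : ContDiffOn ℝ ∞ w S) {z : E × ℝ} (hz : z ∈ S ×ˢ R) :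
    laplacianLocal (prodBasis b) (warpMetric f G) (prodPull c w) z
      = prodPull (fun r => (((f r ^ 2)⁻¹ : ℝ) : ℂ) * c r) (laplacianLocal b G w) z
        - prodPull (radialCoeff (Fintype.card ι) 0 u c₁ c₂) w z := by
  have hU := hG.isOpen.prod hf.isOpen
  have hdw := contDiffOn_extDeriv hG.isOpen hw
  rw [laplacianLocal, codiffLocal_congr Filter.EventuallyEq.rfl
    (eventuallyEq_of_eqOn hU (extDeriv_prodPull_eqOn hG.isOpen hc hw) hz),
    codiffLocal_add (isMetricOn_warpMetric hG hf) (contDiffOn_prodPull hcs hdw)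
      (contDiffOn_prodWedge hc₁s hw) hz,
    codiffLocal_prodPull hG hf hz (hc _ hz.2).differentiableAt hdw,
    codiffLocal_prodWedge_zero hG hf hz (hc₁ _ hz.2) hw, ← sub_eq_add_neg]
  rfl

/-- In the mixed term, `dδ` contributes `(f⁻² c)' dr ∧ δw` and `δd` contributes `-f⁻² c' dr ∧ δw`.
The derivatives of `c` cancel and only `(f⁻²)' c = (2u / r) f⁻² c` survives. -/
theorem laplacianLocal_prodPull_succ (hG : IsMetricOn G S) (hf : IsWarping f u R)
    {c c₁ c₂ : ℝ → ℂ} (hcs : ContDiffOn ℝ ∞ c R) (hc₁s : ContDiffOn ℝ ∞ c₁ R)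
    (hc : ∀ r ∈ R, HasDerivAt c (c₁ r) r) (hc₁ : ∀ r ∈ R, HasDerivAt c₁ (c₂ r) r)
    {w : E → E [⋀^Fin (k + 1)]→L[ℝ] ℂ} (hw : ContDiffOn ℝ ∞ w S) {z : E × ℝ}
    (hz : z ∈ S ×ˢ R) :
    laplacianLocal (prodBasis b) (warpMetric f G) (prodPull c w) z
      = prodPull (fun r => (((f r ^ 2)⁻¹ : ℝ) : ℂ) * c r) (laplacianLocal b G w) z
        - prodPull (radialCoeff (Fintype.card ι) (k + 1) u c₁ c₂) w z
        + prodWedge (fun r => 2 * u r / r * (((f r ^ 2)⁻¹ : ℝ) : ℂ) * c r)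
          (codiffLocal b G w) z := by
  have hU := hG.isOpen.prod hf.isOpen
  have hdw := contDiffOn_extDeriv hG.isOpen hw
  have hδw := contDiffOn_codiffLocal (b := b) hG hw
  have h1 : codiffLocal (prodBasis b) (warpMetric f G) (extDeriv (prodPull c w)) z
      = prodPull (fun r => (((f r ^ 2)⁻¹ : ℝ) : ℂ) * c r) (codiffLocal b G (extDeriv w)) z
        + (-prodPull (radialCoeff (Fintype.card ι) (k + 1) u c₁ c₂) w z
          - prodWedge (fun r => (((f r ^ 2)⁻¹ : ℝ) : ℂ) * c₁ r) (codiffLocal b G w) z) := by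
    rw [codiffLocal_congr Filter.EventuallyEq.rfl
      (eventuallyEq_of_eqOn hU (extDeriv_prodPull_eqOn hG.isOpen hc hw) hz),
      codiffLocal_add (isMetricOn_warpMetric hG hf) (contDiffOn_prodPull hcs hdw)
        (contDiffOn_prodWedge hc₁s hw) hz,
      codiffLocal_prodPull hG hf hz (hc _ hz.2).differentiableAt hdw,
      codiffLocal_prodWedge hG hf hz (hc₁ _ hz.2) hw]
    rfl
  have h2 : extDeriv (codiffLocal (prodBasis b) (warpMetric f G) (prodPull c w)) z
      = prodPull (fun r => (((f r ^ 2)⁻¹ : ℝ) : ℂ) * c r) (extDeriv (codiffLocal b G w)) z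
        + prodWedge (fun r => 2 * u r / r * (((f r ^ 2)⁻¹ : ℝ) : ℂ) * c r
          + (((f r ^ 2)⁻¹ : ℝ) : ℂ) * c₁ r) (codiffLocal b G w) z := by
    rw [Filter.EventuallyEq.extDeriv_eq (eventuallyEq_of_eqOn hU (fun z' hz' =>
      codiffLocal_prodPull hG hf hz' (hc _ hz'.2).differentiableAt hw) hz)]
    exact extDeriv_prodPull ((hasDerivAt_inv_sq hf hz.2).mul (hc _ hz.2))
      (diffAt_of_contDiffOn hG.isOpen hδw hz.1)
  rw [laplacianLocal, Pi.add_apply, h1, h2]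
  simp only [prodPull, prodWedge, laplacianLocal, Pi.add_apply, _root_.map_add, smul_add,
    alt_add_smul]
  abel

/-- With `T` the radial coefficient in degree `k`, `dδ` contributes `-T dw - T' dr ∧ w`, while `δd`
contributes the radial coefficient in degree `k + 1` times `dw`. The two coefficients of `dw` differ
only by `2 r u c`, which is the whole mixed term. -/
theorem laplacianLocal_prodWedge (hG : IsMetricOn G S) (hf : IsWarping f u R)
    {c c₁ t : ℝ → ℂ}
    (hc : ∀ r ∈ R, HasDerivAt c (c₁ r) r)
    (ht : ∀ r ∈ R, HasDerivAt (radialCoeff (Fintype.card ι) k u c c₁) (t r) r)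
    {w : E → E [⋀^Fin k]→L[ℝ] ℂ} (hw : ContDiffOn ℝ ∞ w S) {z : E × ℝ}
    (hz : z ∈ S ×ˢ R) :
    laplacianLocal (prodBasis b) (warpMetric f G) (prodWedge c w) z
      = prodWedge (fun r => (((f r ^ 2)⁻¹ : ℝ) : ℂ) * c r) (laplacianLocal b G w) z
        - prodWedge t w z + prodPull (fun r => 2 * r * u r * c r) (extDeriv w) z := by
  have hU := hG.isOpen.prod hf.isOpen
  have hdw := contDiffOn_extDeriv hG.isOpen hw
  have hwz := diffAt_of_contDiffOn hG.isOpen hw hz.1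
  have e0 : laplacianLocal (prodBasis b) (warpMetric f G) (prodWedge c w) z
      = extDeriv (codiffLocal (prodBasis b) (warpMetric f G) (prodWedge c w)) z
        + codiffLocal (prodBasis b) (warpMetric f G) (extDeriv (prodWedge c w)) z := rfl
  set T := radialCoeff (Fintype.card ι) k u c c₁ with hT
  have h1 : codiffLocal (prodBasis b) (warpMetric f G) (extDeriv (prodWedge c w)) z
      = prodPull (fun r => T r + 2 * r * u r * c r) (extDeriv w) z
          + prodWedge (fun r => (((f r ^ 2)⁻¹ : ℝ) : ℂ) * c r)
            (codiffLocal b G (extDeriv w)) z := by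
    rw [codiffLocal_congr Filter.EventuallyEq.rfl
      (eventuallyEq_of_eqOn hU (extDeriv_prodWedge_eqOn hG.isOpen hc hw) hz),
      codiffLocal_prodWedge hG hf hz (hc _ hz.2).fun_neg hdw]
    -- Passing from `w` to `dw` lowers `n - 2k` by two, hence the extra `2 r u c`.
    have e1 : radialCoeff (Fintype.card ι) (k + 1) u (fun r => -c r) (fun _ => -c₁ z.2) z.2
        = -(T z.2 + 2 * z.2 * u z.2 * c z.2) := by
      simp only [hT, radialCoeff]
      push_cast
      ring
    simp only [prodPull, prodWedge, e1, mul_neg, alt_neg_smul, neg_neg, sub_neg_eq_add]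
  have hTd : DifferentiableAt ℝ (fun r => -T r) z.2 := (ht _ hz.2).fun_neg.differentiableAt
  have hdT : extDeriv (prodPull (fun r => -T r) w) z
      = -prodPull T (extDeriv w) z - prodWedge t w z := by
    rw [extDeriv_prodPull (ht _ hz.2).fun_neg hwz]
    simp only [prodPull, prodWedge, alt_neg_smul, sub_eq_add_neg]
  -- The codifferential of `c dr ∧ w` contains `dr ∧ δw` only when `w` has positive degree.
  cases k with
  | zero =>
    have h2 : extDeriv (codiffLocal (prodBasis b) (warpMetric f G) (prodWedge c w)) z
        = -prodPull T (extDeriv w) z - prodWedge t w z := by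
      rw [Filter.EventuallyEq.extDeriv_eq (eventuallyEq_of_eqOn hU (w' := prodPull (fun r => -T r) w)
        (fun z' hz' => (codiffLocal_prodWedge_zero hG hf hz' (hc _ hz'.2) hw).trans
          (alt_neg_smul _ _).symm) hz), hdT]
    rw [e0, h1, h2]
    simp only [prodPull, prodWedge, laplacianLocal, alt_add_smul]
    abel
  | succ k =>
    have hδw := contDiffOn_codiffLocal (b := b) hG hw
    have hδwz := diffAt_of_contDiffOn hG.isOpen hδw hz.1
    have hq : DifferentiableAt ℝ (fun r => -((((f r ^ 2)⁻¹ : ℝ) : ℂ) * c r)) z.2 :=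
      ((hasDerivAt_inv_sq hf hz.2).mul (hc _ hz.2)).fun_neg.differentiableAt
    have h2 : extDeriv (codiffLocal (prodBasis b) (warpMetric f G) (prodWedge c w)) z
        = -prodPull T (extDeriv w) z - prodWedge t w z
          + prodWedge (fun r => (((f r ^ 2)⁻¹ : ℝ) : ℂ) * c r)
            (extDeriv (codiffLocal b G w)) z := by
      rw [Filter.EventuallyEq.extDeriv_eq (eventuallyEq_of_eqOn hU
        (w' := prodPull (fun r => -T r) w
          + prodWedge (fun r => -((((f r ^ 2)⁻¹ : ℝ) : ℂ) * c r)) (codiffLocal b G w))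
        (fun z' hz' => ?_) hz),
        extDeriv_add (differentiableAt_prodPull hTd hwz) (differentiableAt_prodWedge hq hδwz),
        hdT, extDeriv_prodWedge hq hδwz]
      · simp only [prodWedge, alt_neg_smul, neg_neg]
      · rw [codiffLocal_prodWedge hG hf hz' (hc _ hz'.2) hw]
        simp only [Pi.add_apply, prodPull, prodWedge, alt_neg_smul, sub_eq_add_neg]
        rfl
    rw [e0, h1, h2]
    have e : ∀ μ ν : E [⋀^Fin (k + 1)]→L[ℝ] ℂ, covWedge (ContinuousLinearMap.snd ℝ E ℝ)
        (pullFst E (k + 1) μ + pullFst E (k + 1) ν)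
        = covWedge (ContinuousLinearMap.snd ℝ E ℝ) (pullFst E (k + 1) μ)
          + covWedge (ContinuousLinearMap.snd ℝ E ℝ) (pullFst E (k + 1) ν) := fun μ ν =>
      (covWedgeL (k + 1) (ContinuousLinearMap.snd ℝ E ℝ)).map_add _ _
    simp only [prodPull, prodWedge, laplacianLocal, alt_add_smul, Pi.add_apply, _root_.map_add, e,
      smul_add]
    abel

end WarpedLaplacianFormula

end FormLaplace

end

/-! ### The Poincaré metric in local coordinates -/

noncomputable section

namespace FormLaplace

open ContinuousAlternatingMap

section PoincareLocal

/-- The warping function `(1 - κ r²) / r` of the Poincaré metric. -/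
def poincareWarp (κ r : ℝ) : ℝ := (1 - κ * r ^ 2) / r

/-- The negative logarithmic derivative of `poincareWarp` with respect to `r ∂_r`. -/
def poincareLog (κ r : ℝ) : ℝ := (1 + κ * r ^ 2) / (1 - κ * r ^ 2)

/-- The radii at which the Poincaré metric is used. -/
def poincareDomain (κ : ℝ) : Set ℝ := {r | 0 < r ∧ 0 < 1 - κ * r ^ 2}

theorem poincareDomain_mem_nhdsGT (κ : ℝ) : poincareDomain κ ∈ 𝓝[>] (0 : ℝ) := by
  have h : ContinuousAt (fun r : ℝ => 1 - κ * r ^ 2) 0 := by fun_prop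
  have h2 : ∀ᶠ r in 𝓝 (0 : ℝ), 0 < 1 - κ * r ^ 2 := by
    apply h.eventually
    simpa using (lt_mem_nhds (show (0 : ℝ) < 1 from one_pos))
  filter_upwards [self_mem_nhdsWithin, nhdsWithin_le_nhds h2] with r h3 h4
  exact ⟨h3, h4⟩

theorem isOpen_poincareDomain (κ : ℝ) : IsOpen (poincareDomain κ) :=
  (isOpen_lt continuous_const continuous_id).inter
    (isOpen_lt continuous_const (by fun_prop : Continuous fun r : ℝ => 1 - κ * r ^ 2))

theorem isWarping_poincare (κ : ℝ) :
    IsWarping (poincareWarp κ) (poincareLog κ) (poincareDomain κ) where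
  isOpen := isOpen_poincareDomain κ
  pos := fun _ hr => hr.1
  f_pos := fun _ hr => div_pos hr.2 hr.1
  smooth := by
    refine ContDiffOn.div (by fun_prop) contDiffOn_id fun r hr => hr.1.ne'
  deriv := by
    intro r hr
    have h1 : HasDerivAt (fun r : ℝ => 1 - κ * r ^ 2) (-(κ * (2 * r))) r := by
      simpa using ((hasDerivAt_pow 2 r).const_mul κ).const_sub 1
    have h := hr.1.ne'
    have h' := hr.2.ne'
    refine (h1.div (hasDerivAt_id r) h).congr_deriv ?_
    simp only [poincareLog, poincareWarp, id]
    field_simp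
    ring

theorem hasDerivAt_poincareLog {κ r : ℝ} (hr : r ∈ poincareDomain κ) :
    HasDerivAt (poincareLog κ) (4 * κ * r / (1 - κ * r ^ 2) ^ 2) r := by
  have h0 : HasDerivAt (fun r : ℝ => κ * r ^ 2) (κ * (2 * r)) r := by
    simpa using (hasDerivAt_pow 2 r).const_mul κ
  have h' := hr.2.ne'
  refine ((h0.const_add 1).div (h0.const_sub 1) h').congr_deriv ?_
  field_simp
  ring

theorem hasDerivAt_cpow_real (L : ℂ) {r : ℝ} (hr : 0 < r) :
    HasDerivAt (fun r : ℝ => (r : ℂ) ^ L) (L * (r : ℂ) ^ (L - 1)) r := by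
  have h := (hasDerivAt_id (r : ℂ)).cpow_const (c := L) (Or.inl (by simpa using hr))
  simpa using h.comp_ofReal

theorem contDiffOn_cpow_real (L : ℂ) (κ : ℝ) :
    ContDiffOn ℝ ∞ (fun r : ℝ => (r : ℂ) ^ L) (poincareDomain κ) := by
  intro r hr
  have h1 : AnalyticAt ℂ (fun z : ℂ => z ^ L) (r : ℂ) :=
    analyticAt_id.cpow analyticAt_const (Or.inl (by simpa using hr.1))
  have h2 : ContDiffAt ℝ ∞ (fun z : ℂ => z ^ L) (r : ℂ) :=
    (h1.contDiffAt (n := ∞)).restrict_scalars ℝ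
  exact (h2.comp r Complex.ofRealCLM.contDiff.contDiffAt).contDiffWithinAt

theorem cpow_real_sub_one (L : ℂ) {r : ℝ} (hr : 0 < r) :
    (r : ℂ) ^ (L - 1) = (r : ℂ) ^ L * (r : ℂ)⁻¹ := by
  rw [Complex.cpow_sub _ _ (by exact_mod_cast hr.ne'), Complex.cpow_one, div_eq_mul_inv]

variable {E : Type*} [NormedAddCommGroup E] [NormedSpace ℝ E] [FiniteDimensional ℝ E]
  {ι : Type*} [Fintype ι] [DecidableEq ι] {k : ℕ}
  {b : Module.Basis ι ℝ E} {G : E → Matrix ι ι ℝ} {S : Set E} {κ : ℝ}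

theorem radialCoeff_pull (n k : ℕ) (u : ℝ → ℝ) (L : ℂ) {r : ℝ} (hr : 0 < r) :
    radialCoeff n k u (fun r => L * (r : ℂ) ^ (L - 1))
      (fun r => L * ((L - 1) * (r : ℂ) ^ (L - 1 - 1))) r
      = (r : ℂ) ^ L * (L ^ 2 - (n - 2 * k) * u r * L) := by
  have h : (r : ℂ) ≠ 0 := by exact_mod_cast hr.ne'
  rw [radialCoeff, cpow_real_sub_one _ hr, cpow_real_sub_one _ hr]
  field_simp
  ring

/-- The exponent is `L - 1` because the normal part of the series is written with `dr / r` rather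
than `dr`. -/
theorem radialCoeff_wedge (n k : ℕ) (u : ℝ → ℝ) (L : ℂ) {r : ℝ} (hr : 0 < r) :
    radialCoeff n k u (fun r => (r : ℂ) ^ (L - 1))
      (fun r => (L - 1) * (r : ℂ) ^ (L - 1 - 1)) r
      = (r : ℂ) ^ L * (L - (n - 2 * k) * u r) := by
  have h : (r : ℂ) ≠ 0 := by exact_mod_cast hr.ne'
  rw [radialCoeff, cpow_real_sub_one _ hr, cpow_real_sub_one _ hr]
  field_simp
  ring

/-- The last term is `r u'`: here, unlike for `c(r) w`, the radial coefficient gets differentiated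
and the derivative falls on `u` as well. -/
theorem hasDerivAt_radialCoeff_wedge (n k : ℕ) (L : ℂ) {r : ℝ} (hr : r ∈ poincareDomain κ) :
    HasDerivAt (radialCoeff n k (poincareLog κ) (fun r => (r : ℂ) ^ (L - 1))
      (fun r => (L - 1) * (r : ℂ) ^ (L - 1 - 1)))
      ((r : ℂ) ^ (L - 1) * (L ^ 2 - (n - 2 * k) * poincareLog κ r * L
        - (n - 2 * k) * (4 * κ * r ^ 2 / (1 - κ * r ^ 2) ^ 2))) r := by
  have h1 : HasDerivAt (fun r : ℝ => (r : ℂ) ^ L * (L - (n - 2 * k) * poincareLog κ r))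
      (L * (r : ℂ) ^ (L - 1) * (L - (n - 2 * k) * poincareLog κ r)
        + (r : ℂ) ^ L * (-((n - 2 * k) * ((4 * κ * r / (1 - κ * r ^ 2) ^ 2 : ℝ) : ℂ)))) r :=
    (hasDerivAt_cpow_real L hr.1).mul
      (((hasDerivAt_poincareLog hr).ofReal_comp.const_mul _).const_sub L)
  have h2 : radialCoeff n k (poincareLog κ) (fun r => (r : ℂ) ^ (L - 1))
      (fun r => (L - 1) * (r : ℂ) ^ (L - 1 - 1)) =ᶠ[𝓝 r]
      fun r : ℝ => (r : ℂ) ^ L * (L - (n - 2 * k) * poincareLog κ r) := by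
    filter_upwards [(isOpen_poincareDomain κ).mem_nhds hr] with r' hr'
    exact radialCoeff_wedge n k _ L hr'.1
  refine (h1.congr_of_eventuallyEq h2).congr_deriv ?_
  have h : (r : ℂ) ≠ 0 := by exact_mod_cast hr.1.ne'
  rw [cpow_real_sub_one _ hr.1]
  push_cast
  field_simp
  ring

/-- The tuple `(v_i + s_i r ∂_r)_i`. -/
def frameLocal (v : Fin k → E) (s : Fin k → ℝ) (r : ℝ) : Fin k → E × ℝ :=
  fun i => (v i, s i * r)

/-- The value of `(dr / r) ∧ η` on the tuple `(v_i + s_i r ∂_r)_i`. -/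
def wedgeEval (η : E [⋀^Fin k]→L[ℝ] ℂ) (v : Fin (k + 1) → E) (s : Fin (k + 1) → ℝ) : ℂ :=
  ∑ i : Fin (k + 1), (-1 : ℂ) ^ (i : ℕ) * s i * η (i.removeNth v)

theorem prodPull_frameLocal (c : ℝ → ℂ) (w : E → E [⋀^Fin k]→L[ℝ] ℂ) (y : E) (r : ℝ)
    (v : Fin k → E) (s : Fin k → ℝ) :
    prodPull c w (y, r) (frameLocal v s r) = c r * w y v := rfl

theorem prodWedge_frameLocal (c : ℝ → ℂ) (w : E → E [⋀^Fin k]→L[ℝ] ℂ) (y : E) (r : ℝ)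
    (v : Fin (k + 1) → E) (s : Fin (k + 1) → ℝ) :
    prodWedge c w (y, r) (frameLocal v s r) = c r * r * wedgeEval (w y) v s := by
  have h : ∀ i : Fin (k + 1), pullFst E k (w y) (i.removeNth (frameLocal v s r))
      = w y (i.removeNth v) := fun i => rfl
  rw [prodWedge, ContinuousAlternatingMap.smul_apply, covWedge_apply, wedgeEval, smul_eq_mul,
    mul_assoc, Finset.mul_sum (a := (r : ℂ))]
  congr 1
  refine Finset.sum_congr rfl fun i _ => ?_
  rw [h]
  simp [frameLocal]
  ring

theorem poincareWarp_inv_sq (κ r : ℝ) :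
    (((poincareWarp κ r ^ 2)⁻¹ : ℝ) : ℂ) = r ^ 2 / (1 - κ * r ^ 2) ^ 2 := by
  rw [poincareWarp, div_pow, inv_div]
  push_cast
  rfl

theorem laplacianLocal_pull_function (hG : IsMetricOn G S) (L : ℂ)
    {w : E → E [⋀^Fin 0]→L[ℝ] ℂ} (hw : ContDiffOn ℝ ∞ w S) {y : E} (hy : y ∈ S) {r : ℝ}
    (hr : r ∈ poincareDomain κ) (v : Fin 0 → E) (s : Fin 0 → ℝ) :
    laplacianLocal (prodBasis b) (warpMetric (poincareWarp κ) G)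
        (prodPull (fun r => (r : ℂ) ^ L) w) (y, r) (frameLocal v s r)
      = (r : ℂ) ^ L * (r ^ 2 / (1 - κ * r ^ 2) ^ 2 * laplacianLocal b G w y v
        - (L ^ 2 - Fintype.card ι * poincareLog κ r * L) * w y v) := by
  rw [laplacianLocal_prodPull_zero hG (isWarping_poincare κ) (contDiffOn_cpow_real L κ)
    (contDiffOn_const.mul (contDiffOn_cpow_real (L - 1) κ))
    (fun r hr => hasDerivAt_cpow_real L hr.1)
    (fun r hr => (hasDerivAt_cpow_real (L - 1) hr.1).const_mul L) hw ⟨hy, hr⟩,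
    ContinuousAlternatingMap.sub_apply, prodPull_frameLocal, prodPull_frameLocal,
    radialCoeff_pull _ _ _ _ hr.1, poincareWarp_inv_sq]
  push_cast
  ring

theorem laplacianLocal_pull_form (hG : IsMetricOn G S) (L : ℂ)
    {w : E → E [⋀^Fin (k + 1)]→L[ℝ] ℂ} (hw : ContDiffOn ℝ ∞ w S) {y : E} (hy : y ∈ S) {r : ℝ}
    (hr : r ∈ poincareDomain κ) (v : Fin (k + 1) → E) (s : Fin (k + 1) → ℝ) :
    laplacianLocal (prodBasis b) (warpMetric (poincareWarp κ) G)
        (prodPull (fun r => (r : ℂ) ^ L) w) (y, r) (frameLocal v s r)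
      = (r : ℂ) ^ L * (r ^ 2 / (1 - κ * r ^ 2) ^ 2 * laplacianLocal b G w y v
        - (L ^ 2 - (Fintype.card ι - 2 * (k + 1)) * poincareLog κ r * L) * w y v
        + 2 * poincareLog κ r * (r ^ 2 / (1 - κ * r ^ 2) ^ 2) *
          wedgeEval (codiffLocal b G w y) v s) := by
  rw [laplacianLocal_prodPull_succ hG (isWarping_poincare κ) (contDiffOn_cpow_real L κ)
    (contDiffOn_const.mul (contDiffOn_cpow_real (L - 1) κ))
    (fun r hr => hasDerivAt_cpow_real L hr.1)
    (fun r hr => (hasDerivAt_cpow_real (L - 1) hr.1).const_mul L) hw ⟨hy, hr⟩,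
    ContinuousAlternatingMap.add_apply, ContinuousAlternatingMap.sub_apply, prodPull_frameLocal,
    prodPull_frameLocal, prodWedge_frameLocal,
    radialCoeff_pull _ _ _ _ hr.1, poincareWarp_inv_sq]
  have h : (r : ℂ) ≠ 0 := by exact_mod_cast hr.1.ne'
  have e : 2 * (poincareLog κ r : ℂ) / r * (r ^ 2 / (1 - κ * r ^ 2) ^ 2) * (r : ℂ) ^ L * r
      = 2 * (poincareLog κ r : ℂ) * (r ^ 2 / (1 - κ * r ^ 2) ^ 2) * (r : ℂ) ^ L := by
    rw [div_mul_eq_mul_div, div_mul_eq_mul_div, div_mul_cancel₀ _ h]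
  rw [e]
  push_cast
  ring

/-- In the application `k = p - 1`, so `n - 2k` is `β + 2` with `β = n - 2p`; this is the source of
the shifts by two in the normal recurrence. -/
theorem laplacianLocal_wedge_form (hG : IsMetricOn G S) (L : ℂ)
    {w : E → E [⋀^Fin k]→L[ℝ] ℂ} (hw : ContDiffOn ℝ ∞ w S) {y : E} (hy : y ∈ S) {r : ℝ}
    (hr : r ∈ poincareDomain κ) (v : Fin (k + 1) → E) (s : Fin (k + 1) → ℝ) :
    laplacianLocal (prodBasis b) (warpMetric (poincareWarp κ) G)
        (prodWedge (fun r => (r : ℂ) ^ (L - 1)) w) (y, r) (frameLocal v s r)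
      = (r : ℂ) ^ L * (r ^ 2 / (1 - κ * r ^ 2) ^ 2 * wedgeEval (laplacianLocal b G w y) v s
        - (L ^ 2 - (Fintype.card ι - 2 * k) * poincareLog κ r * L
          - (Fintype.card ι - 2 * k) * (4 * κ * r ^ 2 / (1 - κ * r ^ 2) ^ 2))
            * wedgeEval (w y) v s
        + 2 * poincareLog κ r * extDeriv w y v) := by
  rw [laplacianLocal_prodWedge hG (isWarping_poincare κ)
    (fun r hr => hasDerivAt_cpow_real (L - 1) hr.1)
    (fun r hr => hasDerivAt_radialCoeff_wedge _ _ _ hr) hw ⟨hy, hr⟩,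
    ContinuousAlternatingMap.add_apply, ContinuousAlternatingMap.sub_apply, prodPull_frameLocal,
    prodWedge_frameLocal, prodWedge_frameLocal, poincareWarp_inv_sq]
  have h : (r : ℂ) ≠ 0 := by exact_mod_cast hr.1.ne'
  have e : (r : ℂ) ^ (L - 1) * r = (r : ℂ) ^ L := by
    rw [cpow_real_sub_one _ hr.1, mul_assoc, inv_mul_cancel₀ h, mul_one]
  rw [← e]
  ring

end PoincareLocal

end FormLaplace

end

/-! ### Charts of the base manifold -/

noncomputable section

namespace FormLaplace

section Charts

variable {n : ℕ} {M : Type*} [TopologicalSpace M] [ChartedSpace (EuclideanSpace ℝ (Fin n)) M]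
  [IsManifold (𝓡 n) ∞ M]

theorem isManifold_one : IsManifold (𝓡 n) 1 M := IsManifold.of_le (n := ∞) (by simp)

theorem mdifferentiableAt_chart_symm (x : M) {y : EuclideanSpace ℝ (Fin n)}
    (hy : y ∈ (extChartAt (𝓡 n) x).target) :
    MDifferentiableAt 𝓘(ℝ, EuclideanSpace ℝ (Fin n)) (𝓡 n) (extChartAt (𝓡 n) x).symm y := by
  have : IsManifold (𝓡 n) 1 M := isManifold_one
  have h := mdifferentiableWithinAt_extChartAt_symm (I := 𝓡 n) hy
  -- The model has no boundary, so derivatives within its range are ordinary derivatives.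
  rw [(𝓡 n).range_eq_univ] at h
  exact mdifferentiableWithinAt_univ.1 h

theorem mfderiv_chart_comp_symm (x : M) {y : EuclideanSpace ℝ (Fin n)}
    (hy : y ∈ (extChartAt (𝓡 n) x).target) (v : EuclideanSpace ℝ (Fin n)) :
    mfderiv (𝓡 n) 𝓘(ℝ, EuclideanSpace ℝ (Fin n)) (extChartAt (𝓡 n) x)
      ((extChartAt (𝓡 n) x).symm y)
      (mfderiv 𝓘(ℝ, EuclideanSpace ℝ (Fin n)) (𝓡 n) (extChartAt (𝓡 n) x).symm y v) = v := by
  have : IsManifold (𝓡 n) 1 M := isManifold_one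
  have h := mfderiv_extChartAt_comp_mfderivWithin_extChartAt_symm (I := 𝓡 n) hy
  rw [(𝓡 n).range_eq_univ, mfderivWithin_univ] at h
  exact DFunLike.congr_fun h v

theorem mfderiv_symm_comp_chart (x : M) (v : TangentSpace (𝓡 n) x) :
    mfderiv 𝓘(ℝ, EuclideanSpace ℝ (Fin n)) (𝓡 n) (extChartAt (𝓡 n) x).symm (extChartAt (𝓡 n) x x)
      (mfderiv (𝓡 n) 𝓘(ℝ, EuclideanSpace ℝ (Fin n)) (extChartAt (𝓡 n) x) x v) = v := by
  have : IsManifold (𝓡 n) 1 M := isManifold_one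
  have h := mfderivWithin_extChartAt_symm_comp_mfderiv_extChartAt' (I := 𝓡 n)
    (mem_extChartAt_source (I := 𝓡 n) x)
  rw [(𝓡 n).range_eq_univ, mfderivWithin_univ] at h
  exact DFunLike.congr_fun h v

/-- A coordinate field is the tangent map of the inverse chart composed with a constant section, and
tangent maps of smooth maps are smooth. -/
theorem contMDiffOn_coordinate_field (x : M) (v : EuclideanSpace ℝ (Fin n)) :
    ContMDiffOn 𝓘(ℝ, EuclideanSpace ℝ (Fin n)) ((𝓡 n).prod 𝓘(ℝ, EuclideanSpace ℝ (Fin n))) ∞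
      (fun y => (Bundle.TotalSpace.mk' (EuclideanSpace ℝ (Fin n)) ((extChartAt (𝓡 n) x).symm y)
        (mfderiv 𝓘(ℝ, EuclideanSpace ℝ (Fin n)) (𝓡 n) (extChartAt (𝓡 n) x).symm y v) :
          TangentBundle (𝓡 n) M)) (extChartAt (𝓡 n) x).target := by
  have : IsManifold (𝓡 n) 1 M := isManifold_one
  have hopen : IsOpen (extChartAt (𝓡 n) x).target := isOpen_extChartAt_target x
  have h1 := (contMDiffOn_extChartAt_symm (I := 𝓡 n) (n := ∞) x).contMDiffOn_tangentMapWithin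
    (m := ∞) (by simp) hopen.uniqueMDiffOn
  have h2 : ContMDiff 𝓘(ℝ, EuclideanSpace ℝ (Fin n))
      (𝓘(ℝ, EuclideanSpace ℝ (Fin n)).prod 𝓘(ℝ, EuclideanSpace ℝ (Fin n))) ∞
      (fun y => (Bundle.TotalSpace.mk' (EuclideanSpace ℝ (Fin n)) y v :
        TangentBundle 𝓘(ℝ, EuclideanSpace ℝ (Fin n)) (EuclideanSpace ℝ (Fin n)))) :=
    contMDiff_vectorSpace_iff_contDiff.2 contDiff_const
  refine (h1.comp h2.contMDiffOn fun y hy => hy).congr fun y hy => ?_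
  simp only [Function.comp, tangentMapWithin]
  rw [mfderivWithin_of_isOpen hopen hy]

theorem contDiffOn_metric_inChart
    (h : Bundle.ContMDiffRiemannianMetric (𝓡 n) ∞ (EuclideanSpace ℝ (Fin n))
      (fun x : M => TangentSpace (𝓡 n) x)) (x : M) (i j : Fin n) :
    ContDiffOn ℝ ∞ (fun y => MetricField.inChart (coordM n) (fun x u v => h.inner x u v) x y i j)
      (extChartAt (𝓡 n) x).target := by
  rw [← contMDiffOn_iff_contDiffOn]
  have hψ := h.contMDiff.comp_contMDiffOn (contMDiffOn_extChartAt_symm (I := 𝓡 n) (n := ∞) x)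
  have h1 := contMDiffOn_coordinate_field x (coordM n i)
  have h2 := contMDiffOn_coordinate_field x (coordM n j)
  intro y hy
  have : ContMDiffWithinAt 𝓘(ℝ, EuclideanSpace ℝ (Fin n)) ((𝓡 n).prod 𝓘(ℝ, ℝ)) ∞
      (fun y => Bundle.TotalSpace.mk' ℝ (E := Bundle.Trivial M ℝ) ((extChartAt (𝓡 n) x).symm y)
        (h.inner ((extChartAt (𝓡 n) x).symm y)
          (mfderiv 𝓘(ℝ, EuclideanSpace ℝ (Fin n)) (𝓡 n) (extChartAt (𝓡 n) x).symm y (coordM n i))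
          (mfderiv 𝓘(ℝ, EuclideanSpace ℝ (Fin n)) (𝓡 n) (extChartAt (𝓡 n) x).symm y
            (coordM n j)))) (extChartAt (𝓡 n) x).target y := by
    apply ContMDiffWithinAt.clm_bundle_apply₂ (F₁ := EuclideanSpace ℝ (Fin n))
      (F₂ := EuclideanSpace ℝ (Fin n))
    · exact hψ y hy
    · exact h1 y hy
    · exact h2 y hy
  simp only [Bundle.contMDiffWithinAt_totalSpace] at this
  exact this.2

theorem dotProduct_mulVec_bilin {V : Type*} [AddCommGroup V] [Module ℝ V] [TopologicalSpace V]
    [IsTopologicalAddGroup V] [ContinuousSMul ℝ V] (B : V →L[ℝ] V →L[ℝ] ℝ) (e : Fin n → V)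
    (a : Fin n → ℝ) :
    a ⬝ᵥ (Matrix.of fun i j => B (e i) (e j)).mulVec a
      = B (∑ i, a i • e i) (∑ i, a i • e i) := by
  simp only [dotProduct, Matrix.mulVec, Matrix.of_apply, map_sum, map_smul,
    _root_.sum_apply, _root_.smul_apply, smul_eq_mul, Finset.mul_sum]
  rw [Finset.sum_comm]
  refine Finset.sum_congr rfl fun i _ => Finset.sum_congr rfl fun j _ => ?_
  ring

theorem isMetricOn_inChart
    (h : Bundle.ContMDiffRiemannianMetric (𝓡 n) ∞ (EuclideanSpace ℝ (Fin n))
      (fun x : M => TangentSpace (𝓡 n) x)) (x : M) :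
    IsMetricOn (MetricField.inChart (coordM n) (fun x u v => h.inner x u v) x)
      (extChartAt (𝓡 n) x).target where
  isOpen := isOpen_extChartAt_target x
  smooth := contDiffOn_metric_inChart h x
  det_pos := by
    intro y hy
    set D : EuclideanSpace ℝ (Fin n) →L[ℝ]
        TangentSpace (𝓡 n) ((extChartAt (𝓡 n) x).symm y) :=
      mfderiv 𝓘(ℝ, EuclideanSpace ℝ (Fin n)) (𝓡 n) (extChartAt (𝓡 n) x).symm y with hD
    -- The matrix is the Gram matrix of the coordinate vectors. These are independent because the
    -- derivative of the inverse chart has a left inverse, so the Gram matrix is positive definite.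
    refine Matrix.PosDef.det_pos (Matrix.PosDef.of_dotProduct_mulVec_pos ?_ fun a ha => ?_)
    · ext i j
      exact h.symm _ _ _
    · have hsum : ∑ i, a i • coordM n i ≠ 0 := by
        intro h0
        apply ha
        funext i
        exact Fintype.linearIndependent_iff.1 (coordM n).linearIndependent a h0 i
      have hne : D (∑ i, a i • coordM n i) ≠ 0 := by
        intro h0
        apply hsum
        rw [← mfderiv_chart_comp_symm x hy (∑ i, a i • coordM n i)]
        exact (congrArg _ h0).trans (map_zero _)
      have hpos := h.pos _ _ hne
      have e := dotProduct_mulVec_bilin (h.inner ((extChartAt (𝓡 n) x).symm y))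
        (fun i => D (coordM n i)) a
      rw [map_sum] at hpos
      simp only [map_smul] at hpos
      rw [← e] at hpos
      exact hpos

end Charts

end FormLaplace

end

/-! ### Charts of the product with the real line -/

noncomputable section

namespace FormLaplace

section ProductCharts

variable {n : ℕ} {M : Type*} [TopologicalSpace M] [ChartedSpace (EuclideanSpace ℝ (Fin n)) M]
  [IsManifold (𝓡 n) ∞ M]

theorem extChartAt_prod_real_symm (x : M) (r : ℝ) (z : EuclideanSpace ℝ (Fin n) × ℝ) :
    (extChartAt ((𝓡 n).prod 𝓘(ℝ, ℝ)) ((x, r) : M × ℝ)).symm z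
      = ((extChartAt (𝓡 n) x).symm z.1, z.2) := by
  rw [extChartAt_prod]
  simp [chartAt_self_eq]

theorem extChartAt_prod_real (x : M) (r : ℝ) (z : M × ℝ) :
    (extChartAt ((𝓡 n).prod 𝓘(ℝ, ℝ)) ((x, r) : M × ℝ)) z = (extChartAt (𝓡 n) x z.1, z.2) := by
  rw [extChartAt_prod]
  simp [chartAt_self_eq]

/-- The derivative of the inverse chart around `x`, on the model space. -/
def chartSymmD (x : M) (y : EuclideanSpace ℝ (Fin n)) :
    EuclideanSpace ℝ (Fin n) →L[ℝ] EuclideanSpace ℝ (Fin n) :=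
  mfderiv 𝓘(ℝ, EuclideanSpace ℝ (Fin n)) (𝓡 n) (extChartAt (𝓡 n) x).symm y

/-- The derivative of the chart around `x` at `x`, on the model space. -/
def chartD (x : M) : EuclideanSpace ℝ (Fin n) →L[ℝ] EuclideanSpace ℝ (Fin n) :=
  mfderiv (𝓡 n) 𝓘(ℝ, EuclideanSpace ℝ (Fin n)) (extChartAt (𝓡 n) x) x

theorem mfderiv_prod_real_symm (x : M) (r : ℝ) {z : EuclideanSpace ℝ (Fin n) × ℝ}
    (hz : z.1 ∈ (extChartAt (𝓡 n) x).target) :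
    mfderiv 𝓘(ℝ, EuclideanSpace ℝ (Fin n) × ℝ) ((𝓡 n).prod 𝓘(ℝ, ℝ))
        (extChartAt ((𝓡 n).prod 𝓘(ℝ, ℝ)) ((x, r) : M × ℝ)).symm z
      = ((chartSymmD x z.1).prodMap (ContinuousLinearMap.id ℝ ℝ) :
        EuclideanSpace ℝ (Fin n) × ℝ →L[ℝ] EuclideanSpace ℝ (Fin n) × ℝ) := by
  have h1 := (mdifferentiableAt_chart_symm x hz).hasMFDerivAt
  have h2 := HasMFDerivAt.comp z h1
    ((hasFDerivAt_fst (𝕜 := ℝ) (E := EuclideanSpace ℝ (Fin n)) (F := ℝ) (p := z)).hasMFDerivAt)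
  have h3 := (hasFDerivAt_snd (𝕜 := ℝ) (E := EuclideanSpace ℝ (Fin n)) (F := ℝ)
    (p := z)).hasMFDerivAt
  have h4 := HasMFDerivAt.prodMk h2 h3
  have e : ⇑(extChartAt ((𝓡 n).prod 𝓘(ℝ, ℝ)) ((x, r) : M × ℝ)).symm
      = fun z : EuclideanSpace ℝ (Fin n) × ℝ => ((extChartAt (𝓡 n) x).symm z.1, z.2) :=
    funext fun z => extChartAt_prod_real_symm x r z
  rw [e]
  exact h4.mfderiv

theorem mfderiv_prod_real (x : M) (r : ℝ) :
    mfderiv ((𝓡 n).prod 𝓘(ℝ, ℝ)) 𝓘(ℝ, EuclideanSpace ℝ (Fin n) × ℝ)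
        (extChartAt ((𝓡 n).prod 𝓘(ℝ, ℝ)) ((x, r) : M × ℝ)) (x, r)
      = ((chartD x).prodMap (ContinuousLinearMap.id ℝ ℝ) :
        EuclideanSpace ℝ (Fin n) × ℝ →L[ℝ] EuclideanSpace ℝ (Fin n) × ℝ) := by
  have : IsManifold (𝓡 n) 1 M := isManifold_one
  have h1 := (mdifferentiableAt_extChartAt (I := 𝓡 n) (mem_chart_source _ x)).hasMFDerivAt
  have h2 := HasMFDerivAt.comp ((x, r) : M × ℝ) h1
    (hasMFDerivAt_fst (I := 𝓡 n) (I' := 𝓘(ℝ, ℝ)) ((x, r) : M × ℝ))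
  have h3 := hasMFDerivAt_snd (I := 𝓡 n) (I' := 𝓘(ℝ, ℝ)) ((x, r) : M × ℝ)
  have h4 := HasMFDerivAt.comp ((x, r) : M × ℝ)
    ((ContinuousLinearMap.inl ℝ (EuclideanSpace ℝ (Fin n)) ℝ).hasMFDerivAt) h2
  have h5 := HasMFDerivAt.comp ((x, r) : M × ℝ)
    ((ContinuousLinearMap.inr ℝ (EuclideanSpace ℝ (Fin n)) ℝ).hasMFDerivAt) h3
  have h6 := (HasMFDerivAt.add h4 h5).mfderiv
  -- The chart of the product is written as a sum of two maps into the vector space `E × ℝ`, each a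
  -- composition whose derivative is known.
  have e : ⇑(extChartAt ((𝓡 n).prod 𝓘(ℝ, ℝ)) ((x, r) : M × ℝ))
      = (⇑(ContinuousLinearMap.inl ℝ (EuclideanSpace ℝ (Fin n)) ℝ) ∘
          (⇑(extChartAt (𝓡 n) x) ∘ Prod.fst)
        + ⇑(ContinuousLinearMap.inr ℝ (EuclideanSpace ℝ (Fin n)) ℝ) ∘ Prod.snd) := by
    funext z
    rw [extChartAt_prod_real x r z]
    simp
  rw [e]
  refine h6.trans ?_
  apply ContinuousLinearMap.ext
  rintro ⟨v, s⟩
  have e2 : ((chartD x v, (0 : ℝ)) : EuclideanSpace ℝ (Fin n) × ℝ) + (0, s) = (chartD x v, s) := by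
    simp
  exact e2

theorem poincareMetric_inChart
    (h : Bundle.ContMDiffRiemannianMetric (𝓡 n) ∞ (EuclideanSpace ℝ (Fin n))
      (fun x : M => TangentSpace (𝓡 n) x)) (κ : ℝ) (x : M) (r : ℝ)
    {z : EuclideanSpace ℝ (Fin n) × ℝ} (hz : z.1 ∈ (extChartAt (𝓡 n) x).target) :
    MetricField.inChart (coordX n) (poincareMetric (fun x u v => h.inner x u v) κ)
        ((x, r) : M × ℝ) z
      = warpMetric (poincareWarp κ)
        (MetricField.inChart (coordM n) (fun x u v => h.inner x u v) x) z := by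
  obtain ⟨B, hB⟩ : ∃ B : EuclideanSpace ℝ (Fin n) →L[ℝ] EuclideanSpace ℝ (Fin n) →L[ℝ] ℝ,
      B = h.inner ((extChartAt (𝓡 n) x).symm z.1) := ⟨_, rfl⟩
  have key : ∀ u v : EuclideanSpace ℝ (Fin n) × ℝ,
      poincareMetric (fun x u v => h.inner x u v) κ
        ((extChartAt ((𝓡 n).prod 𝓘(ℝ, ℝ)) ((x, r) : M × ℝ)).symm z)
        (mfderiv 𝓘(ℝ, EuclideanSpace ℝ (Fin n) × ℝ) ((𝓡 n).prod 𝓘(ℝ, ℝ))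
          (extChartAt ((𝓡 n).prod 𝓘(ℝ, ℝ)) ((x, r) : M × ℝ)).symm z u)
        (mfderiv 𝓘(ℝ, EuclideanSpace ℝ (Fin n) × ℝ) ((𝓡 n).prod 𝓘(ℝ, ℝ))
          (extChartAt ((𝓡 n).prod 𝓘(ℝ, ℝ)) ((x, r) : M × ℝ)).symm z v)
      = (z.2 ^ 2)⁻¹ * (u.2 * v.2 + (1 - κ * z.2 ^ 2) ^ 2 *
        B (chartSymmD x z.1 u.1) (chartSymmD x z.1 v.1)) := by
    intro u v
    rw [mfderiv_prod_real_symm x r hz, extChartAt_prod_real_symm x r z, hB]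
    rfl
  have key2 : ∀ i j, MetricField.inChart (coordM n) (fun x u v => h.inner x u v) x z.1 i j
      = B (chartSymmD x z.1 (coordM n i)) (chartSymmD x z.1 (coordM n j)) := by
    intro i j
    rw [hB]
    rfl
  have hf : poincareWarp κ z.2 ^ 2 = (z.2 ^ 2)⁻¹ * (1 - κ * z.2 ^ 2) ^ 2 := by
    rw [poincareWarp, div_pow, div_eq_inv_mul]
  ext i j
  refine (key (coordX n i) (coordX n j)).trans ?_
  rcases i with i | i <;> rcases j with j | j <;>
    simp [prodBasis_inl, prodBasis_inr, warpMetric, hf, key2, mul_assoc]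

theorem pullM_inChart {k : ℕ} (w : Form (𝓡 n) M k) (x : M) (r : ℝ)
    {z : EuclideanSpace ℝ (Fin n) × ℝ} (hz : z.1 ∈ (extChartAt (𝓡 n) x).target) :
    (pullM w).inChart ((x, r) : M × ℝ) z = pullFst _ k (w.inChart x z.1) := by
  rw [Form.inChart, mfderiv_prod_real_symm x r hz, extChartAt_prod_real_symm x r z]
  rfl

theorem drWedge_inChart {k : ℕ} (w : Form (𝓡 n) M k) (x : M) (r : ℝ)
    {z : EuclideanSpace ℝ (Fin n) × ℝ} (hz : z.1 ∈ (extChartAt (𝓡 n) x).target) :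
    (drWedge (pullM w)).inChart ((x, r) : M × ℝ) z
      = covWedge (ContinuousLinearMap.snd ℝ _ ℝ) (pullFst _ k (w.inChart x z.1)) := by
  rw [Form.inChart, mfderiv_prod_real_symm x r hz, extChartAt_prod_real_symm x r z]
  exact covWedge_comp (V := EuclideanSpace ℝ (Fin n) × ℝ) (V' := EuclideanSpace ℝ (Fin n) × ℝ)
    (ContinuousLinearMap.snd ℝ (EuclideanSpace ℝ (Fin n)) ℝ)
    (pullFst (EuclideanSpace ℝ (Fin n)) k (w ((extChartAt (𝓡 n) x).symm z.1)))
    ((chartSymmD x z.1).prodMap (ContinuousLinearMap.id ℝ ℝ))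

end ProductCharts

end FormLaplace

end

/-! ### The Laplacian of the partial sums -/

noncomputable section

namespace FormLaplace

open ContinuousAlternatingMap

section AnsatzLaplacian

theorem sum_smul_add_smul_comp {V V' : Type*} [NormedAddCommGroup V] [NormedSpace ℝ V]
    [NormedAddCommGroup V'] [NormedSpace ℝ V'] {k : ℕ} {J : Type*} (t : Finset J) (c : J → ℂ)
    (d : ℂ) (a e : J → V [⋀^Fin k]→L[ℝ] ℂ) (A : V' →L[ℝ] V) :
    (∑ j ∈ t, c j • (a j + d • e j)).compContinuousLinearMap A
      = ∑ j ∈ t, c j • ((a j).compContinuousLinearMap A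
        + d • (e j).compContinuousLinearMap A) := by
  ext v
  simp [ContinuousAlternatingMap.sum_apply]

variable {n : ℕ} {M : Type*} [TopologicalSpace M] [ChartedSpace (EuclideanSpace ℝ (Fin n)) M]

/-- The value of `(dr / r) ∧ η` on the tuple `(v_i + s_i r ∂_r)_i`, for a `(p-1)`-form `η`. -/
def predEval : {p : ℕ} → PredForm (𝓡 n) M p → (x : M) → (Fin p → TangentSpace (𝓡 n) x) →
    (Fin p → ℝ) → ℂ
  | 0, _, _, _, _ => 0
  | q + 1, η, x, v, s => wedgeEval (E := EuclideanSpace ℝ (Fin n)) (k := q) (η ⟨q, rfl⟩ x) v s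

theorem drWedgePull_frame {p : ℕ} (η : PredForm (𝓡 n) M p) (x : M) (r : ℝ)
    (v : Fin p → TangentSpace (𝓡 n) x) (s : Fin p → ℝ) :
    drWedgePull η (x, r) (frame v s r) = r * predEval η x v s := by
  cases p with
  | zero => exact (mul_zero _).symm
  | succ q =>
    have h := prodWedge_frameLocal (E := EuclideanSpace ℝ (Fin n)) (k := q) (fun _ => 1)
      (fun _ => η ⟨q, rfl⟩ x) 0 r v s
    have h' : prodWedge (E := EuclideanSpace ℝ (Fin n)) (k := q) (fun _ => 1)
        (fun _ => η ⟨q, rfl⟩ x) (0, r) = covWedge (ContinuousLinearMap.snd ℝ _ ℝ)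
          (pullFst (EuclideanSpace ℝ (Fin n)) q (η ⟨q, rfl⟩ x)) := one_smul ℂ _
    rw [one_mul, h'] at h
    exact h

theorem ansatz_frame {p : ℕ} (lam : ℂ) (wp : ℕ → Form (𝓡 n) M p) (wm : ℕ → PredForm (𝓡 n) M p)
    (N : ℕ) (x : M) {r : ℝ} (hr : 0 < r) (v : Fin p → TangentSpace (𝓡 n) x) (s : Fin p → ℝ) :
    ansatz lam wp wm N (x, r) (frame v s r)
      = ∑ j ∈ Finset.range (N + 1), (r : ℂ) ^ (lam + j) * (wp j x v + predEval (wm j) x v s) := by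
  have h : (r : ℂ) ≠ 0 := by exact_mod_cast hr.ne'
  have h1 : ∀ j, pullM (wp j) (x, r) (frame v s r) = wp j x v := fun j => rfl
  rw [ansatz, ContinuousAlternatingMap.sum_apply]
  refine Finset.sum_congr rfl fun j _ => ?_
  rw [ContinuousAlternatingMap.smul_apply, ContinuousAlternatingMap.add_apply,
    ContinuousAlternatingMap.smul_apply, h1, drWedgePull_frame, smul_eq_mul, smul_eq_mul,
    inv_mul_cancel_left₀ h]

variable [IsManifold (𝓡 n) ∞ M]

/-- At the centre of the chart, the derivatives of the chart and of its inverse cancel, so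
evaluation in the chart agrees with evaluation on `M`. -/
theorem inChart_self_chartD {k : ℕ} (w : Form (𝓡 n) M k) (x : M)
    (v : Fin k → EuclideanSpace ℝ (Fin n)) :
    w.inChart x (extChartAt (𝓡 n) x x) (fun i => chartD x (v i)) = w x v := by
  have h1 : ∀ q, q = x → (w q : EuclideanSpace ℝ (Fin n) [⋀^Fin k]→L[ℝ] ℂ) v = w x v := by
    rintro q rfl
    rfl
  refine Eq.trans ?_ (h1 ((extChartAt (𝓡 n) x).symm (extChartAt (𝓡 n) x x))
    (extChartAt_to_inv (I := 𝓡 n) x))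
  exact congrArg (w ((extChartAt (𝓡 n) x).symm (extChartAt (𝓡 n) x x)))
    (funext fun i => mfderiv_symm_comp_chart x (v i))

theorem wedgeEval_inChart_self {k : ℕ} (w : Form (𝓡 n) M k) (x : M)
    (v : Fin (k + 1) → EuclideanSpace ℝ (Fin n)) (s : Fin (k + 1) → ℝ) :
    wedgeEval (w.inChart x (extChartAt (𝓡 n) x x)) (fun i => chartD x (v i)) s
      = wedgeEval (E := EuclideanSpace ℝ (Fin n)) (w x) v s := by
  unfold wedgeEval
  refine Finset.sum_congr rfl fun i _ => ?_
  congr 1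
  exact inChart_self_chartD w x (i.removeNth v)

theorem ansatz_inChart {p : ℕ} (lam : ℂ) (wp : ℕ → Form (𝓡 n) M p)
    (wm : ℕ → PredForm (𝓡 n) M p) (N : ℕ) (x : M) (r : ℝ)
    {z : EuclideanSpace ℝ (Fin n) × ℝ} :
    (ansatz lam wp wm N).inChart ((x, r) : M × ℝ) z
      = ∑ j ∈ Finset.range (N + 1), ((z.2 : ℂ) ^ (lam + j)) •
        ((pullM (wp j)).inChart ((x, r) : M × ℝ) z
          + (z.2 : ℂ)⁻¹ • (drWedgePull (wm j)).inChart ((x, r) : M × ℝ) z) := by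
  have e : ((extChartAt ((𝓡 n).prod 𝓘(ℝ, ℝ)) ((x, r) : M × ℝ)).symm z).2 = z.2 := by
    rw [extChartAt_prod_real_symm]
  have h := sum_smul_add_smul_comp (V := EuclideanSpace ℝ (Fin n) × ℝ)
    (V' := EuclideanSpace ℝ (Fin n) × ℝ) (Finset.range (N + 1))
    (fun j => (z.2 : ℂ) ^ (lam + j)) (z.2 : ℂ)⁻¹
    (fun j => pullM (wp j) ((extChartAt ((𝓡 n).prod 𝓘(ℝ, ℝ)) ((x, r) : M × ℝ)).symm z))
    (fun j => drWedgePull (wm j) ((extChartAt ((𝓡 n).prod 𝓘(ℝ, ℝ)) ((x, r) : M × ℝ)).symm z))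
    (mfderiv 𝓘(ℝ, EuclideanSpace ℝ (Fin n) × ℝ) ((𝓡 n).prod 𝓘(ℝ, ℝ))
      (extChartAt ((𝓡 n).prod 𝓘(ℝ, ℝ)) ((x, r) : M × ℝ)).symm z)
  refine Eq.trans ?_ h
  rw [Form.inChart, ansatz, e]
  rfl

theorem ansatz_inChart_zero (lam : ℂ) (wp : ℕ → Form (𝓡 n) M 0)
    (wm : ℕ → PredForm (𝓡 n) M 0) (N : ℕ) (x : M) (r : ℝ)
    {z : EuclideanSpace ℝ (Fin n) × ℝ} (hz : z.1 ∈ (extChartAt (𝓡 n) x).target) :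
    (ansatz lam wp wm N).inChart ((x, r) : M × ℝ) z
      = ∑ j ∈ Finset.range (N + 1),
        prodPull (fun r => (r : ℂ) ^ (lam + j)) ((wp j).inChart x) z := by
  rw [ansatz_inChart]
  refine Finset.sum_congr rfl fun j _ => ?_
  rw [pullM_inChart _ x r hz]
  have : (drWedgePull (wm j)).inChart ((x, r) : M × ℝ) z = 0 := by
    ext v
    rfl
  rw [this, alt_smul_zero, add_zero]
  rfl

theorem ansatz_inChart_succ {q : ℕ} (lam : ℂ) (wp : ℕ → Form (𝓡 n) M (q + 1))
    (wm : ℕ → PredForm (𝓡 n) M (q + 1)) (N : ℕ) (x : M) (r : ℝ)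
    {z : EuclideanSpace ℝ (Fin n) × ℝ} (hz : z.1 ∈ (extChartAt (𝓡 n) x).target) (hz2 : 0 < z.2) :
    (ansatz lam wp wm N).inChart ((x, r) : M × ℝ) z
      = ∑ j ∈ Finset.range (N + 1),
        (prodPull (fun r => (r : ℂ) ^ (lam + j)) ((wp j).inChart x) z
          + prodWedge (fun r => (r : ℂ) ^ (lam + j - 1)) ((wm j ⟨q, rfl⟩).inChart x) z) := by
  rw [ansatz_inChart]
  refine Finset.sum_congr rfl fun j _ => ?_
  rw [pullM_inChart _ x r hz, smul_add, smul_smul, prodWedge, cpow_real_sub_one _ hz2]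
  have : (drWedgePull (wm j)).inChart ((x, r) : M × ℝ) z
      = covWedge (ContinuousLinearMap.snd ℝ _ ℝ) (pullFst _ q ((wm j ⟨q, rfl⟩).inChart x z.1)) :=
    drWedge_inChart _ x r hz
  rw [this]
  rfl

/-- The chart is the identity in `r`, so `r ∂_r` is its own coordinate expression and only the
tangential parts of the vectors are transformed. -/
theorem laplacian_frame
    (g : MetricField ((𝓡 n).prod 𝓘(ℝ, ℝ)) (M × ℝ)) {p : ℕ}
    (w : Form ((𝓡 n).prod 𝓘(ℝ, ℝ)) (M × ℝ) p) (x : M) (r : ℝ)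
    (v : Fin p → TangentSpace (𝓡 n) x) (s : Fin p → ℝ) :
    Form.laplacian (coordX n) g w (x, r) (frame v s r)
      = laplacianLocal (prodBasis (coordM n)) (g.inChart (coordX n) (x, r)) (w.inChart (x, r))
        (extChartAt (𝓡 n) x x, r) (frameLocal (fun i => chartD x (v i)) s r) := by
  rw [Form.laplacian, fromChart, mfderiv_prod_real, extChartAt_prod_real]
  rfl

end AnsatzLaplacian

end FormLaplace

end

/-! ### The components of the Laplacian of the partial sums -/

noncomputable section

namespace FormLaplace

open ContinuousAlternatingMap

section Components

variable {n : ℕ} {M : Type*} [TopologicalSpace M] [ChartedSpace (EuclideanSpace ℝ (Fin n)) M]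

/-- The factor of `r ^ L` in the tangential component of `Δ (r^L α + (dr / r) ∧ r^L η)`, where
`a`, `a₂`, `a₁` are the values of `α`, `Δ α`, `d η`. -/
def plusTerm (κ : ℝ) (β L a a₂ a₁ : ℂ) (r : ℝ) : ℂ :=
  r ^ 2 / (1 - κ * r ^ 2) ^ 2 * a₂ - (L ^ 2 - β * poincareLog κ r * L) * a
    + 2 * poincareLog κ r * a₁

/-- The factor of `r ^ L` in the normal component of `Δ (r^L α + (dr / r) ∧ r^L η)`, where
`a`, `a₂`, `a₁` are the values of `η`, `Δ η`, `δ α`. -/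
def minusTerm (κ : ℝ) (β L a a₂ a₁ : ℂ) (r : ℝ) : ℂ :=
  r ^ 2 / (1 - κ * r ^ 2) ^ 2 * a₂
    - (L ^ 2 - (β + 2) * poincareLog κ r * L
      - (β + 2) * (4 * κ * r ^ 2 / (1 - κ * r ^ 2) ^ 2)) * a
    + 2 * poincareLog κ r * (r ^ 2 / (1 - κ * r ^ 2) ^ 2) * a₁

variable [IsManifold (𝓡 n) ∞ M]

/-- Additivity reduces this to single powers. Degree `p = 0` is separate because functions have
neither a normal component nor a codifferential. -/
theorem laplacian_ansatz_frame
    (h : Bundle.ContMDiffRiemannianMetric (𝓡 n) ∞ (EuclideanSpace ℝ (Fin n))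
      (fun x : M => TangentSpace (𝓡 n) x)) (κ : ℝ)
    {g : MetricField (𝓡 n) M} (hg : g = fun x u v => h.inner x u v) {p : ℕ} (lam : ℂ)
    (wp : ℕ → Form (𝓡 n) M p) (wm : ℕ → PredForm (𝓡 n) M p)
    (hwp : ∀ j, Form.IsSmooth (wp j)) (hwm : ∀ j, PredForm.IsSmooth (wm j))
    (N : ℕ) (x : M) {r : ℝ} (hr : r ∈ poincareDomain κ)
    (v : Fin p → TangentSpace (𝓡 n) x) (s : Fin p → ℝ) :
    Form.laplacian (coordX n) (poincareMetric g κ) (ansatz lam wp wm N) (x, r) (frame v s r)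
      = ∑ j ∈ Finset.range (N + 1), (r : ℂ) ^ (lam + j) *
        (plusTerm κ (n - 2 * p) (lam + j) (wp j x v) (Form.laplacian (coordM n) g (wp j) x v)
            (PredForm.d (wm j) x v) r
          + minusTerm κ (n - 2 * p) (lam + j) (predEval (wm j) x v s)
            (predEval (PredForm.laplacian (coordM n) g (wm j)) x v s)
            (predEval (Form.codiffPred (coordM n) g (wp j)) x v s) r) := by
  have hmet : IsMetricOn (MetricField.inChart (coordM n) g x) (extChartAt (𝓡 n) x).target := by
    rw [hg]
    exact isMetricOn_inChart h x
  have hwarp := isMetricOn_warpMetric hmet (isWarping_poincare κ)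
  have hy : extChartAt (𝓡 n) x x ∈ (extChartAt (𝓡 n) x).target := mem_extChartAt_target x
  have hG : (poincareMetric g κ).inChart (coordX n) ((x, r) : M × ℝ)
      =ᶠ[𝓝 (extChartAt (𝓡 n) x x, r)]
        warpMetric (poincareWarp κ) (MetricField.inChart (coordM n) g x) := by
    refine eventuallyEq_of_eqOn hwarp.isOpen ?_ ⟨hy, hr⟩
    intro z hz
    rw [hg]
    exact poincareMetric_inChart h κ x r hz.1
  obtain ⟨V, hV⟩ : ∃ V : Fin p → EuclideanSpace ℝ (Fin n), V = fun i => chartD x (v i) := ⟨_, rfl⟩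
  rw [laplacian_frame, ← hV]
  cases p with
  | zero =>
    have hw : (ansatz lam wp wm N).inChart ((x, r) : M × ℝ) =ᶠ[𝓝 (extChartAt (𝓡 n) x x, r)]
        ∑ j ∈ Finset.range (N + 1),
          prodPull (fun r => (r : ℂ) ^ (lam + j)) ((wp j).inChart x) := by
      refine eventuallyEq_of_eqOn hwarp.isOpen ?_ ⟨hy, hr⟩
      intro z hz
      rw [Finset.sum_apply]
      exact ansatz_inChart_zero lam wp wm N x r hz.1
    rw [laplacianLocal_congr hG hw, laplacianLocal_sum hwarp _
      (fun j => contDiffOn_prodPull (contDiffOn_cpow_real _ κ) (hwp j x)) ⟨hy, hr⟩,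
      ContinuousAlternatingMap.sum_apply]
    refine Finset.sum_congr rfl fun j _ => ?_
    rw [laplacianLocal_pull_function hmet _ (hwp j x) hy hr, plusTerm, minusTerm]
    have e0 : laplacianLocal (coordM n) (MetricField.inChart (coordM n) g x) ((wp j).inChart x)
        (extChartAt (𝓡 n) x x) V
        = Form.laplacian (coordM n) g (wp j) x v := hV ▸ rfl
    have e5 : (wp j).inChart x (extChartAt (𝓡 n) x x) V = wp j x v :=
      hV ▸ inChart_self_chartD (wp j) x v
    have e1 : PredForm.d (wm j) x v = 0 := rfl
    have e2 : ∀ η : PredForm (𝓡 n) M 0, predEval η x v s = 0 := fun _ => rfl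
    rw [e0, e1, e2, e2, e2, e5, Fintype.card_fin]
    push_cast
    ring
  | succ q =>
    have hw : (ansatz lam wp wm N).inChart ((x, r) : M × ℝ) =ᶠ[𝓝 (extChartAt (𝓡 n) x x, r)]
        ∑ j ∈ Finset.range (N + 1),
          (prodPull (fun r => (r : ℂ) ^ (lam + j)) ((wp j).inChart x)
            + prodWedge (fun r => (r : ℂ) ^ (lam + j - 1)) ((wm j ⟨q, rfl⟩).inChart x)) := by
      refine eventuallyEq_of_eqOn hwarp.isOpen ?_ ⟨hy, hr⟩
      intro z hz
      rw [Finset.sum_apply]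
      exact ansatz_inChart_succ lam wp wm N x r hz.1 hz.2.1
    have hs1 := fun j => contDiffOn_prodPull (contDiffOn_cpow_real (lam + (j : ℕ)) κ) (hwp j x)
    have hs2 := fun j => contDiffOn_prodWedge (contDiffOn_cpow_real (lam + (j : ℕ) - 1) κ)
      (hwm j ⟨q, rfl⟩ x)
    rw [laplacianLocal_congr hG hw, laplacianLocal_sum hwarp _
      (w := fun j : ℕ => prodPull (fun r => (r : ℂ) ^ (lam + j)) ((wp j).inChart x)
        + prodWedge (fun r => (r : ℂ) ^ (lam + j - 1)) ((wm j ⟨q, rfl⟩).inChart x))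
      (fun j => (hs1 j).add (hs2 j)) ⟨hy, hr⟩, ContinuousAlternatingMap.sum_apply]
    refine Finset.sum_congr rfl fun j _ => ?_
    rw [laplacianLocal_add hwarp (hs1 j) (hs2 j) ⟨hy, hr⟩, ContinuousAlternatingMap.add_apply,
      laplacianLocal_pull_form hmet _ (hwp j x) hy hr,
      laplacianLocal_wedge_form hmet _ (hwm j ⟨q, rfl⟩ x) hy hr,
      plusTerm, minusTerm]
    have e0 : laplacianLocal (coordM n) (MetricField.inChart (coordM n) g x) ((wp j).inChart x)
        (extChartAt (𝓡 n) x x) V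
        = Form.laplacian (coordM n) g (wp j) x v := hV ▸ rfl
    have e1 : extDeriv ((wm j ⟨q, rfl⟩).inChart x) (extChartAt (𝓡 n) x x)
        V = PredForm.d (wm j) x v := hV ▸ rfl
    have e2 : wedgeEval (codiffLocal (coordM n) (MetricField.inChart (coordM n) g x)
        ((wp j).inChart x) (extChartAt (𝓡 n) x x)) V s
        = predEval (Form.codiffPred (coordM n) g (wp j)) x v s := hV ▸ rfl
    have e3 : wedgeEval (laplacianLocal (coordM n) (MetricField.inChart (coordM n) g x)
        ((wm j ⟨q, rfl⟩).inChart x) (extChartAt (𝓡 n) x x)) V s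
        = predEval (PredForm.laplacian (coordM n) g (wm j)) x v s := hV ▸ rfl
    have e5 : (wp j).inChart x (extChartAt (𝓡 n) x x) V = wp j x v :=
      hV ▸ inChart_self_chartD (wp j) x v
    have e4 : wedgeEval ((wm j ⟨q, rfl⟩).inChart x (extChartAt (𝓡 n) x x)) V s
        = predEval (wm j) x v s := hV ▸ wedgeEval_inChart_self (wm j ⟨q, rfl⟩) x v s
    rw [e0, e1, e2, e3, e4, e5, Fintype.card_fin]
    push_cast
    ring

end Components

end FormLaplace

end

/-! ### Comparison of coefficients -/

noncomputable section

namespace FormLaplace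

section Coefficients

open Asymptotics Polynomial

/-- Factors `X` are split off one at a time: if `X^N Q` is `O(r^(N+1))`, then `Q` tends to `0` at
the origin, so `Q(0) = 0` by continuity and `X` divides `Q`. -/
theorem isBigO_pow_iff_X_pow_dvd (P : ℂ[X]) (N : ℕ) :
    (fun r : ℝ => P.eval (r : ℂ)) =O[𝓝[>] 0] (fun r : ℝ => (r : ℂ) ^ N) ↔ X ^ N ∣ P := by
  have hcont : ∀ Q : ℂ[X], Filter.Tendsto (fun r : ℝ => Q.eval (r : ℂ)) (𝓝[>] 0)
      (𝓝 (Q.eval 0)) := by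
    intro Q
    have h : Continuous fun r : ℝ => Q.eval (r : ℂ) := Q.continuous.comp Complex.continuous_ofReal
    have h2 := h.tendsto 0
    rw [Complex.ofReal_zero] at h2
    exact h2.mono_left nhdsWithin_le_nhds
  constructor
  · induction N with
    | zero => exact fun _ => ⟨P, by simp⟩
    | succ N ih =>
      intro h
      have h1 : (fun r : ℝ => (r : ℂ) ^ (N + 1)) =O[𝓝[>] 0] (fun r : ℝ => (r : ℂ) ^ N) := by
        have h2 := ((hcont X).isBigO_one ℂ).mul (isBigO_refl (fun r : ℝ => (r : ℂ) ^ N) (𝓝[>] 0))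
        simpa [pow_succ'] using h2
      obtain ⟨Q, rfl⟩ := ih (h.trans h1)
      have h3 : (fun r : ℝ => Q.eval (r : ℂ)) =O[𝓝[>] 0] (fun r : ℝ => (r : ℂ)) := by
        have h4 := (isBigO_refl (fun r : ℝ => ((r : ℂ) ^ N)⁻¹) (𝓝[>] 0)).mul h
        refine h4.congr' ?_ ?_
        · filter_upwards [self_mem_nhdsWithin] with r hr
          have hr' : (r : ℂ) ≠ 0 := by exact_mod_cast (show (0 : ℝ) < r from hr).ne'
          simp [hr']
        · filter_upwards [self_mem_nhdsWithin] with r hr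
          have hr' : (r : ℂ) ≠ 0 := by exact_mod_cast (show (0 : ℝ) < r from hr).ne'
          rw [pow_succ, inv_mul_cancel_left₀ (pow_ne_zero _ hr')]
      have h5 : Filter.Tendsto (fun r : ℝ => Q.eval (r : ℂ)) (𝓝[>] 0) (𝓝 0) := by
        refine h3.trans_tendsto ?_
        simpa using hcont X
      have h6 : Q.eval 0 = 0 := tendsto_nhds_unique (hcont Q) h5
      have h7 : X ∣ Q := by
        rw [X_dvd_iff, coeff_zero_eq_eval_zero, h6]
      rw [pow_succ]
      exact mul_dvd_mul_left _ h7
  · rintro ⟨Q, rfl⟩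
    have h := (isBigO_refl (fun r : ℝ => (r : ℂ) ^ N) (𝓝[>] 0)).mul ((hcont Q).isBigO_one ℂ)
    simpa using h

/-- The monomial of index `j, k` has degree `j + 2k ≥ j`, so below degree `N` the truncated sum
already has every contribution; `back` discards the negative indices. -/
theorem coeff_sum_sum_monomial (c : Fin 4 → ℕ → ℂ) {N m : ℕ} (hm : m < N) :
    (∑ j ∈ Finset.range N, ∑ k : Fin 4, monomial (j + 2 * (k : ℕ)) (c k j)).coeff m
      = ∑ k : Fin 4, back (c k) (2 * (k : ℕ)) m := by
  rw [finsetSum_coeff, Finset.sum_congr rfl fun j _ => finsetSum_coeff _ _ _, Finset.sum_comm]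
  refine Finset.sum_congr rfl fun k _ => ?_
  simp only [coeff_monomial, back]
  split_ifs with h
  · rw [Finset.sum_eq_single (m - 2 * (k : ℕ))]
    · rw [if_pos (by omega)]
    · intro j _ hj
      rw [if_neg (by omega)]
    · intro h'
      exact absurd (Finset.mem_range.2 (by omega)) h'
  · exact Finset.sum_eq_zero fun j _ => if_neg (by omega)

/-- A sum of polynomials of degree at most `3` in `r ^ 2`, times `r ^ j`, is `O(r^N)` if and only if
all the coefficients of lower order vanish. -/
theorem isBigO_sum_iff (c : Fin 4 → ℕ → ℂ) (N : ℕ) :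
    (fun r : ℝ => ∑ j ∈ Finset.range N, (r : ℂ) ^ j * ∑ k : Fin 4, (r : ℂ) ^ (2 * (k : ℕ)) * c k j)
      =O[𝓝[>] 0] (fun r : ℝ => (r : ℂ) ^ N)
      ↔ ∀ m < N, ∑ k : Fin 4, back (c k) (2 * (k : ℕ)) m = 0 := by
  have e : (fun r : ℝ =>
      ∑ j ∈ Finset.range N, (r : ℂ) ^ j * ∑ k : Fin 4, (r : ℂ) ^ (2 * (k : ℕ)) * c k j)
      = fun r : ℝ => (∑ j ∈ Finset.range N, ∑ k : Fin 4,
        monomial (j + 2 * (k : ℕ)) (c k j)).eval (r : ℂ) := by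
    funext r
    rw [eval_finsetSum]
    refine Finset.sum_congr rfl fun j _ => ?_
    rw [eval_finsetSum, Finset.mul_sum]
    refine Finset.sum_congr rfl fun k _ => ?_
    rw [eval_monomial, pow_add]
    ring
  rw [e, isBigO_pow_iff_X_pow_dvd, X_pow_dvd_iff]
  refine forall_congr' fun m => forall_congr' fun hm => ?_
  rw [coeff_sum_sum_monomial c hm]

theorem isBigO_mul_iff {u F G : ℝ → ℂ} (hu : Filter.Tendsto u (𝓝[>] 0) (𝓝 1)) :
    (fun r => u r * F r) =O[𝓝[>] 0] G ↔ F =O[𝓝[>] 0] G := by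
  have hne : ∀ᶠ r in 𝓝[>] (0 : ℝ), u r ≠ 0 := hu.eventually_ne one_ne_zero
  constructor
  · intro h
    have h1 := ((hu.inv₀ one_ne_zero).isBigO_one ℂ).mul h
    refine h1.congr' ?_ (by simp)
    filter_upwards [hne] with r hr
    rw [inv_mul_cancel_left₀ hr]
  · intro h
    simpa using (hu.isBigO_one ℂ).mul h

/-- On `r > 0` the factor `r^λ` is invertible, for complex `λ` too, and can be cancelled on both
sides. -/
theorem isBigO_cpow_mul_iff (lam : ℂ) (F : ℝ → ℂ) (N : ℕ) :
    (fun r : ℝ => (r : ℂ) ^ lam * F r) =O[𝓝[>] 0] (fun r : ℝ => (r : ℂ) ^ (lam + N))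
      ↔ F =O[𝓝[>] 0] (fun r : ℝ => (r : ℂ) ^ N) := by
  have hne : ∀ r : ℝ, r ∈ Set.Ioi (0 : ℝ) → (r : ℂ) ≠ 0 := fun r hr => by
    exact_mod_cast (show (0 : ℝ) < r from hr).ne'
  constructor
  · intro h
    refine ((isBigO_refl (fun r : ℝ => (r : ℂ) ^ (-lam)) (𝓝[>] 0)).mul h).congr' ?_ ?_
    · filter_upwards [self_mem_nhdsWithin] with r hr
      rw [← mul_assoc, ← Complex.cpow_add _ _ (hne r hr), neg_add_cancel, Complex.cpow_zero,
        one_mul]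
    · filter_upwards [self_mem_nhdsWithin] with r hr
      rw [← Complex.cpow_add _ _ (hne r hr), neg_add_cancel_left, Complex.cpow_natCast]
  · intro h
    refine ((isBigO_refl (fun r : ℝ => (r : ℂ) ^ lam) (𝓝[>] 0)).mul h).congr' ?_ ?_
    · exact Filter.EventuallyEq.rfl
    · filter_upwards [self_mem_nhdsWithin] with r hr
      rw [Complex.cpow_add _ _ (hne r hr), Complex.cpow_natCast]

theorem tendsto_poincareFactor (κ : ℝ) (k : ℕ) :
    Filter.Tendsto (fun r : ℝ => (1 - (κ : ℂ) * (r : ℂ) ^ 2) ^ k) (𝓝[>] 0) (𝓝 1) := by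
  have h : Continuous fun r : ℝ => (1 - (κ : ℂ) * (r : ℂ) ^ 2) ^ k := by fun_prop
  have h2 := h.tendsto 0
  simp only [Complex.ofReal_zero, ne_eq, OfNat.ofNat_ne_zero, not_false_eq_true, zero_pow, mul_zero,
    sub_zero, one_pow] at h2
  exact h2.mono_left nhdsWithin_le_nhds

/-- The coefficients of `(1 - κ r²)²` times the tangential component of the eigenequation. -/
def plusPoly (κ : ℝ) (β lam : ℂ) (a a₂ a₁ : ℕ → ℂ) (k : Fin 4) (j : ℕ) : ℂ :=
  ![-((lam + j) ^ 2 - β * (lam + j) + lam * (β - lam)) * a j + 2 * a₁ j,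
    a₂ j + 2 * κ * ((lam + j) ^ 2 + lam * (β - lam)) * a j,
    -κ ^ 2 * ((lam + j) ^ 2 + β * (lam + j) + lam * (β - lam)) * a j - 2 * κ ^ 2 * a₁ j, 0] k

/-- The coefficients of `(1 - κ r²)³` times the normal component of the eigenequation. -/
def minusPoly (κ : ℝ) (β lam : ℂ) (a a₂ a₁ : ℕ → ℂ) (k : Fin 4) (j : ℕ) : ℂ :=
  ![-((lam + j) ^ 2 - (β + 2) * (lam + j) + lam * (β - lam)) * a j,
    a₂ j + 2 * a₁ j + κ * (3 * ((lam + j) ^ 2 + lam * (β - lam)) - (β + 2) * (lam + j)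
      + 4 * (β + 2)) * a j,
    -κ * a₂ j + 2 * κ * a₁ j - κ ^ 2 * (3 * ((lam + j) ^ 2 + lam * (β - lam))
      + (β + 2) * (lam + j) + 4 * (β + 2)) * a j,
    κ ^ 3 * ((lam + j) ^ 2 + (β + 2) * (lam + j) + lam * (β - lam)) * a j] k

/-- The denominators are those of `f⁻²` and `u`, so a square clears them. The result has degree two
in `r²`; its fourth coefficient is zero, to match the shape of the normal component. -/
theorem plusPoly_spec {κ : ℝ} (β lam : ℂ) (a a₂ a₁ : ℕ → ℂ) (j : ℕ) {r : ℝ}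
    (hr : r ∈ poincareDomain κ) :
    (1 - (κ : ℂ) * (r : ℂ) ^ 2) ^ 2 * (plusTerm κ β (lam + j) (a j) (a₂ j) (a₁ j) r
        - lam * (β - lam) * a j)
      = ∑ k : Fin 4, (r : ℂ) ^ (2 * (k : ℕ)) * plusPoly κ β lam a a₂ a₁ k j := by
  have h : (1 - (κ : ℂ) * (r : ℂ) ^ 2) ≠ 0 := by exact_mod_cast hr.2.ne'
  simp only [plusTerm, poincareLog, plusPoly, Fin.sum_univ_four, Complex.ofReal_div,
    Complex.ofReal_sub, Complex.ofReal_add, Complex.ofReal_mul, Complex.ofReal_pow,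
    Complex.ofReal_one]
  simp
  field_simp
  ring

/-- The product `u f⁻²` in front of `δα` has denominator `(1 - κ r²)³`, hence the cube and the extra
term with `κ³`. -/
theorem minusPoly_spec {κ : ℝ} (β lam : ℂ) (a a₂ a₁ : ℕ → ℂ) (j : ℕ) {r : ℝ}
    (hr : r ∈ poincareDomain κ) :
    (1 - (κ : ℂ) * (r : ℂ) ^ 2) ^ 3 * (minusTerm κ β (lam + j) (a j) (a₂ j) (a₁ j) r
        - lam * (β - lam) * a j)
      = ∑ k : Fin 4, (r : ℂ) ^ (2 * (k : ℕ)) * minusPoly κ β lam a a₂ a₁ k j := by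
  have h : (1 - (κ : ℂ) * (r : ℂ) ^ 2) ≠ 0 := by exact_mod_cast hr.2.ne'
  simp only [minusTerm, poincareLog, minusPoly, Fin.sum_univ_four, Complex.ofReal_div,
    Complex.ofReal_sub, Complex.ofReal_add, Complex.ofReal_mul, Complex.ofReal_pow,
    Complex.ofReal_one]
  simp
  field_simp
  ring

theorem isBigO_term_iff {κ : ℝ} (lam : ℂ) (l : ℕ) (t : ℕ → ℝ → ℂ) (c : Fin 4 → ℕ → ℂ)
    (hc : ∀ j, ∀ r ∈ poincareDomain κ, (1 - (κ : ℂ) * (r : ℂ) ^ 2) ^ l * t j r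
      = ∑ k : Fin 4, (r : ℂ) ^ (2 * (k : ℕ)) * c k j) (N : ℕ) :
    (fun r : ℝ => ∑ j ∈ Finset.range N, (r : ℂ) ^ (lam + j) * t j r)
      =O[𝓝[>] 0] (fun r : ℝ => (r : ℂ) ^ (lam + N))
      ↔ ∀ m < N, ∑ k : Fin 4, back (c k) (2 * (k : ℕ)) m = 0 := by
  rw [← isBigO_sum_iff, ← isBigO_mul_iff (tendsto_poincareFactor κ l),
    ← isBigO_cpow_mul_iff lam]
  refine isBigO_congr ?_ Filter.EventuallyEq.rfl
  filter_upwards [poincareDomain_mem_nhdsGT κ] with r hr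
  have hne : (r : ℂ) ≠ 0 := by exact_mod_cast hr.1.ne'
  rw [Finset.mul_sum, Finset.mul_sum]
  refine Finset.sum_congr rfl fun j _ => ?_
  rw [← hc j r hr, Complex.cpow_add _ _ hne, Complex.cpow_natCast]
  ring

/-- The coefficient of `r^m` collects the terms with `j = m, m - 2, m - 4`. The leading one is the
indicial polynomial `(λ+m)² - β(λ+m) + λ(β-λ) = -m(β - 2λ - m)`, that is `a_m`. -/
theorem sum_back_plusPoly (κ : ℝ) (β lam : ℂ) (a a₂ a₁ : ℕ → ℂ) (m : ℕ) :
    ∑ k : Fin 4, back (plusPoly κ β lam a a₂ a₁ k) (2 * (k : ℕ)) m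
      = (coeffb β lam m * κ * back a 2 m + coeffc β lam m * κ ^ 2 * back a 4 m + back a₂ 2 m
        + 2 * a₁ m - 2 * κ ^ 2 * back a₁ 4 m) - coeffa β lam m * a m := by
  have h : ∀ k, k ≤ m → ((m - k : ℕ) : ℂ) = m - k := fun k hk => Nat.cast_sub hk
  simp only [Fin.sum_univ_four, plusPoly, back, coeffa, coeffb, coeffc]
  simp
  split_ifs with h2 h4
  · rw [h 2 h2, h 4 h4]
    push_cast
    ring
  · rw [h 2 h2]
    push_cast
    ring
  · omega
  · ring

/-- Here the terms are `j = m, m - 2, m - 4, m - 6`, and the leading coefficient is the same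
indicial polynomial with `β + 2` in place of `β` in its linear term, which is `A_m`. -/
theorem sum_back_minusPoly (κ : ℝ) (β lam : ℂ) (a a₂ a₁ : ℕ → ℂ) (m : ℕ) :
    ∑ k : Fin 4, back (minusPoly κ β lam a a₂ a₁ k) (2 * (k : ℕ)) m
      = (coeffB β lam m * κ * back a 2 m + coeffC β lam m * κ ^ 2 * back a 4 m
        + coeffD β lam m * κ ^ 3 * back a 6 m + back a₂ 2 m - κ * back a₂ 4 m
        + 2 * back a₁ 2 m + 2 * κ * back a₁ 4 m) - coeffA β lam m * a m := by
  have h : ∀ k, k ≤ m → ((m - k : ℕ) : ℂ) = m - k := fun k hk => Nat.cast_sub hk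
  simp only [Fin.sum_univ_four, minusPoly, back, coeffA, coeffB, coeffC, coeffD]
  simp
  split_ifs with h2 h4 h6 h6
  · rw [h 2 h2, h 4 h4, h 6 h6]
    push_cast
    ring
  · rw [h 2 h2, h 4 h4]
    push_cast
    ring
  all_goals first
    | omega
    | (rw [h 2 h2]; push_cast; ring)
    | ring

end Coefficients

end FormLaplace

end

/-! ### The eigenequation and the recurrence relations -/

noncomputable section

namespace FormLaplace

section Eigenequation

variable {n : ℕ} {M : Type*} [TopologicalSpace M] [ChartedSpace (EuclideanSpace ℝ (Fin n)) M]
  {p : ℕ}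

theorem predEval_succ {q : ℕ} (η : PredForm (𝓡 n) M (q + 1)) (x : M)
    (v : Fin (q + 1) → TangentSpace (𝓡 n) x) (s : Fin (q + 1) → ℝ) :
    predEval η x v s
      = ∑ i : Fin (q + 1), (-1 : ℂ) ^ (i : ℕ) * s i * η ⟨q, rfl⟩ x (i.removeNth v) := rfl

theorem predEval_zero_right (η : PredForm (𝓡 n) M p) (x : M)
    (v : Fin p → TangentSpace (𝓡 n) x) : predEval η x v 0 = 0 := by
  cases p with
  | zero => rfl
  | succ q => simp [predEval_succ]

theorem predEval_zero (x : M) (v : Fin p → TangentSpace (𝓡 n) x) (s : Fin p → ℝ) :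
    predEval (0 : PredForm (𝓡 n) M p) x v s = 0 := by
  cases p with
  | zero => rfl
  | succ q => simp [predEval_succ]

theorem predEval_add (η θ : PredForm (𝓡 n) M p) (x : M) (v : Fin p → TangentSpace (𝓡 n) x)
    (s : Fin p → ℝ) : predEval (η + θ) x v s = predEval η x v s + predEval θ x v s := by
  cases p with
  | zero => exact (add_zero _).symm
  | succ q => simp [predEval_succ, mul_add, Finset.sum_add_distrib]

theorem predEval_sub (η θ : PredForm (𝓡 n) M p) (x : M) (v : Fin p → TangentSpace (𝓡 n) x)
    (s : Fin p → ℝ) : predEval (η - θ) x v s = predEval η x v s - predEval θ x v s := by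
  cases p with
  | zero => exact (sub_zero _).symm
  | succ q => simp [predEval_succ, mul_sub, Finset.sum_sub_distrib]

theorem predEval_smul (c : ℂ) (η : PredForm (𝓡 n) M p) (x : M)
    (v : Fin p → TangentSpace (𝓡 n) x) (s : Fin p → ℝ) :
    predEval (c • η) x v s = c * predEval η x v s := by
  cases p with
  | zero => exact (mul_zero _).symm
  | succ q => simp [predEval_succ, Finset.mul_sum, mul_left_comm]

/-- A `(p-1)`-form `η` is determined by the values of `(dr / r) ∧ η`. -/
theorem predForm_ext {η θ : PredForm (𝓡 n) M p}
    (h : ∀ x v s, predEval η x v s = predEval θ x v s) : η = θ := by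
  funext q
  obtain ⟨q, rfl⟩ := q
  funext x
  apply ContinuousAlternatingMap.ext
  intro v
  -- Testing on `(r ∂_r, v)`: the first vector has `s = 1` and no tangential part, and the others
  -- have `s = 0`, so only the term of index `0` survives and returns the value on `v`.
  have h1 : ∀ ζ : PredForm (𝓡 n) M (q + 1), predEval ζ x
      (Fin.cons (0 : EuclideanSpace ℝ (Fin n)) v) (Pi.single 0 1) = ζ ⟨q, rfl⟩ x v := by
    intro ζ
    rw [predEval_succ, Finset.sum_eq_single 0]
    rotate_left
    · intro i _ hi
      rw [Pi.single_eq_of_ne hi]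
      simp
    · simp
    rw [Pi.single_eq_same]
    simp only [Fin.val_zero, pow_zero, Complex.ofReal_one, one_mul]
    rfl
  rw [← h1, ← h1, h]

theorem predForm_zero_degree (η : PredForm (𝓡 n) M 0) : η = 0 := predForm_ext fun _ _ _ => rfl

theorem inChart_zero_form {k : ℕ} (x : M) : (0 : Form (𝓡 n) M k).inChart x = 0 := by
  funext y
  ext v
  rfl

theorem laplacian_zero_form (g : MetricField (𝓡 n) M) {k : ℕ} :
    Form.laplacian (coordM n) g (0 : Form (𝓡 n) M k) = 0 := by
  funext x
  rw [Form.laplacian, inChart_zero_form, laplacianLocal_zero]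
  apply ContinuousAlternatingMap.ext
  intro v
  rfl

theorem laplacian_zero_predForm (g : MetricField (𝓡 n) M) :
    PredForm.laplacian (coordM n) g (0 : PredForm (𝓡 n) M p) = 0 := by
  funext q
  exact laplacian_zero_form g

theorem d_zero_predForm : PredForm.d (0 : PredForm (𝓡 n) M p) = 0 := by
  cases p with
  | zero => rfl
  | succ q =>
    funext x
    have h : PredForm.d (0 : PredForm (𝓡 n) M (q + 1)) x
        = fromChart x (extDeriv ((0 : Form (𝓡 n) M q).inChart x) (extChartAt (𝓡 n) x x)) := rfl
    rw [h, inChart_zero_form, extDeriv_zero_form]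
    apply ContinuousAlternatingMap.ext
    intro v
    rfl

theorem codiffPred_zero_form (g : MetricField (𝓡 n) M) :
    Form.codiffPred (coordM n) g (0 : Form (𝓡 n) M p) = 0 := by
  funext q
  obtain ⟨q, rfl⟩ := q
  funext x
  have h : Form.codiffPred (coordM n) g (0 : Form (𝓡 n) M (q + 1)) ⟨q, rfl⟩ x
      = fromChart x (codiffLocal (coordM n) (g.inChart (coordM n) x)
        ((0 : Form (𝓡 n) M (q + 1)).inChart x) (extChartAt (𝓡 n) x x)) := rfl
  rw [h, inChart_zero_form, codiffLocal_zero]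
  apply ContinuousAlternatingMap.ext
  intro v
  rfl

/-- Terms with negative index are zero, so a map commutes with the index shift as soon as it sends
`0` to `0`. -/
theorem apply_back {V W : Type*} [Zero V] [Zero W] (T : V → W) (hT : T 0 = 0) (w : ℕ → V)
    (k j : ℕ) : T (back w k j) = back (fun j => T (w j)) k j := by
  unfold back
  split_ifs
  · rfl
  · exact hT

theorem plusRecurrence_iff (g : MetricField (𝓡 n) M) (κ : ℝ) (lam : ℂ)
    (wp : ℕ → Form (𝓡 n) M p) (wm : ℕ → PredForm (𝓡 n) M p) (m : ℕ) :
    PlusRecurrence g κ lam wp wm m ↔ ∀ x v,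
      ∑ k : Fin 4, back (plusPoly κ (n - 2 * p) lam (fun j => wp j x v)
        (fun j => Form.laplacian (coordM n) g (wp j) x v) (fun j => PredForm.d (wm j) x v) k)
          (2 * (k : ℕ)) m = 0 := by
  have h2 : ∀ x v, (fun (w : Form (𝓡 n) M p) => Form.laplacian (coordM n) g w x v) 0 = 0 := by
    intro x v
    simp only [laplacian_zero_form]
    rfl
  have h3 : ∀ x v, (fun (w : PredForm (𝓡 n) M p) => PredForm.d w x v) 0 = 0 := by
    intro x v
    simp only [d_zero_predForm]
    rfl
  have key : PlusRecurrence g κ lam wp wm m ↔ ∀ x v, coeffa (n - 2 * p) lam m * wp m x v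
      = (coeffb (n - 2 * p) lam m * κ) * back wp 2 m x v
        + (coeffc (n - 2 * p) lam m * κ ^ 2) * back wp 4 m x v
        + Form.laplacian (coordM n) g (back wp 2 m) x v
        + 2 * PredForm.d (wm m) x v - 2 * κ ^ 2 * PredForm.d (back wm 4 m) x v := by
    constructor
    · intro h x v
      exact DFunLike.congr_fun (congrFun h x) v
    · intro h
      funext x
      apply ContinuousAlternatingMap.ext
      exact h x
  rw [key]
  refine forall_congr' fun x => forall_congr' fun v => ?_
  rw [sum_back_plusPoly, sub_eq_zero, eq_comm, ← apply_back (fun w : Form (𝓡 n) M p => w x v) rfl,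
    ← apply_back (fun w : Form (𝓡 n) M p => w x v) rfl,
    ← apply_back (fun w : Form (𝓡 n) M p => Form.laplacian (coordM n) g w x v) (h2 x v),
    ← apply_back (fun w : PredForm (𝓡 n) M p => PredForm.d w x v) (h3 x v)]

theorem minusRecurrence_iff (g : MetricField (𝓡 n) M) (κ : ℝ) (lam : ℂ)
    (wp : ℕ → Form (𝓡 n) M p) (wm : ℕ → PredForm (𝓡 n) M p) (m : ℕ) :
    MinusRecurrence g κ lam wp wm m ↔ ∀ x v s,
      ∑ k : Fin 4, back (minusPoly κ (n - 2 * p) lam (fun j => predEval (wm j) x v s)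
        (fun j => predEval (PredForm.laplacian (coordM n) g (wm j)) x v s)
        (fun j => predEval (Form.codiffPred (coordM n) g (wp j)) x v s) k)
          (2 * (k : ℕ)) m = 0 := by
  have h2 : ∀ x v s, (fun (w : PredForm (𝓡 n) M p) =>
      predEval (PredForm.laplacian (coordM n) g w) x v s) 0 = 0 := by
    intro x v s
    simp only [laplacian_zero_predForm, predEval_zero]
  have h3 : ∀ x v s, (fun (w : Form (𝓡 n) M p) =>
      predEval (Form.codiffPred (coordM n) g w) x v s) 0 = 0 := by
    intro x v s
    simp only [codiffPred_zero_form, predEval_zero]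
  have key : ∀ η θ : PredForm (𝓡 n) M p, η = θ ↔ ∀ x v s, predEval η x v s = predEval θ x v s :=
    fun η θ => ⟨fun h x v s => by rw [h], predForm_ext⟩
  unfold MinusRecurrence
  rw [key]
  refine forall_congr' fun x => forall_congr' fun v => forall_congr' fun s => ?_
  rw [sum_back_minusPoly, sub_eq_zero, eq_comm,
    ← apply_back (fun w : PredForm (𝓡 n) M p => predEval w x v s) (predEval_zero x v s),
    ← apply_back (fun w : PredForm (𝓡 n) M p => predEval w x v s) (predEval_zero x v s),
    ← apply_back (fun w : PredForm (𝓡 n) M p => predEval w x v s) (predEval_zero x v s),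
    ← apply_back (fun w => predEval (PredForm.laplacian (coordM n) g w) x v s) (h2 x v s),
    ← apply_back (fun w => predEval (PredForm.laplacian (coordM n) g w) x v s) (h2 x v s),
    ← apply_back (fun w => predEval (Form.codiffPred (coordM n) g w) x v s) (h3 x v s),
    ← apply_back (fun w => predEval (Form.codiffPred (coordM n) g w) x v s) (h3 x v s)]
  simp only [predEval_add, predEval_sub, predEval_smul]

variable [IsManifold (𝓡 n) ∞ M]

/-- A formal series solves the eigenequation if and only if its coefficients satisfy all the
recurrence relations, including those of index `0`. -/
theorem isFormalEigenform_iff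
    (h : Bundle.ContMDiffRiemannianMetric (𝓡 n) ∞ (EuclideanSpace ℝ (Fin n))
      (fun x : M => TangentSpace (𝓡 n) x)) (κ : ℝ)
    {g : MetricField (𝓡 n) M} (hg : g = fun x u v => h.inner x u v) (lam : ℂ)
    (wp : ℕ → Form (𝓡 n) M p) (wm : ℕ → PredForm (𝓡 n) M p)
    (hwp : ∀ j, Form.IsSmooth (wp j)) (hwm : ∀ j, PredForm.IsSmooth (wm j)) :
    IsFormalEigenform g κ lam wp wm
      ↔ ∀ j, MinusRecurrence g κ lam wp wm j ∧ PlusRecurrence g κ lam wp wm j := by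
  set β : ℂ := n - 2 * p with hβ
  let tp : (x : M) → (Fin p → TangentSpace (𝓡 n) x) → ℕ → ℝ → ℂ := fun x v j r =>
    plusTerm κ β (lam + j) (wp j x v) (Form.laplacian (coordM n) g (wp j) x v)
      (PredForm.d (wm j) x v) r - lam * (β - lam) * wp j x v
  let tm : (x : M) → (Fin p → TangentSpace (𝓡 n) x) → (Fin p → ℝ) → ℕ → ℝ → ℂ := fun x v s j r =>
    minusTerm κ β (lam + j) (predEval (wm j) x v s)
      (predEval (PredForm.laplacian (coordM n) g (wm j)) x v s)
      (predEval (Form.codiffPred (coordM n) g (wp j)) x v s) r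
      - lam * (β - lam) * predEval (wm j) x v s
  -- Every normal term is linear in `s`, hence absent for purely tangential vectors.
  have htm0 : ∀ x v j r, tm x v 0 j r = 0 := by
    intro x v j r
    simp only [tm, minusTerm, predEval_zero_right]
    ring
  have hP := fun (x : M) (v : Fin p → TangentSpace (𝓡 n) x) (N : ℕ) =>
    isBigO_term_iff (κ := κ) lam 2 (tp x v) _
      (fun j r hr => plusPoly_spec β lam (fun j => wp j x v)
        (fun j => Form.laplacian (coordM n) g (wp j) x v) (fun j => PredForm.d (wm j) x v) j hr)
      (N + 1)
  have hM := fun (x : M) (v : Fin p → TangentSpace (𝓡 n) x) (s : Fin p → ℝ) (N : ℕ) =>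
    isBigO_term_iff (κ := κ) lam 3 (tm x v s) _
      (fun j r hr => minusPoly_spec β lam (fun j => predEval (wm j) x v s)
        (fun j => predEval (PredForm.laplacian (coordM n) g (wm j)) x v s)
        (fun j => predEval (Form.codiffPred (coordM n) g (wp j)) x v s) j hr)
      (N + 1)
  have herr : ∀ (N : ℕ) (x : M) (v : Fin p → TangentSpace (𝓡 n) x) (s : Fin p → ℝ),
      (fun r : ℝ =>
        Form.laplacian (coordX n) (poincareMetric g κ) (ansatz lam wp wm N) (x, r) (frame v s r)
          - lam * ((n : ℂ) - 2 * p - lam) * ansatz lam wp wm N (x, r) (frame v s r))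
      =ᶠ[𝓝[>] 0] fun r : ℝ =>
        ∑ j ∈ Finset.range (N + 1), (r : ℂ) ^ (lam + j) * tp x v j r
          + ∑ j ∈ Finset.range (N + 1), (r : ℂ) ^ (lam + j) * tm x v s j r := by
    intro N x v s
    filter_upwards [poincareDomain_mem_nhdsGT κ] with r hr
    rw [laplacian_ansatz_frame h κ hg lam wp wm hwp hwm N x hr v s,
      ansatz_frame lam wp wm N x hr.1 v s, Finset.mul_sum, ← Finset.sum_sub_distrib,
      ← Finset.sum_add_distrib]
    refine Finset.sum_congr rfl fun j _ => ?_
    simp only [tp, tm, hβ]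
    ring
  have hcast : ∀ N : ℕ, lam + ((N : ℂ) + 1) = lam + ((N + 1 : ℕ) : ℂ) := by
    intro N
    push_cast
    ring
  have hsplit : IsFormalEigenform g κ lam wp wm ↔
      ∀ (N : ℕ) (x : M) (v : Fin p → TangentSpace (𝓡 n) x) (s : Fin p → ℝ),
        (fun r : ℝ => ∑ j ∈ Finset.range (N + 1), (r : ℂ) ^ (lam + j) * tm x v s j r)
            =O[𝓝[>] 0] (fun r : ℝ => (r : ℂ) ^ (lam + ((N + 1 : ℕ) : ℂ))) ∧
          (fun r : ℝ => ∑ j ∈ Finset.range (N + 1), (r : ℂ) ^ (lam + j) * tp x v j r)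
            =O[𝓝[>] 0] (fun r : ℝ => (r : ℂ) ^ (lam + ((N + 1 : ℕ) : ℂ))) := by
    constructor
    -- Inserting `s = 0` isolates the tangential error; subtracting it from the full error leaves
    -- the normal one.
    · intro H N x v s
      have H1 : ∀ s, _ := fun s => (H N x v s).congr' (herr N x v s) Filter.EventuallyEq.rfl
      simp only [hcast] at H1
      have H2 := H1 0
      simp only [htm0, mul_zero, Finset.sum_const_zero, add_zero] at H2
      refine ⟨?_, H2⟩
      simpa using (H1 s).sub H2
    · intro H N x v s
      refine Asymptotics.IsBigO.congr' ?_ (herr N x v s).symm Filter.EventuallyEq.rfl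
      simp only [hcast]
      exact (H N x v s).2.add (H N x v s).1
  rw [hsplit]
  constructor
  -- The partial sum with `N = j` is controlled to order `r^(λ+j+1)`, just enough to reach the
  -- coefficient of index `j`.
  · intro H j
    rw [minusRecurrence_iff, plusRecurrence_iff]
    exact ⟨fun x v s => (hM x v s j).1 (H j x v s).1 j (Nat.lt_succ_self j),
      fun x v => (hP x v j).1 (H j x v 0).2 j (Nat.lt_succ_self j)⟩
  · intro H N x v s
    refine ⟨(hM x v s N).2 fun m _ => ?_, (hP x v N).2 fun m _ => ?_⟩
    · exact (minusRecurrence_iff g κ lam wp wm m).1 (H m).1 x v s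
    · exact (plusRecurrence_iff g κ lam wp wm m).1 (H m).2 x v

end Eigenequation

end FormLaplace

end

/-! ### Parity -/

noncomputable section

namespace FormLaplace

section Parity

theorem back_eq_zero_of_odd {V : Type*} [Zero V] {w : ℕ → V} {k i : ℕ} (hk : Even k) (hk0 : 0 < k)
    (hi : Odd i) (hw : ∀ l < i, Odd l → w l = 0) : back w k i = 0 := by
  unfold back
  split_ifs with h
  · exact hw _ (by omega) (Nat.Odd.sub_even h hi hk)
  · rfl

theorem back_congr_of_even {V : Type*} [Zero V] {w w' : ℕ → V} {k i : ℕ} (hk : Even k)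
    (hi : Even i) (hw : ∀ l, Even l → w l = w' l) : back w k i = back w' k i := by
  unfold back
  split_ifs with h
  · exact hw _ ((Nat.even_sub h).2 (iff_of_true hi hk))
  · rfl

variable {n : ℕ} {M : Type*} [TopologicalSpace M] [ChartedSpace (EuclideanSpace ℝ (Fin n)) M]
  {p : ℕ}

theorem isSmooth_zero_form {k : ℕ} : Form.IsSmooth (0 : Form (𝓡 n) M k) := by
  intro x
  rw [inChart_zero_form]
  exact contDiffOn_const

theorem minusRecurrence_scalar_iff (g : MetricField (𝓡 n) M) (κ : ℝ) (lam : ℂ)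
    (wp : ℕ → Form (𝓡 n) M p) (wm : ℕ → PredForm (𝓡 n) M p) (m : ℕ) :
    MinusRecurrence g κ lam wp wm m ↔ ∀ x v s,
      coeffB (n - 2 * p) lam m * κ * back (fun j => predEval (wm j) x v s) 2 m
        + coeffC (n - 2 * p) lam m * κ ^ 2 * back (fun j => predEval (wm j) x v s) 4 m
        + coeffD (n - 2 * p) lam m * κ ^ 3 * back (fun j => predEval (wm j) x v s) 6 m
        + back (fun j => predEval (PredForm.laplacian (coordM n) g (wm j)) x v s) 2 m
        - κ * back (fun j => predEval (PredForm.laplacian (coordM n) g (wm j)) x v s) 4 m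
        + 2 * back (fun j => predEval (Form.codiffPred (coordM n) g (wp j)) x v s) 2 m
        + 2 * κ * back (fun j => predEval (Form.codiffPred (coordM n) g (wp j)) x v s) 4 m
        - coeffA (n - 2 * p) lam m * predEval (wm m) x v s = 0 := by
  simp only [minusRecurrence_iff, sum_back_minusPoly]

theorem plusRecurrence_scalar_iff (g : MetricField (𝓡 n) M) (κ : ℝ) (lam : ℂ)
    (wp : ℕ → Form (𝓡 n) M p) (wm : ℕ → PredForm (𝓡 n) M p) (m : ℕ) :
    PlusRecurrence g κ lam wp wm m ↔ ∀ x v,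
      coeffb (n - 2 * p) lam m * κ * back (fun j => wp j x v) 2 m
        + coeffc (n - 2 * p) lam m * κ ^ 2 * back (fun j => wp j x v) 4 m
        + back (fun j => Form.laplacian (coordM n) g (wp j) x v) 2 m
        + 2 * PredForm.d (wm m) x v
        - 2 * κ ^ 2 * back (fun j => PredForm.d (wm j) x v) 4 m
        - coeffa (n - 2 * p) lam m * wp m x v = 0 := by
  simp only [plusRecurrence_iff, sum_back_plusPoly]

theorem form_apply_zero (x : M) (v : Fin p → TangentSpace (𝓡 n) x) :
    (0 : Form (𝓡 n) M p) x v = 0 := rfl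

/-- All shifted terms are absent and `A_0 = -2λ`. -/
theorem minusRecurrence_index_zero (g : MetricField (𝓡 n) M) (κ : ℝ) (lam : ℂ)
    (wp : ℕ → Form (𝓡 n) M p) (wm : ℕ → PredForm (𝓡 n) M p) :
    MinusRecurrence g κ lam wp wm 0 ↔ ∀ x v s, lam * predEval (wm 0) x v s = 0 := by
  rw [minusRecurrence_scalar_iff]
  refine forall_congr' fun x => forall_congr' fun v => forall_congr' fun s => ?_
  have e : coeffA (n - 2 * p) lam 0 = -2 * lam := by
    simp only [coeffA]
    push_cast
    ring
  simp [back, e]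

/-- Since `a_0 = 0`, the coefficient `ω⁺_0` is free and the only remaining term is `dω⁻_0`. -/
theorem plusRecurrence_index_zero (g : MetricField (𝓡 n) M) (κ : ℝ) (lam : ℂ)
    (wp : ℕ → Form (𝓡 n) M p) {wm : ℕ → PredForm (𝓡 n) M p} (h0 : wm 0 = 0) :
    PlusRecurrence g κ lam wp wm 0 := by
  rw [plusRecurrence_scalar_iff]
  intro x v
  simp [back, h0, d_zero_predForm, coeffa]

/-- The odd coefficients vanish as long as the recurrence relations determine them. -/
theorem odd_eq_zero {g : MetricField (𝓡 n) M} {κ : ℝ} {lam : ℂ}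
    {wp : ℕ → Form (𝓡 n) M p} {wm : ℕ → PredForm (𝓡 n) M p}
    (H : ∀ j, MinusRecurrence g κ lam wp wm j ∧ PlusRecurrence g κ lam wp wm j) {m : ℕ}
    (hm : ∀ i ≤ m, Odd i → coeffa (n - 2 * p) lam i ≠ 0 ∧ (p ≠ 0 → coeffA (n - 2 * p) lam i ≠ 0))
    (i : ℕ) (him : i ≤ m) (hi : Odd i) : wp i = 0 ∧ wm i = 0 := by
  induction i using Nat.strong_induction_on with
  | _ i ih =>
    have hback : ∀ (a : ℕ → ℂ), (∀ l, Odd l → wp l = 0 ∧ wm l = 0 → a l = 0) →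
        ∀ k, Even k → 0 < k → back a k i = 0 := fun a ha k hk hk0 =>
      back_eq_zero_of_odd hk hk0 hi fun l hl hlo => ha l hlo (ih l hl (hl.le.trans him) hlo)
    have e2 : Even 2 := by decide
    have e4 : Even 4 := by decide
    have e6 : Even 6 := by decide
    -- The normal coefficient comes first: the tangential recurrence at index `i` contains `dω⁻_i`,
    -- while the normal one involves only smaller indices besides `ω⁻_i`. For `p = 0` there is no
    -- normal part and `A_i` plays no role.
    have hminus : wm i = 0 := by
      by_cases hp : p = 0
      · subst hp
        exact predForm_zero_degree _
      · apply predForm_ext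
        intro x v s
        have h := (minusRecurrence_scalar_iff g κ lam wp wm i).1 (H i).1 x v s
        have h1 := hback (fun j => predEval (wm j) x v s) fun l _ hl => by
          simp only [hl.2, predEval_zero]
        have h2 := hback (fun j => predEval (PredForm.laplacian (coordM n) g (wm j)) x v s)
          fun l _ hl => by simp only [hl.2, laplacian_zero_predForm, predEval_zero]
        have h3 := hback (fun j => predEval (Form.codiffPred (coordM n) g (wp j)) x v s)
          fun l _ hl => by simp only [hl.1, codiffPred_zero_form, predEval_zero]
        rw [h1 2 e2 (by omega), h1 4 e4 (by omega), h1 6 e6 (by omega), h2 2 e2 (by omega),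
          h2 4 e4 (by omega), h3 2 e2 (by omega), h3 4 e4 (by omega)] at h
        rw [predEval_zero]
        simpa [(hm i him hi).2 hp] using h
    refine ⟨?_, hminus⟩
    funext x
    apply ContinuousAlternatingMap.ext
    intro v
    have h := (plusRecurrence_scalar_iff g κ lam wp wm i).1 (H i).2 x v
    have h1 := hback (fun j => wp j x v) fun l _ hl => by
      simp only [hl.1, form_apply_zero]
    have h2 := hback (fun j => Form.laplacian (coordM n) g (wp j) x v) fun l _ hl => by
      simp only [hl.1, laplacian_zero_form, form_apply_zero]
    have h3 := hback (fun j => PredForm.d (wm j) x v) fun l _ hl => by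
      simp only [hl.2, d_zero_predForm, form_apply_zero]
    rw [h1 2 e2 (by omega), h1 4 e4 (by omega), h2 2 e2 (by omega), h3 4 e4 (by omega), hminus,
      d_zero_predForm, form_apply_zero] at h
    rw [form_apply_zero]
    simpa [(hm i him hi).1] using h

/-- The recurrence relations persist if the odd coefficients are replaced by zero. -/
theorem recurrence_even_part {g : MetricField (𝓡 n) M} {κ : ℝ} {lam : ℂ}
    {wp : ℕ → Form (𝓡 n) M p} {wm : ℕ → PredForm (𝓡 n) M p} (j : ℕ)
    (H : MinusRecurrence g κ lam wp wm j ∧ PlusRecurrence g κ lam wp wm j) :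
    MinusRecurrence g κ lam (fun j => if Odd j then 0 else wp j)
        (fun j => if Odd j then 0 else wm j) j
      ∧ PlusRecurrence g κ lam (fun j => if Odd j then 0 else wp j)
        (fun j => if Odd j then 0 else wm j) j := by
  have e2 : Even 2 := by decide
  have e4 : Even 4 := by decide
  have e6 : Even 6 := by decide
  obtain ⟨wp', hwp'⟩ : ∃ w : ℕ → Form (𝓡 n) M p, w = fun j => if Odd j then 0 else wp j :=
    ⟨_, rfl⟩
  obtain ⟨wm', hwm'⟩ : ∃ w : ℕ → PredForm (𝓡 n) M p, w = fun j => if Odd j then 0 else wm j :=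
    ⟨_, rfl⟩
  have po : ∀ l, Odd l → wp' l = 0 := fun l hl => by rw [hwp']; exact if_pos hl
  have mo : ∀ l, Odd l → wm' l = 0 := fun l hl => by rw [hwm']; exact if_pos hl
  have pe : ∀ l, Even l → wp' l = wp l := fun l hl => by
    rw [hwp']; exact if_neg (Nat.not_odd_iff_even.2 hl)
  have me : ∀ l, Even l → wm' l = wm l := fun l hl => by
    rw [hwm']; exact if_neg (Nat.not_odd_iff_even.2 hl)
  rw [← hwp', ← hwm', minusRecurrence_scalar_iff, plusRecurrence_scalar_iff]
  -- At even indices the even shifts only see unchanged coefficients; at odd indices every term is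
  -- zero.
  rcases Nat.even_or_odd j with hj | hj
  · have hback : ∀ (a a' : ℕ → ℂ), (∀ l, wp' l = wp l → wm' l = wm l → a l = a' l) →
        ∀ k, Even k → back a k j = back a' k j := fun a a' ha k hk =>
      back_congr_of_even hk hj fun l hl => ha l (pe l hl) (me l hl)
    constructor
    · intro x v s
      have h1 := hback (fun j => predEval (wm' j) x v s) (fun j => predEval (wm j) x v s)
        fun l _ h => by simp only [h]
      have h2 := hback (fun j => predEval (PredForm.laplacian (coordM n) g (wm' j)) x v s)
        (fun j => predEval (PredForm.laplacian (coordM n) g (wm j)) x v s)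
        fun l _ h => by simp only [h]
      have h3 := hback (fun j => predEval (Form.codiffPred (coordM n) g (wp' j)) x v s)
        (fun j => predEval (Form.codiffPred (coordM n) g (wp j)) x v s)
        fun l h _ => by simp only [h]
      rw [h1 2 e2, h1 4 e4, h1 6 e6, h2 2 e2, h2 4 e4, h3 2 e2, h3 4 e4, me j hj]
      exact (minusRecurrence_scalar_iff g κ lam wp wm j).1 H.1 x v s
    · intro x v
      have h1 := hback (fun j => wp' j x v) (fun j => wp j x v) fun l h _ => by simp only [h]
      have h2 := hback (fun j => Form.laplacian (coordM n) g (wp' j) x v)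
        (fun j => Form.laplacian (coordM n) g (wp j) x v) fun l h _ => by simp only [h]
      have h3 := hback (fun j => PredForm.d (wm' j) x v) (fun j => PredForm.d (wm j) x v)
        fun l _ h => by simp only [h]
      rw [h1 2 e2, h1 4 e4, h2 2 e2, h3 4 e4, me j hj, pe j hj]
      exact (plusRecurrence_scalar_iff g κ lam wp wm j).1 H.2 x v
  · have hback : ∀ (a : ℕ → ℂ), (∀ l, wp' l = 0 → wm' l = 0 → a l = 0) →
        ∀ k, Even k → 0 < k → back a k j = 0 := fun a ha k hk hk0 =>
      back_eq_zero_of_odd hk hk0 hj fun l _ hl => ha l (po l hl) (mo l hl)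
    constructor
    · intro x v s
      have h1 := hback (fun j => predEval (wm' j) x v s) fun l _ h => by
        simp only [h, predEval_zero]
      have h2 := hback (fun j => predEval (PredForm.laplacian (coordM n) g (wm' j)) x v s)
        fun l _ h => by simp only [h, laplacian_zero_predForm, predEval_zero]
      have h3 := hback (fun j => predEval (Form.codiffPred (coordM n) g (wp' j)) x v s)
        fun l h _ => by simp only [h, codiffPred_zero_form, predEval_zero]
      rw [h1 2 e2 (by omega), h1 4 e4 (by omega), h1 6 e6 (by omega), h2 2 e2 (by omega),
        h2 4 e4 (by omega), h3 2 e2 (by omega), h3 4 e4 (by omega), mo j hj, predEval_zero]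
      ring
    · intro x v
      have h1 := hback (fun j => wp' j x v) fun l h _ => by simp only [h, form_apply_zero]
      have h2 := hback (fun j => Form.laplacian (coordM n) g (wp' j) x v) fun l h _ => by
        simp only [h, laplacian_zero_form, form_apply_zero]
      have h3 := hback (fun j => PredForm.d (wm' j) x v) fun l _ h => by
        simp only [h, d_zero_predForm, form_apply_zero]
      rw [h1 2 e2 (by omega), h1 4 e4 (by omega), h2 2 e2 (by omega), h3 4 e4 (by omega), mo j hj,
        po j hj, d_zero_predForm, form_apply_zero]
      ring

end Parity

end FormLaplace

end

theorem proposition3p2 {n : ℕ} (hn : 3 ≤ n)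
    {M : Type*} [TopologicalSpace M] [ChartedSpace (EuclideanSpace ℝ (Fin n)) M]
    [IsManifold (𝓡 n) ∞ M]
    (h : Bundle.ContMDiffRiemannianMetric (𝓡 n) ∞ (EuclideanSpace ℝ (Fin n))
      (fun x : M => TangentSpace (𝓡 n) x))
    (g : MetricField (𝓡 n) M) (hg : g = fun x u v => h.inner x u v)
    (J : ℝ) (hJ : IsEinstein (coordM n) g (2 * J / n * (n - 1)))
    (κ : ℝ) (hκ : κ = J / (2 * n))
    (p : ℕ) (lam β : ℂ) (hβ : β = (n : ℂ) - 2 * p)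
    (wp : ℕ → Form (𝓡 n) M p) (wm : ℕ → PredForm (𝓡 n) M p)
    (hwp : ∀ j, Form.IsSmooth (wp j)) (hwm : ∀ j, PredForm.IsSmooth (wm j)) :
    -- the eigenequation is equivalent to the recurrence relations
    (wm 0 = 0 →
      (IsFormalEigenform g κ lam wp wm ↔
        ∀ j : ℕ, 1 ≤ j →
          MinusRecurrence g κ lam wp wm j ∧ PlusRecurrence g κ lam wp wm j)) ∧
    -- the initial condition `ω⁻_0 = 0` is automatic for `λ ≠ 0`
    (lam ≠ 0 → IsFormalEigenform g κ lam wp wm → wm 0 = 0) ∧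
    -- the odd coefficients vanish, as long as the recurrence relations determine them
    (wm 0 = 0 → IsFormalEigenform g κ lam wp wm →
      ∀ m : ℕ,
        (∀ i ≤ m, Odd i → coeffa β lam i ≠ 0 ∧ (p ≠ 0 → coeffA β lam i ≠ 0)) →
        ∀ i ≤ m, Odd i → wp i = 0 ∧ wm i = 0) ∧
    -- for all `λ`, the odd coefficients may be taken to be zero
    (wm 0 = 0 → IsFormalEigenform g κ lam wp wm →
      IsFormalEigenform g κ lam (fun j => if Odd j then 0 else wp j)
        (fun j => if Odd j then 0 else wm j)) := by
  subst hβ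
  have key := isFormalEigenform_iff h κ hg lam wp wm hwp hwm
  refine ⟨fun h0 => key.trans ⟨fun H j _ => H j, fun H j => ?_⟩, fun hlam H => ?_,
    fun _ H m hm i him hi => odd_eq_zero (key.1 H) hm i him hi, fun _ H => ?_⟩
  -- The stated relations start at `j = 1`; those of index `0` follow from `wm 0 = 0`.
  · rcases Nat.eq_zero_or_pos j with rfl | hj
    · refine ⟨(minusRecurrence_index_zero g κ lam wp wm).2 fun x v s => ?_,
        plusRecurrence_index_zero g κ lam wp h0⟩
      rw [h0, predEval_zero, mul_zero]
    · exact H j hj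
  · refine predForm_ext fun x v s => ?_
    rw [predEval_zero]
    exact (mul_eq_zero.1 ((minusRecurrence_index_zero g κ lam wp wm).1
      (key.1 H 0).1 x v s)).resolve_left hlam
  · refine (isFormalEigenform_iff h κ hg lam _ _ (fun j => ?_) (fun j => ?_)).2
      fun j => recurrence_even_part j (key.1 H j)
    · split_ifs
      · exact isSmooth_zero_form
      · exact hwp j
    · split_ifs
      · exact fun q => isSmooth_zero_form
      · exact hwm j
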